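/- **Conventions.** Rings are associative and unital. A left bialgebroid $\mathcal H_L=(H,L,s_L,t_L,\gamma_L,\pi_L)$ consists of rings $H,L$, ring homomorphisms $s_L:L\to H$, $t_L:L^{op}\to H$ with commuting images, a coproduct $\gamma_L(h)=h_{(1)}\otimes h_{(2)}\in H_L\otimes{}_LH$ and a counit $\pi_L:H\to L$ with the usual axioms, with respect to $l\cdot h\cdot l'=s_L(l)t_L(l')h$; a right bialgebroid $\mathcal H_R=(H,R,s_R,t_R,\gamma_R,\pi_R)$, $\gamma_R(h)=h^{(1)}\otimes h^{(2)}$, is the mirror notion, with respect to $r\cdot h\cdot r'=h\,s_R(r')t_R(r)$. A Hopf algebroid $\mathcal H=(\mathcal H_L,\mathcal H_R,S)$ is a left and a right bialgebroid on the same ring $H$ with $R\cong L^{op}$, $s_L(L)=t_R(R)$, $t_L(L)=s_R(R)$, $(\gamma_L\otimes 1)\gamma_R=(1\otimes\gamma_R)\gamma_L$, $(\gamma_R\otimes 1)\gamma_L=(1\otimes\gamma_L)\gamma_R$, and an additive bijection $S:H\to H$ with $S(t_L(l)ht_L(l'))=s_L(l')S(h)s_L(l)$, $S(t_R(r')ht_R(r))=s_R(r)S(h)s_R(r')$,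 $S(h_{(1)})h_{(2)}=s_R\pi_R(h)$, $h^{(1)}S(h^{(2)})=s_L\pi_L(h)$. A strict isomorphism of Hopf algebroids is an isomorphism $(\Phi,\phi)$ of the underlying left bialgebroids ($\Phi$ on the total rings, $\phi$ on the base rings) with $\Phi\circ S=S'\circ\Phi$. An element $i\in H$ is a left integral if $hi=s_L\pi_L(h)i$ for all $h$, and a right integral if $ih=is_R\pi_R(h)$ for all $h$; it is two-sided if it is both. Let ${}_*H=\mathrm{Hom}({}_LH,{}_LL)$ and $H_*=\mathrm{Hom}(H_L,L_L)$, and let ${}_*H$ have the product $(\varphi\psi)(h)=\psi\big(t_L(\varphi(h_{(2)}))h_{(1)}\big)$. A right integral $i$ is non-degenerate if ${}_Li:{}_*H\to H$, $\varphi\mapsto t_L(\varphi(i_{(2)}))i_{(1)}$, and $i_L:H_*\to H$, $\varphi\mapsto s_L(\varphi(i_{(1)}))i_{(2)}$, are bijective; a left integral $i$ is non-degenerate if $\varphi\mapsto i^{(2)}t_R(\varphi(i^{(1)}))$ on $\mathrm{Hom}(H^R,R^R)$ and $\varphi\mapsto i^{(1)}s_R(\varphi(i^{(2)}))$ on $\mathrm{Hom}({}^RH,{}^RR)$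 are bijective. A two-sided integral is called non-degenerate if it is non-degenerate as a left or as a right integral. In an additive bicategory (2-morphisms form abelian groups, both compositions are biadditive, there are finite direct sums of 1-morphisms) let $\iota:a\to b$ be a 1-morphism with a two-sided dual $\bar\iota$, exhibited by $\mathrm{ev}_L:\bar\iota\times\iota\to 1$, $\mathrm{coev}_L:1\to\iota\times\bar\iota$, $\mathrm{ev}_R:\iota\times\bar\iota\to 1$, $\mathrm{coev}_R:1\to\bar\iota\times\iota$ satisfying the four triangle identities ($\iota$ is then a Frobenius 1-morphism). It is of depth 2 (D2) if $\iota\times\bar\iota\times\iota$ is a direct summand of a finite direct sum of copies of $\iota$, and $\bar\iota\times\iota\times\bar\iota$ of copies of $\bar\iota$. A D2 quasi-basis is a finite family of pairs $(y_k,x_k)$ in $A=\mathrm{End}(\iota\times\bar\iota)$ with $\sum_k(y_k\times\iota)\circ(\iota\times\mathrm{coev}_R)\circ(\iota\times\mathrm{ev}_L)\circ(x_k\times\iota)=1_{\iota\times\bar\iota\times\iota}$ (coherence isomorphisms are suppressed here and below; $\circ$ is the vertical composition and the product of $A$). The symmetry of a D2 Frobenius 1-morphism is the Hopf algebroid $\mathcal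 A$ with total ring $A$ and base rings $\mathrm{End}(\iota)$ (left) and $\mathrm{End}(\bar\iota)$ (right) which has the structure maps $$s_L(l)=l\times\bar\iota,\quad t_L(l)=\iota\times\mu(l),\quad \gamma_L(a)=\sum_k a*S_A^{-1}(y_k)\otimes x_k,\quad \pi_L(a)=\phi_L(a\circ i_A),$$ $$s_R(r)=\iota\times r,\quad t_R(r)=\nu^{-1}(r)\times\bar\iota,\quad \gamma_R(a)=\sum_k a*S_A(x_k)\otimes y_k,\quad \pi_R(a)=\nu\big(\phi_L(S_A^{-1}(a)\circ i_A)\big),$$ where $(y_k,x_k)$ is any D2 quasi-basis, $i_A=\mathrm{coev}_L\circ\mathrm{ev}_R$, $\mu(l)=(\mathrm{ev}_L\times\bar\iota)\circ(\bar\iota\times l\times\bar\iota)\circ(\bar\iota\times\mathrm{coev}_L)$, $\nu(l)=(\bar\iota\times\mathrm{ev}_R)\circ(\bar\iota\times l\times\bar\iota)\circ(\mathrm{coev}_R\times\bar\iota)$, $\phi_L(a)=(\iota\times\mathrm{ev}_L)\circ(a\times\iota)\circ(\iota\times\mathrm{coev}_R)$, $a*a'=(\iota\times\mathrm{ev}_L\times\bar\iota)\circ(a\times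 a')\circ(\iota\times\mathrm{coev}_R\times\bar\iota)$, and the antipode is $S_A(a)=(\iota\times\bar\iota\times\mathrm{ev}_R)\circ(\iota\times\mathcal F(a)\times\bar\iota)\circ(\mathrm{coev}_L\times\iota\times\bar\iota)$ with $\mathcal F(a)=(\bar\iota\times\iota\times\mathrm{ev}_L)\circ(\bar\iota\times a\times\iota)\circ(\mathrm{coev}_R\times\bar\iota\times\iota)$. For a monoidal category $\mathcal M$ with coequalizers which are preserved by the tensor product, $\mathbf{BIM}(\mathcal M)$ is the bicategory of monoids, internal bimodules and bimodule maps in $\mathcal M$. The category $\mathcal M_H$ of right $H$-modules is monoidal with the tensor product over $R$ (an $H$-module being an $R$-bimodule by $r\cdot m\cdot r'=m\,s_R(r')t_R(r)$), with the action $(m\otimes n)h=mh^{(1)}\otimes nh^{(2)}$ and the unit $R_H$, $r\cdot h=\pi_R(s_R(r)h)$. **Theorem.** Let $\mathcal H=(\mathcal H_L,\mathcal H_R,S)$ be a Hopf algebroid. (1) Let $i$ be a non-degenerate right integral of $\mathcal H$. Then $S(i)=i$ if and only if $i$ is also a left integral. Suppose that this is the case. Then $\mathbf{BIM}(\mathcal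 M_H)$ is additive; the product $h*k={}_Li\big({}_Li^{-1}(h)\,{}_Li^{-1}(k)\big)$ with the unit $\eta:R\to H$, $r\mapsto i\,s_R(r)$, makes $H_H$ a monoid $\mathcal Q$ in $\mathcal M_H$; and, $\mathcal U$ being the trivial monoid $R_H$ and $l_H,r_H$ the unit isomorphisms of $\mathcal M_H$, the $\mathcal U$-$\mathcal Q$ bimodule $\mathcal X=(H_H,l_H,*)$ is a Frobenius 1-morphism of depth 2 in $\mathbf{BIM}(\mathcal M_H)$, with the two-sided dual $\overline{\mathcal X}=(H_H,*,r_H)$ exhibited by $\mathrm{ev}_L=*$, $\mathrm{coev}_L=\eta$, $\mathrm{ev}_R=\pi_R$, $\mathrm{coev}_R=\gamma_R$ (with $H\otimes_{\mathcal Q}H$ identified with $H$ by $*$, and $H\otimes_{\mathcal U}H$ with $H\otimes_RH$). Its symmetry $\mathcal A$ exists, and the pair $(\Lambda,\Lambda\circ s_L)$, where $\Lambda(h)$ is the left multiplication $k\mapsto hk$ on $H_H$, is a strict isomorphism $\mathcal H\to\mathcal A$ of Hopf algebroids. (2) $\mathcal H$ is strictly isomorphic to the symmetry of a D2 Frobenius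 1-morphism in some additive bicategory if and only if $\mathcal H$ has a two-sided non-degenerate integral; in that case it has a two-sided integral which is non-degenerate both as a left and as a right integral. -/

import Mathlib

open CategoryTheory Limits MulOpposite
open scoped TensorProduct

universe u v w u₁

namespace Algebroid

noncomputable section

section Balanced

variable {R R' M N P T : Type*} [AddCommGroup M] [AddCommGroup N] [AddCommGroup P] [AddCommGroup T]

/-- A biadditive map, as a map on the tensor product of abelian groups. -/
def tlift (f : M →+ N →+ T) : M ⊗[ℤ] N →+ T :=
  TensorProduct.liftAddHom f fun z m n => by simp

@[simp] theorem tlift_tmul (f : M →+ N →+ T) (m : M) (n : N) : tlift f (m ⊗ₜ n) = f m n := rfl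

/-- The tensor product of two additive maps. -/
def tmap {M' N' : Type*} [AddCommGroup M'] [AddCommGroup N'] (f : M →+ M') (g : N →+ N') :
    M ⊗[ℤ] N →+ M' ⊗[ℤ] N' :=
  (TensorProduct.map f.toIntLinearMap g.toIntLinearMap).toAddMonoidHom

@[simp] theorem tmap_tmul {M' N' : Type*} [AddCommGroup M'] [AddCommGroup N'] (f : M →+ M')
    (g : N →+ N') (m : M) (n : N) : tmap f g (m ⊗ₜ n) = f m ⊗ₜ g n := rfl

theorem tensor_hom_ext {f g : M ⊗[ℤ] N →+ T} (h : ∀ m n, f (m ⊗ₜ n) = g (m ⊗ₜ n)) : f = g := by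
  ext x
  induction x with
  | zero => simp
  | tmul m n => exact h m n
  | add x y hx hy => simp [hx, hy]

/-- The subgroup of `M ⊗ N` generated by the elements `m · r ⊗ n - m ⊗ r · n`. -/
def balRel (ρ : M → R → M) (l : R → N → N) : AddSubgroup (M ⊗[ℤ] N) :=
  AddSubgroup.closure {x | ∃ m r n, x = ρ m r ⊗ₜ[ℤ] n - m ⊗ₜ[ℤ] l r n}

/-- The tensor product over a non-commutative ring `R` of a right `R`-module `M`, with action
`ρ`, and a left `R`-module `N`, with action `l`. -/
def Bal (ρ : M → R → M) (l : R → N → N) : Type _ := (M ⊗[ℤ] N) ⧸ balRel ρ l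

instance (ρ : M → R → M) (l : R → N → N) : AddCommGroup (Bal ρ l) :=
  inferInstanceAs (AddCommGroup ((M ⊗[ℤ] N) ⧸ balRel ρ l))

namespace Bal

/-- The canonical projection `M ⊗ N → M ⊗_R N`. -/
def mk (ρ : M → R → M) (l : R → N → N) : M ⊗[ℤ] N →+ Bal ρ l :=
  QuotientAddGroup.mk' (balRel ρ l)

variable {ρ : M → R → M} {l : R → N → N}

theorem mk_surjective : Function.Surjective (mk ρ l) := QuotientAddGroup.mk'_surjective _

theorem mk_balance (m : M) (r : R) (n : N) :
    mk ρ l (ρ m r ⊗ₜ n) = mk ρ l (m ⊗ₜ l r n) := by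
  rw [← sub_eq_zero, ← map_sub]
  exact (QuotientAddGroup.eq_zero_iff _).2 (AddSubgroup.subset_closure ⟨m, r, n, rfl⟩)

/-- The universal property of the tensor product over `R`. -/
def lift (f : M ⊗[ℤ] N →+ T) (h : ∀ m r n, f (ρ m r ⊗ₜ n) = f (m ⊗ₜ l r n)) : Bal ρ l →+ T :=
  QuotientAddGroup.lift (balRel ρ l) f (by
    rw [balRel, AddSubgroup.closure_le]
    rintro _ ⟨m, r, n, rfl⟩
    simp [AddMonoidHom.mem_ker, h])

@[simp] theorem lift_mk (f : M ⊗[ℤ] N →+ T) (h : ∀ m r n, f (ρ m r ⊗ₜ n) = f (m ⊗ₜ l r n))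
    (x : M ⊗[ℤ] N) : lift (ρ := ρ) (l := l) f h (mk ρ l x) = f x := rfl

theorem hom_ext {f g : Bal ρ l →+ T} (h : ∀ m n, f (mk ρ l (m ⊗ₜ n)) = g (mk ρ l (m ⊗ₜ n))) :
    f = g := by
  have : f.comp (mk ρ l) = g.comp (mk ρ l) := tensor_hom_ext h
  ext x
  obtain ⟨x, rfl⟩ := mk_surjective x
  exact DFunLike.congr_fun this x

end Bal

/-- The subgroup of `(M ⊗_R N) ⊗ P` generated by the elements
`(m ⊗ n · r) ⊗ p - (m ⊗ n) ⊗ r · p`. -/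
def balRel3 (ρ : M → R → M) (l : R → N → N) (ρ' : N → R' → N) (l' : R' → P → P) :
    AddSubgroup (Bal ρ l ⊗[ℤ] P) :=
  AddSubgroup.closure {x | ∃ m n r p, x = Bal.mk ρ l (m ⊗ₜ[ℤ] ρ' n r) ⊗ₜ[ℤ] p -
    Bal.mk ρ l (m ⊗ₜ[ℤ] n) ⊗ₜ[ℤ] l' r p}

/-- The triple tensor product `(M ⊗_R N) ⊗_{R'} P`, where `N` is an `R`-`R'`-bimodule. -/
def Bal3 (ρ : M → R → M) (l : R → N → N) (ρ' : N → R' → N) (l' : R' → P → P) : Type _ :=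
  (Bal ρ l ⊗[ℤ] P) ⧸ balRel3 ρ l ρ' l'

instance (ρ : M → R → M) (l : R → N → N) (ρ' : N → R' → N) (l' : R' → P → P) :
    AddCommGroup (Bal3 ρ l ρ' l') :=
  inferInstanceAs (AddCommGroup ((Bal ρ l ⊗[ℤ] P) ⧸ balRel3 ρ l ρ' l'))

namespace Bal3

/-- The canonical projection `(M ⊗_R N) ⊗ P → M ⊗_R N ⊗_{R'} P`. -/
def mkL (ρ : M → R → M) (l : R → N → N) (ρ' : N → R' → N) (l' : R' → P → P) :
    Bal ρ l ⊗[ℤ] P →+ Bal3 ρ l ρ' l' :=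
  QuotientAddGroup.mk' (balRel3 ρ l ρ' l')

variable {ρ : M → R → M} {l : R → N → N} {ρ' : N → R' → N} {l' : R' → P → P}

theorem mkL_balance (m : M) (n : N) (r : R') (p : P) :
    mkL ρ l ρ' l' (Bal.mk ρ l (m ⊗ₜ ρ' n r) ⊗ₜ p) = mkL ρ l ρ' l' (Bal.mk ρ l (m ⊗ₜ n) ⊗ₜ l' r p) := by
  rw [← sub_eq_zero, ← map_sub]
  exact (QuotientAddGroup.eq_zero_iff _).2 (AddSubgroup.subset_closure ⟨m, n, r, p, rfl⟩)

/-- The universal property of the triple tensor product. -/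
def lift (f : Bal ρ l ⊗[ℤ] P →+ T)
    (h : ∀ m n r p, f (Bal.mk ρ l (m ⊗ₜ ρ' n r) ⊗ₜ p) = f (Bal.mk ρ l (m ⊗ₜ n) ⊗ₜ l' r p)) :
    Bal3 ρ l ρ' l' →+ T :=
  QuotientAddGroup.lift (balRel3 ρ l ρ' l') f (by
    rw [balRel3, AddSubgroup.closure_le]
    rintro _ ⟨m, n, r, p, rfl⟩
    simp [AddMonoidHom.mem_ker, h])

@[simp] theorem lift_mkL (f : Bal ρ l ⊗[ℤ] P →+ T)
    (h : ∀ m n r p, f (Bal.mk ρ l (m ⊗ₜ ρ' n r) ⊗ₜ p) = f (Bal.mk ρ l (m ⊗ₜ n) ⊗ₜ l' r p))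
    (x : Bal ρ l ⊗[ℤ] P) : lift (ρ' := ρ') (l' := l') f h (mkL ρ l ρ' l' x) = f x := rfl

/-- For fixed `m`, the map `n ⊗ p ↦ m ⊗ n ⊗ p`. -/
def mkRAux (ρ : M → R → M) (l : R → N → N) (ρ' : N → R' → N) (l' : R' → P → P) (m : M) :
    Bal ρ' l' →+ Bal3 ρ l ρ' l' :=
  Bal.lift ((mkL ρ l ρ' l').comp (tmap ((Bal.mk ρ l).comp (TensorProduct.mk ℤ M N m).toAddMonoidHom)
    (AddMonoidHom.id P))) (fun n r p => by simpa using mkL_balance m n r p)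

/-- The canonical projection `M ⊗ (N ⊗_{R'} P) → M ⊗_R N ⊗_{R'} P`. -/
def mkR (ρ : M → R → M) (l : R → N → N) (ρ' : N → R' → N) (l' : R' → P → P) :
    M ⊗[ℤ] Bal ρ' l' →+ Bal3 ρ l ρ' l' :=
  tlift
    { toFun := mkRAux ρ l ρ' l'
      map_zero' := by
        apply Bal.hom_ext; intro n p
        simp [mkRAux, TensorProduct.zero_tmul]
      map_add' := fun m m' => by
        apply Bal.hom_ext; intro n p
        simp [mkRAux, TensorProduct.add_tmul] }

@[simp] theorem mkR_tmul (m : M) (n : N) (p : P) :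
    mkR ρ l ρ' l' (m ⊗ₜ Bal.mk ρ' l' (n ⊗ₜ p)) = mkL ρ l ρ' l' (Bal.mk ρ l (m ⊗ₜ n) ⊗ₜ p) := rfl

end Bal3

end Balanced

section Bialgebroid

variable {A L R : Type*} [Ring A] [Ring L] [Ring R]

/-- The additive map `m ⊗ n ↦ f(m) g(n)`. -/
def mulMap {M N : Type*} [AddCommGroup M] [AddCommGroup N] (f : M →+ A) (g : N →+ A) :
    M ⊗[ℤ] N →+ A :=
  tlift ((AddMonoidHom.mul.comp f).compr₂ (.id A) |>.compl₂ g)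

@[simp] theorem mulMap_tmul {M N : Type*} [AddCommGroup M] [AddCommGroup N] (f : M →+ A)
    (g : N →+ A) (m : M) (n : N) : mulMap f g (m ⊗ₜ n) = f m * g n := rfl

/-- The additive map `m ⊗ n ↦ g(n) f(m)`. -/
def mulMapSwap {M N : Type*} [AddCommGroup M] [AddCommGroup N] (f : M →+ A) (g : N →+ A) :
    M ⊗[ℤ] N →+ A :=
  tlift ((AddMonoidHom.mul.comp g).flip.comp f)

@[simp] theorem mulMapSwap_tmul {M N : Type*} [AddCommGroup M] [AddCommGroup N] (f : M →+ A)
    (g : N →+ A) (m : M) (n : N) : mulMapSwap f g (m ⊗ₜ n) = g n * f m := rfl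

/-- A ring homomorphism `L^op → A`, as an additive map `L → A`. -/
def addOp (t : Lᵐᵒᵖ →+* A) : L →+ A := t.toAddMonoidHom.comp opAddEquiv.toAddMonoidHom

@[simp] theorem addOp_apply (t : Lᵐᵒᵖ →+* A) (l : L) : addOp t l = t (op l) := rfl

/-- `A_L ⊗ _L A` for the bimodule `l · a · l' = s(l) t(l') a`. -/
abbrev LTensor (s : L →+* A) (t : Lᵐᵒᵖ →+* A) : Type _ :=
  Bal (fun (a : A) (l : L) => t (op l) * a) (fun (l : L) (a : A) => s l * a)

/-- `A_L ⊗ _L A_L ⊗ _L A` for the bimodule `l · a · l' = s(l) t(l') a`. -/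
abbrev LTensor3 (s : L →+* A) (t : Lᵐᵒᵖ →+* A) : Type _ :=
  Bal3 (fun (a : A) (l : L) => t (op l) * a) (fun (l : L) (a : A) => s l * a)
    (fun (a : A) (l : L) => t (op l) * a) (fun (l : L) (a : A) => s l * a)

/-- `A^R ⊗ ^R A` for the bimodule `r · a · r' = a s(r') t(r)`. -/
abbrev RTensor (s : R →+* A) (t : Rᵐᵒᵖ →+* A) : Type _ :=
  Bal (fun (a : A) (r : R) => a * s r) (fun (r : R) (a : A) => a * t (op r))

/-- `A^R ⊗ ^R A^R ⊗ ^R A` for the bimodule `r · a · r' = a s(r') t(r)`. -/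
abbrev RTensor3 (s : R →+* A) (t : Rᵐᵒᵖ →+* A) : Type _ :=
  Bal3 (fun (a : A) (r : R) => a * s r) (fun (r : R) (a : A) => a * t (op r))
    (fun (a : A) (r : R) => a * s r) (fun (r : R) (a : A) => a * t (op r))

/-- `A_L ⊗ _L A^R ⊗ ^R A`. -/
abbrev LRTensor3 (sL : L →+* A) (tL : Lᵐᵒᵖ →+* A) (sR : R →+* A) (tR : Rᵐᵒᵖ →+* A) : Type _ :=
  Bal3 (fun (a : A) (l : L) => tL (op l) * a) (fun (l : L) (a : A) => sL l * a)
    (fun (a : A) (r : R) => a * sR r) (fun (r : R) (a : A) => a * tR (op r))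

/-- `A^R ⊗ ^R A_L ⊗ _L A`. -/
abbrev RLTensor3 (sL : L →+* A) (tL : Lᵐᵒᵖ →+* A) (sR : R →+* A) (tR : Rᵐᵒᵖ →+* A) : Type _ :=
  Bal3 (fun (a : A) (r : R) => a * sR r) (fun (r : R) (a : A) => a * tR (op r))
    (fun (a : A) (l : L) => tL (op l) * a) (fun (l : L) (a : A) => sL l * a)

/-- Left bialgebroids with total ring `A` and base ring `L`. An axiom which is usually written in
Sweedler notation `γ(a) = a₍₁₎ ⊗ a₍₂₎` is stated for every representative `w` in `A ⊗ A` of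
`γ(a)` in `A_L ⊗ _L A`. -/
structure LeftBialgebroid (A L : Type*) [Ring A] [Ring L] where
  s : L →+* A
  t : Lᵐᵒᵖ →+* A
  s_comm_t : ∀ l l' : L, s l * t (op l') = t (op l') * s l
  γ : A →+ LTensor s t
  π : A →+ L
  γ_left : ∀ (l : L) (a : A) (w : A ⊗[ℤ] A), Bal.mk _ _ w = γ a →
    γ (s l * a) = Bal.mk _ _ (tmap (.mulLeft (s l)) (.id A) w)
  γ_right : ∀ (l : L) (a : A) (w : A ⊗[ℤ] A), Bal.mk _ _ w = γ a →
    γ (t (op l) * a) = Bal.mk _ _ (tmap (.id A) (.mulLeft (t (op l))) w)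
  π_left : ∀ (l : L) (a : A), π (s l * a) = l * π a
  π_right : ∀ (l : L) (a : A), π (t (op l) * a) = π a * l
  coassoc : ∀ (a : A) (w : A ⊗[ℤ] A), Bal.mk _ _ w = γ a →
    (Bal3.mkL _ _ _ _ (tmap γ (.id A) w) : LTensor3 s t) = Bal3.mkR _ _ _ _ (tmap (.id A) γ w)
  counit_left : ∀ (a : A) (w : A ⊗[ℤ] A), Bal.mk _ _ w = γ a →
    mulMap (s.toAddMonoidHom.comp π) (.id A) w = a
  counit_right : ∀ (a : A) (w : A ⊗[ℤ] A), Bal.mk _ _ w = γ a →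
    mulMapSwap (.id A) ((addOp t).comp π) w = a
  takeuchi : ∀ (l : L) (a : A) (w : A ⊗[ℤ] A), Bal.mk _ _ w = γ a →
    (Bal.mk _ _ (tmap (.mulRight (t (op l))) (.id A) w) : LTensor s t) =
      Bal.mk _ _ (tmap (.id A) (.mulRight (s l)) w)
  γ_one : γ 1 = Bal.mk _ _ (1 ⊗ₜ 1)
  γ_mul : ∀ (a b : A) (w w' : A ⊗[ℤ] A), Bal.mk _ _ w = γ a → Bal.mk _ _ w' = γ b →
    γ (a * b) = Bal.mk _ _ (w * w')
  π_one : π 1 = 1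
  π_mul_s : ∀ a b : A, π (a * s (π b)) = π (a * b)
  π_mul_t : ∀ a b : A, π (a * t (op (π b))) = π (a * b)

/-- Right bialgebroids with total ring `A` and base ring `R`. An axiom which is usually written in
Sweedler notation `γ(a) = a⁽¹⁾ ⊗ a⁽²⁾` is stated for every representative `w` in `A ⊗ A` of
`γ(a)` in `A^R ⊗ ^R A`. -/
structure RightBialgebroid (A R : Type*) [Ring A] [Ring R] where
  s : R →+* A
  t : Rᵐᵒᵖ →+* A
  s_comm_t : ∀ r r' : R, s r * t (op r') = t (op r') * s r
  γ : A →+ RTensor s t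
  π : A →+ R
  γ_left : ∀ (r : R) (a : A) (w : A ⊗[ℤ] A), Bal.mk _ _ w = γ a →
    γ (a * t (op r)) = Bal.mk _ _ (tmap (.mulRight (t (op r))) (.id A) w)
  γ_right : ∀ (r : R) (a : A) (w : A ⊗[ℤ] A), Bal.mk _ _ w = γ a →
    γ (a * s r) = Bal.mk _ _ (tmap (.id A) (.mulRight (s r)) w)
  π_left : ∀ (r : R) (a : A), π (a * t (op r)) = r * π a
  π_right : ∀ (r : R) (a : A), π (a * s r) = π a * r
  coassoc : ∀ (a : A) (w : A ⊗[ℤ] A), Bal.mk _ _ w = γ a →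
    (Bal3.mkL _ _ _ _ (tmap γ (.id A) w) : RTensor3 s t) = Bal3.mkR _ _ _ _ (tmap (.id A) γ w)
  counit_left : ∀ (a : A) (w : A ⊗[ℤ] A), Bal.mk _ _ w = γ a →
    mulMapSwap ((addOp t).comp π) (.id A) w = a
  counit_right : ∀ (a : A) (w : A ⊗[ℤ] A), Bal.mk _ _ w = γ a →
    mulMap (.id A) (s.toAddMonoidHom.comp π) w = a
  takeuchi : ∀ (r : R) (a : A) (w : A ⊗[ℤ] A), Bal.mk _ _ w = γ a →
    (Bal.mk _ _ (tmap (.mulLeft (s r)) (.id A) w) : RTensor s t) =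
      Bal.mk _ _ (tmap (.id A) (.mulLeft (t (op r))) w)
  γ_one : γ 1 = Bal.mk _ _ (1 ⊗ₜ 1)
  γ_mul : ∀ (a b : A) (w w' : A ⊗[ℤ] A), Bal.mk _ _ w = γ a → Bal.mk _ _ w' = γ b →
    γ (a * b) = Bal.mk _ _ (w * w')
  π_one : π 1 = 1
  π_s_mul : ∀ a b : A, π (s (π a) * b) = π (a * b)
  π_t_mul : ∀ a b : A, π (t (op (π a)) * b) = π (a * b)

/-- Hopf algebroids: a left and a right bialgebroid structure on the same total ring, connected by
a bijective antipode. -/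
structure HopfAlgebroid (A L R : Type*) [Ring A] [Ring L] [Ring R] where
  left : LeftBialgebroid A L
  right : RightBialgebroid A R
  base : Nonempty (R ≃+* Lᵐᵒᵖ)
  range_sL : left.s.range = right.t.range
  range_tL : left.t.range = right.s.range
  coassoc_left_right : ∀ (a : A) (w w' : A ⊗[ℤ] A),
    Bal.mk _ _ w = right.γ a → Bal.mk _ _ w' = left.γ a →
    (Bal3.mkL _ _ _ _ (tmap left.γ (.id A) w) : LRTensor3 left.s left.t right.s right.t) =
      Bal3.mkR _ _ _ _ (tmap (.id A) right.γ w')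
  coassoc_right_left : ∀ (a : A) (w w' : A ⊗[ℤ] A),
    Bal.mk _ _ w = left.γ a → Bal.mk _ _ w' = right.γ a →
    (Bal3.mkL _ _ _ _ (tmap right.γ (.id A) w) : RLTensor3 left.s left.t right.s right.t) =
      Bal3.mkR _ _ _ _ (tmap (.id A) left.γ w')
  /-- The antipode. -/
  S : A ≃+ A
  S_left : ∀ (l l' : L) (a : A),
    S (left.t (op l) * a * left.t (op l')) = left.s l' * S a * left.s l
  S_right : ∀ (r r' : R) (a : A),
    S (right.t (op r') * a * right.t (op r)) = right.s r * S a * right.s r'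
  antipode_left : ∀ (a : A) (w : A ⊗[ℤ] A), Bal.mk _ _ w = left.γ a →
    mulMap S.toAddMonoidHom (.id A) w = right.s (right.π a)
  antipode_right : ∀ (a : A) (w : A ⊗[ℤ] A), Bal.mk _ _ w = right.γ a →
    mulMap (.id A) S.toAddMonoidHom w = left.s (left.π a)

/-- Homomorphisms of left bialgebroids. -/
structure LeftBialgebroid.IsHom {A' L' : Type*} [Ring A'] [Ring L'] (B : LeftBialgebroid A L)
    (B' : LeftBialgebroid A' L') (Φ : A →+* A') (φ : L →+* L') : Prop where
  s : ∀ l, B'.s (φ l) = Φ (B.s l)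
  t : ∀ l, B'.t (op (φ l)) = Φ (B.t (op l))
  π : ∀ a, B'.π (Φ a) = φ (B.π a)
  γ : ∀ (a : A) (w : A ⊗[ℤ] A), Bal.mk _ _ w = B.γ a →
    B'.γ (Φ a) = Bal.mk _ _ (tmap Φ.toAddMonoidHom Φ.toAddMonoidHom w)

/-- Strict isomorphisms of Hopf algebroids: isomorphisms of the underlying left bialgebroids which
commute with the antipodes. -/
structure HopfAlgebroid.IsStrictIso {A' L' R' : Type*} [Ring A'] [Ring L'] [Ring R']
    (H : HopfAlgebroid A L R) (H' : HopfAlgebroid A' L' R') (Φ : A ≃+* A') (φ : L ≃+* L') :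
    Prop where
  isHom : H.left.IsHom H'.left Φ φ
  antipode : ∀ a, Φ (H.S a) = H'.S (Φ a)

namespace LeftBialgebroid

variable (B : LeftBialgebroid A L)

/-- The dual `A_*` of right `L`-module maps `A_L → L_L`. -/
def RDual : Type _ := {φ : A →+ L // ∀ (l : L) (a : A), φ (B.t (op l) * a) = φ a * l}

/-- The dual `_*A` of left `L`-module maps `_L A → _L L`. -/
def LDual : Type _ := {φ : A →+ L // ∀ (l : L) (a : A), φ (B.s l * a) = l * φ a}

/-- The action `a ↼ φ = s(φ(a₍₁₎)) a₍₂₎` of `φ` in `A_*`. -/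
def actRDual (φ : B.RDual) : A →+ A :=
  (Bal.lift (mulMap (B.s.toAddMonoidHom.comp φ.1) (.id A)) (fun a l b => by
    simp [φ.2, mul_assoc]) : LTensor B.s B.t →+ A).comp B.γ

/-- The action `a ↽ φ = t(φ(a₍₂₎)) a₍₁₎` of `φ` in `_*A`. -/
def actLDual (φ : B.LDual) : A →+ A :=
  (Bal.lift (mulMapSwap (.id A) ((addOp B.t).comp φ.1)) (fun a l b => by
    simp [φ.2, mul_assoc]) : LTensor B.s B.t →+ A).comp B.γ

theorem actLDual_s_mul (φ : B.LDual) (l : L) (a : A) :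
    B.actLDual φ (B.s l * a) = B.s l * B.actLDual φ a := by
  obtain ⟨w, hw⟩ := Bal.mk_surjective (B.γ a)
  simp only [actLDual, AddMonoidHom.comp_apply, B.γ_left l a w hw, ← hw, Bal.lift_mk]
  clear hw
  induction w with
  | zero => simp
  | tmul x y => simp [← mul_assoc, B.s_comm_t]
  | add x y hx hy => simp only [map_add, hx, hy, mul_add]

/-- The product `(φψ)(a) = ψ(t(φ(a₍₂₎)) a₍₁₎)` of the dual ring `_*A`. -/
def LDual.mul {B : LeftBialgebroid A L} (φ ψ : B.LDual) : B.LDual :=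
  ⟨ψ.1.comp (B.actLDual φ), fun l a => by simp [actLDual_s_mul, ψ.2]⟩

end LeftBialgebroid

namespace RightBialgebroid

variable (B : RightBialgebroid A R)

/-- The dual `A^*` of right `R`-module maps `A^R → R^R`. -/
def RDual : Type _ := {φ : A →+ R // ∀ (r : R) (a : A), φ (a * B.s r) = φ a * r}

/-- The dual `^*A` of left `R`-module maps `^R A → ^R R`. -/
def LDual : Type _ := {φ : A →+ R // ∀ (r : R) (a : A), φ (a * B.t (op r)) = r * φ a}

/-- The action `φ ⇀ a = a⁽²⁾ t(φ(a⁽¹⁾))` of `φ` in `A^*`. -/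
def actRDual (φ : B.RDual) : A →+ A :=
  (Bal.lift (mulMapSwap ((addOp B.t).comp φ.1) (.id A)) (fun a l b => by
    simp [φ.2, mul_assoc]) : RTensor B.s B.t →+ A).comp B.γ

/-- The action `φ ⇁ a = a⁽¹⁾ s(φ(a⁽²⁾))` of `φ` in `^*A`. -/
def actLDual (φ : B.LDual) : A →+ A :=
  (Bal.lift (mulMap (.id A) (B.s.toAddMonoidHom.comp φ.1)) (fun a l b => by
    simp [φ.2, mul_assoc]) : RTensor B.s B.t →+ A).comp B.γ

end RightBialgebroid

namespace HopfAlgebroid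

variable (H : HopfAlgebroid A L R)

/-- Left integrals. -/
def IsLeftIntegral (i : A) : Prop := ∀ a : A, a * i = H.left.s (H.left.π a) * i

/-- Right integrals. -/
def IsRightIntegral (i : A) : Prop := ∀ a : A, i * a = i * H.right.s (H.right.π a)

/-- Non-degeneracy, as it is required of a left integral: the maps `φ ↦ φ ⇀ i` on `A^*` and
`φ ↦ φ ⇁ i` on `^*A` are bijective. -/
def IsLeftNondegenerate (i : A) : Prop :=
  Function.Bijective (fun φ : H.right.RDual => H.right.actRDual φ i) ∧
  Function.Bijective (fun φ : H.right.LDual => H.right.actLDual φ i)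

/-- Non-degeneracy, as it is required of a right integral: the maps `φ ↦ i ↽ φ` on `_*A` and
`φ ↦ i ↼ φ` on `A_*` are bijective. -/
def IsRightNondegenerate (i : A) : Prop :=
  Function.Bijective (fun φ : H.left.LDual => H.left.actLDual φ i) ∧
  Function.Bijective (fun φ : H.left.RDual => H.left.actRDual φ i)

end HopfAlgebroid

end Bialgebroid

section Bicategories

open Bicategory

/-- Bicategories enriched over abelian groups: the 2-morphisms between two fixed 1-morphisms form
an abelian group, and the vertical and the horizontal composition are biadditive. -/
class PreadditiveBicategory (C : Type u₁) [Bicategory.{w, v} C] where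
  homPreadditive : ∀ a b : C, Preadditive (a ⟶ b)
  whiskerLeft_add : ∀ {a b c : C} (f : a ⟶ b) {g h : b ⟶ c} (η θ : g ⟶ h),
    f ◁ (η + θ) = f ◁ η + f ◁ θ
  add_whiskerRight : ∀ {a b c : C} {f g : a ⟶ b} (η θ : f ⟶ g) (h : b ⟶ c),
    (η + θ) ▷ h = η ▷ h + θ ▷ h

attribute [reducible, instance] PreadditiveBicategory.homPreadditive

/-- Additive bicategories: there are direct sums of 1-morphisms and zero 1-morphisms. -/
class IsAdditiveBicategory (C : Type u₁) [Bicategory.{w, v} C] [PreadditiveBicategory C] :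
    Prop where
  hasFiniteBiproducts : ∀ a b : C, HasFiniteBiproducts (a ⟶ b)

variable {C : Type u₁} [Bicategory.{w, v} C] {a b : C}

/-- A two-sided dual `ι'` of the 1-morphism `ι`, with the 2-morphisms which exhibit it. The horizontal
composite is written in the order of the 1-morphisms, `ι ≫ ι'` being `ι × ι'`. -/
structure FrobeniusDual (ι : a ⟶ b) (ι' : b ⟶ a) where
  /-- Its unit and counit are `coev_L` and `ev_L`. -/
  adjL : Bicategory.Adjunction ι ι'
  /-- Its unit and counit are `coev_R` and `ev_R`. -/
  adjR : Bicategory.Adjunction ι' ι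

/-- `f` is a direct summand of a finite direct sum of copies of `g`. -/
def IsSummandOfPower [PreadditiveBicategory C] (f g : a ⟶ b) : Prop :=
  ∃ (n : ℕ) (β : Fin n → (f ⟶ g)) (β' : Fin n → (g ⟶ f)), ∑ k, β k ≫ β' k = 𝟙 f

/-- The depth 2 condition (left and right) on a 1-morphism `ι` with dual `ι'`. -/
def IsDepthTwo [PreadditiveBicategory C] (ι : a ⟶ b) (ι' : b ⟶ a) : Prop :=
  IsSummandOfPower ((ι ≫ ι') ≫ ι) ι ∧ IsSummandOfPower ((ι' ≫ ι) ≫ ι') ι'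

namespace FrobeniusDual

variable {ι : a ⟶ b} {ι' : b ⟶ a} (F : FrobeniusDual ι ι')

/-- `ev_L : ι' × ι → 1`. -/
abbrev evL : ι' ≫ ι ⟶ 𝟙 b := F.adjL.counit
/-- `coev_L : 1 → ι × ι'`. -/
abbrev coevL : 𝟙 a ⟶ ι ≫ ι' := F.adjL.unit
/-- `ev_R : ι × ι' → 1`. -/
abbrev evR : ι ≫ ι' ⟶ 𝟙 a := F.adjR.counit
/-- `coev_R : 1 → ι' × ι`. -/
abbrev coevR : 𝟙 b ⟶ ι' ≫ ι := F.adjR.unit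

/-- The convolution product on the 2-endomorphisms of `ι × ι'`. -/
def conv (x y : End (ι ≫ ι')) : End (ι ≫ ι') :=
  (ρ_ ι).inv ▷ ι' ≫ (ι ◁ F.coevR) ▷ ι' ≫ (α_ ι ι' ι).inv ▷ ι' ≫ (α_ (ι ≫ ι') ι ι').hom ≫
    (x ▷ (ι ≫ ι') ≫ (ι ≫ ι') ◁ y) ≫
    (α_ (ι ≫ ι') ι ι').inv ≫ (α_ ι ι' ι).hom ▷ ι' ≫ (ι ◁ F.evL) ▷ ι' ≫ (ρ_ ι).hom ▷ ι'

/-- The Fourier transformation `ℱ`. -/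
def fourier (x : End (ι ≫ ι')) : End (ι' ≫ ι) :=
  (λ_ (ι' ≫ ι)).inv ≫ F.coevR ▷ (ι' ≫ ι) ≫ (α_ (ι' ≫ ι) ι' ι).inv ≫ (α_ ι' ι ι').hom ▷ ι ≫
    (ι' ◁ x) ▷ ι ≫
    (α_ ι' ι ι').inv ▷ ι ≫ (α_ (ι' ≫ ι) ι' ι).hom ≫ (ι' ≫ ι) ◁ F.evL ≫ (ρ_ (ι' ≫ ι)).hom

/-- The inverse of the second Fourier transformation
`x ↦ λ ∘ (ev_L × (ι' × ι)) ∘ (ι' × (x × ι)) ∘ ((ι' × ι) × coev_R) ∘ ρ⁻¹`. -/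
def fourierDotInv (y : End (ι' ≫ ι)) : End (ι ≫ ι') :=
  (λ_ (ι ≫ ι')).inv ≫ F.coevL ▷ (ι ≫ ι') ≫ (α_ (ι ≫ ι') ι ι').inv ≫ (α_ ι ι' ι).hom ▷ ι' ≫
    (ι ◁ y) ▷ ι' ≫
    (α_ ι ι' ι).inv ▷ ι' ≫ (α_ (ι ≫ ι') ι ι').hom ≫ (ι ≫ ι') ◁ F.evR ≫ (ρ_ (ι ≫ ι')).hom

/-- The anti-isomorphism `μ` from the 2-endomorphisms of `ι` to those of `ι'`. -/
def mu (l : End ι) : End ι' :=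
  (ρ_ ι').inv ≫ ι' ◁ F.coevL ≫ (α_ ι' ι ι').inv ≫ (ι' ◁ l) ▷ ι' ≫ F.evL ▷ ι' ≫ (λ_ ι').hom

/-- The anti-isomorphism `ν` from the 2-endomorphisms of `ι` to those of `ι'`. -/
def nu (l : End ι) : End ι' :=
  (λ_ ι').inv ≫ F.coevR ▷ ι' ≫ (α_ ι' ι ι').hom ≫ ι' ◁ (l ▷ ι') ≫ ι' ◁ F.evR ≫ (ρ_ ι').hom

/-- The Frobenius map `φ_L` from the 2-endomorphisms of `ι × ι'` to those of `ι`. -/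
def phiL (x : End (ι ≫ ι')) : End ι :=
  (ρ_ ι).inv ≫ ι ◁ F.coevR ≫ (α_ ι ι' ι).inv ≫ x ▷ ι ≫ (α_ ι ι' ι).hom ≫ ι ◁ F.evL ≫ (ρ_ ι).hom

/-- The element `i_A = coev_L ∘ ev_R`. -/
def integral : End (ι ≫ ι') := F.evR ≫ F.coevL

/-- The family `(y k, x k)` is a D2 quasi-basis `∑ y_k ⊗ x_k`. -/
def IsQuasiBasis [PreadditiveBicategory C] {n : ℕ} (y x : Fin n → End (ι ≫ ι')) : Prop :=
  ∑ k, (x k : ι ≫ ι' ⟶ ι ≫ ι') ▷ ι ≫ (α_ ι ι' ι).hom ≫ ι ◁ F.evL ≫ ι ◁ F.coevR ≫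
    (α_ ι ι' ι).inv ≫ (y k : ι ≫ ι' ⟶ ι ≫ ι') ▷ ι = 𝟙 ((ι ≫ ι') ≫ ι)

/-- `𝒜` is the Hopf algebroid which the Frobenius 1-morphism `ι` of depth 2 produces, on the
ring of 2-endomorphisms of `ι × ι'`, over the rings of 2-endomorphisms of `ι` and of `ι'`. All the
structure maps are prescribed; the target map of the right bialgebroid is `r ↦ ν⁻¹(r) × ι'`, and
the coproducts are computed from any D2 quasi-basis. -/
structure IsSymmetry [PreadditiveBicategory C]
    (𝒜 : HopfAlgebroid (End (ι ≫ ι')) (End ι) (End ι')) : Prop where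
  sL : ∀ l : End ι, 𝒜.left.s l = (l : ι ⟶ ι) ▷ ι'
  tL : ∀ l : End ι, 𝒜.left.t (op l) = ι ◁ (F.mu l : ι' ⟶ ι')
  γL : ∀ (n : ℕ) (y x : Fin n → End (ι ≫ ι')), F.IsQuasiBasis y x → ∀ c,
    𝒜.left.γ c = ∑ k, Bal.mk _ _ (F.conv c (𝒜.S.symm (y k)) ⊗ₜ x k)
  πL : ∀ c, 𝒜.left.π c = F.phiL (c * F.integral)
  sR : ∀ r : End ι', 𝒜.right.s r = ι ◁ (r : ι' ⟶ ι')
  tR : ∀ l : End ι, 𝒜.right.t (op (F.nu l)) = (l : ι ⟶ ι) ▷ ι'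
  γR : ∀ (n : ℕ) (y x : Fin n → End (ι ≫ ι')), F.IsQuasiBasis y x → ∀ c,
    𝒜.right.γ c = ∑ k, Bal.mk _ _ (F.conv c (𝒜.S (x k)) ⊗ₜ y k)
  πR : ∀ c, 𝒜.right.π c = F.nu (F.phiL (𝒜.S.symm c * F.integral))
  S : ∀ c, 𝒜.S c = F.fourierDotInv (F.fourier c)

end FrobeniusDual

/-- The Hopf algebroid `H` arises as the symmetry of an abstract D2 Frobenius extension: it is
strictly isomorphic to the Hopf algebroid which a D2 Frobenius 1-morphism in some additive
bicategory produces. -/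
def ArisesAsSymmetry {A L R : Type*} [Ring A] [Ring L] [Ring R] (H : HopfAlgebroid A L R) :
    Prop :=
  ∃ (C : Type u₁) (_ : Bicategory.{w, v} C) (_ : PreadditiveBicategory C)
    (_ : IsAdditiveBicategory C) (a b : C) (ι : a ⟶ b) (ι' : b ⟶ a) (F : FrobeniusDual ι ι')
    (_ : IsDepthTwo ι ι') (𝒜 : HopfAlgebroid (End (ι ≫ ι')) (End ι) (End ι'))
    (Φ : A ≃+* End (ι ≫ ι')) (φ : L ≃+* End ι), F.IsSymmetry 𝒜 ∧ H.IsStrictIso 𝒜 Φ φ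

end Bicategories

section RightModules

variable {H R : Type u} [Ring H] [Ring R] (B : RightBialgebroid H R)

namespace RightBialgebroid

/-- The tensor product `M ⊗_R N` of two right `H`-modules (modules over `Hᵐᵒᵖ`, `op h • m` being
`m · h`), which are `R`-bimodules by `r · m · r' = m · (s(r') t(r))`. -/
def TObj (M N : Type u) [AddCommGroup M] [AddCommGroup N] [Module Hᵐᵒᵖ M] [Module Hᵐᵒᵖ N] :
    Type u :=
  Bal (fun (m : M) (r : R) => op (B.s r) • m) (fun (r : R) (n : N) => op (B.t (op r)) • n)

section TObj

variable (M N P : Type u) [AddCommGroup M] [AddCommGroup N] [AddCommGroup P]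
  [Module Hᵐᵒᵖ M] [Module Hᵐᵒᵖ N] [Module Hᵐᵒᵖ P]

instance : AddCommGroup (B.TObj M N) := inferInstanceAs (AddCommGroup (Bal _ _))

/-- The projection `M ⊗ N → M ⊗_R N`. -/
def tmk : M ⊗[ℤ] N →+ B.TObj M N := Bal.mk _ _

variable {M N P}

theorem tmk_surjective : Function.Surjective (B.tmk M N) := Bal.mk_surjective

theorem tmk_balance (m : M) (r : R) (n : N) :
    B.tmk M N ((op (B.s r) • m) ⊗ₜ n) = B.tmk M N (m ⊗ₜ (op (B.t (op r)) • n)) :=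
  Bal.mk_balance (ρ := fun (m : M) (r : R) => op (B.s r) • m)
    (l := fun (r : R) (n : N) => op (B.t (op r)) • n) m r n

/-- The universal property of `M ⊗_R N`. -/
def tLift {T : Type*} [AddCommGroup T] (f : M →+ N →+ T)
    (h : ∀ m r n, f (op (B.s r) • m) n = f m (op (B.t (op r)) • n)) : B.TObj M N →+ T :=
  Bal.lift (tlift f) h

@[simp] theorem tLift_tmk {T : Type*} [AddCommGroup T] (f : M →+ N →+ T)
    (h : ∀ m r n, f (op (B.s r) • m) n = f m (op (B.t (op r)) • n)) (x : M ⊗[ℤ] N) :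
    B.tLift f h (B.tmk M N x) = tlift f x := rfl

theorem TObj.hom_ext {T : Type*} [AddCommGroup T] {f g : B.TObj M N →+ T}
    (h : ∀ m n, f (B.tmk M N (m ⊗ₜ n)) = g (B.tmk M N (m ⊗ₜ n))) : f = g :=
  Bal.hom_ext h

variable (M N) in
/-- The biadditive map `(m, n) ↦ m ⊗ n`. -/
def tpure : M →+ N →+ B.TObj M N :=
  AddMonoidHom.mk' (fun m => AddMonoidHom.mk' (fun n => B.tmk M N (m ⊗ₜ n))
    (fun n n' => by rw [TensorProduct.tmul_add, map_add]))
    (fun m m' => by ext n; simp [TensorProduct.add_tmul])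

@[simp] theorem tpure_apply (m : M) (n : N) : B.tpure M N m n = B.tmk M N (m ⊗ₜ n) := rfl

/-- For fixed `m` and `n`, the map `h ⊗ k ↦ m · h ⊗ n · k` on `H^R ⊗ ^R H`. -/
def orbit (m : M) (n : N) : RTensor B.s B.t →+ B.TObj M N :=
  Bal.lift ((B.tmk M N).comp (tmap
    (AddMonoidHom.mk' (fun h : H => op h • m) (fun h k => by simp [add_smul]))
    (AddMonoidHom.mk' (fun h : H => op h • n) (fun h k => by simp [add_smul]))))
    (fun h r k => by simpa [mul_smul] using B.tmk_balance (op h • m) r (op k • n))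

@[simp] theorem orbit_mk_tmul (m : M) (n : N) (h k : H) :
    B.orbit m n (Bal.mk _ _ (h ⊗ₜ k)) = B.tmk M N ((op h • m) ⊗ₜ (op k • n)) := rfl

theorem orbit_add_left (m m' : M) (n : N) : B.orbit (m + m') n = B.orbit m n + B.orbit m' n :=
  Bal.hom_ext fun h k => by simp [TensorProduct.add_tmul]

theorem orbit_add_right (m : M) (n n' : N) : B.orbit m (n + n') = B.orbit m n + B.orbit m n' :=
  Bal.hom_ext fun h k => by simp [TensorProduct.tmul_add]

/-- The action `(m ⊗ n) · h = m · h⁽¹⁾ ⊗ n · h⁽²⁾` of an element `h` of `H` on `M ⊗_R N`. -/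
def act (h : H) : B.TObj M N →+ B.TObj M N :=
  B.tLift (AddMonoidHom.mk' (fun m => AddMonoidHom.mk' (fun n => B.orbit m n (B.γ h))
      (fun n n' => by rw [orbit_add_right, AddMonoidHom.add_apply]))
      (fun m m' => by ext n; simp [orbit_add_left]))
    (fun m r n => by
      obtain ⟨w, hw⟩ := Bal.mk_surjective (B.γ h)
      have key := congrArg (B.orbit m n) (B.takeuchi r h w hw)
      simp only [AddMonoidHom.mk'_apply, ← hw]
      have h1 : ∀ w : H ⊗[ℤ] H, B.orbit m n (Bal.mk _ _ (tmap (.mulLeft (B.s r)) (.id H) w)) =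
          B.orbit (op (B.s r) • m) n (Bal.mk _ _ w) := fun w => by
        induction w with
        | zero => simp
        | tmul x y => simp [mul_smul]
        | add x y hx hy => simp only [map_add, hx, hy]
      have h2 : ∀ w : H ⊗[ℤ] H,
          B.orbit m n (Bal.mk _ _ (tmap (.id H) (.mulLeft (B.t (op r))) w)) =
          B.orbit m (op (B.t (op r)) • n) (Bal.mk _ _ w) := fun w => by
        induction w with
        | zero => simp
        | tmul x y => simp [mul_smul]
        | add x y hx hy => simp only [map_add, hx, hy]
      rw [← h1, ← h2, key])

@[simp] theorem act_tmk (h : H) (m : M) (n : N) :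
    B.act h (B.tmk M N (m ⊗ₜ n)) = B.orbit m n (B.γ h) := rfl

theorem act_orbit (h : H) (m : M) (n : N) (w w' : H ⊗[ℤ] H) (hw : Bal.mk _ _ w' = B.γ h) :
    B.act h (B.orbit m n (Bal.mk _ _ w)) = B.orbit m n (Bal.mk _ _ (w * w')) := by
  induction w with
  | zero => simp
  | add x y hx hy => simp only [map_add, hx, hy, add_mul]
  | tmul x y =>
    simp only [orbit_mk_tmul, act_tmk, ← hw]
    clear hw
    induction w' with
    | zero => simp
    | tmul x' y' => simp [mul_smul]
    | add x y hx hy => simp only [map_add, hx, hy, mul_add]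

instance : Module Hᵐᵒᵖ (B.TObj M N) where
  smul x t := B.act x.unop t
  one_smul t := by
    change B.act (1 : H) t = AddMonoidHom.id _ t
    congr 1
    exact TObj.hom_ext B fun m n => by simp [B.γ_one]
  mul_smul x y t := by
    change B.act (y.unop * x.unop) t = (B.act x.unop).comp (B.act y.unop) t
    congr 1
    refine TObj.hom_ext B fun m n => ?_
    obtain ⟨w, hw⟩ := Bal.mk_surjective (B.γ x.unop)
    obtain ⟨w', hw'⟩ := Bal.mk_surjective (B.γ y.unop)
    rw [AddMonoidHom.comp_apply, act_tmk, act_tmk, B.γ_mul _ _ w' w hw' hw, ← hw',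
      B.act_orbit _ _ _ w' w hw]
  smul_zero x := map_zero (B.act x.unop)
  smul_add x := map_add (B.act x.unop)
  add_smul x y t := by
    change B.act (x.unop + y.unop) t = (B.act x.unop + B.act y.unop : B.TObj M N →+ B.TObj M N) t
    congr 1
    exact TObj.hom_ext B fun m n => by simp
  zero_smul t := by
    change B.act (0 : H) t = (0 : B.TObj M N →+ B.TObj M N) t
    congr 1
    exact TObj.hom_ext B fun m n => by simp

@[simp] theorem op_smul_tmk (h : H) (m : M) (n : N) :
    op h • B.tmk M N (m ⊗ₜ n) = B.orbit m n (B.γ h) := rfl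

theorem op_smul_eq (h : H) (x : B.TObj M N) : op h • x = B.act h x := rfl

theorem γ_s (r : R) : B.γ (B.s r) = Bal.mk _ _ (1 ⊗ₜ B.s r) := by
  simpa using B.γ_right r 1 (1 ⊗ₜ 1) B.γ_one.symm

theorem γ_t (r : R) : B.γ (B.t (op r)) = Bal.mk _ _ (B.t (op r) ⊗ₜ 1) := by
  simpa using B.γ_left r 1 (1 ⊗ₜ 1) B.γ_one.symm

/-- Construct an `H`-linear map out of `M ⊗_R N`. -/
def tLiftLin {T : Type*} [AddCommGroup T] [Module Hᵐᵒᵖ T] (f : B.TObj M N →+ T)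
    (h : ∀ (k : H) m n, f (B.orbit m n (B.γ k)) = op k • f (B.tmk M N (m ⊗ₜ n))) :
    B.TObj M N →ₗ[Hᵐᵒᵖ] T where
  toFun := f
  map_add' := map_add f
  map_smul' x t := by
    change (f.comp (B.act x.unop)) t = ((DistribSMul.toAddMonoidHom T x).comp f) t
    congr 1
    exact TObj.hom_ext B fun m n => h x.unop m n

theorem lin_ext {T : Type*} [AddCommGroup T] [Module Hᵐᵒᵖ T] {f g : B.TObj M N →ₗ[Hᵐᵒᵖ] T}
    (h : ∀ m n, f (B.tmk M N (m ⊗ₜ n)) = g (B.tmk M N (m ⊗ₜ n))) : f = g := by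
  have := TObj.hom_ext B (f := f.toAddMonoidHom) (g := g.toAddMonoidHom) h
  exact LinearMap.ext fun x => DFunLike.congr_fun this x

/-- The tensor product of two `H`-linear maps. -/
def tMap {M' N' : Type u} [AddCommGroup M'] [AddCommGroup N'] [Module Hᵐᵒᵖ M'] [Module Hᵐᵒᵖ N']
    (f : M →ₗ[Hᵐᵒᵖ] M') (g : N →ₗ[Hᵐᵒᵖ] N') : B.TObj M N →ₗ[Hᵐᵒᵖ] B.TObj M' N' :=
  B.tLiftLin
    (B.tLift (((B.tpure M' N').comp f.toAddMonoidHom).compl₂ g.toAddMonoidHom) (fun m r n => by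
      simpa using B.tmk_balance (f m) r (g n)))
    (fun k m n => by
      change _ = B.orbit (f m) (g n) (B.γ k)
      rw [← AddMonoidHom.comp_apply]
      congr 1
      exact Bal.hom_ext fun x y => by simp)

@[simp] theorem tMap_tmk {M' N' : Type u} [AddCommGroup M'] [AddCommGroup N'] [Module Hᵐᵒᵖ M']
    [Module Hᵐᵒᵖ N'] (f : M →ₗ[Hᵐᵒᵖ] M') (g : N →ₗ[Hᵐᵒᵖ] N') (m : M) (n : N) :
    B.tMap f g (B.tmk M N (m ⊗ₜ n)) = B.tmk M' N' (f m ⊗ₜ g n) := rfl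

theorem s_smul_tmk (r : R) (m : M) (n : N) :
    op (B.s r) • B.tmk M N (m ⊗ₜ n) = B.tmk M N (m ⊗ₜ (op (B.s r) • n)) := by
  simp [γ_s]

theorem t_smul_tmk (r : R) (m : M) (n : N) :
    op (B.t (op r)) • B.tmk M N (m ⊗ₜ n) = B.tmk M N ((op (B.t (op r)) • m) ⊗ₜ n) := by
  simp [γ_t]

/-- For fixed `m`, `n` and `p`, the map `h ⊗ k ⊗ l ↦ m · h ⊗ (n · k ⊗ p · l)`. -/
def orbit3 (m : M) (n : N) (p : P) : RTensor3 B.s B.t →+ B.TObj M (B.TObj N P) :=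
  Bal3.lift
    (tlift (Bal.lift (tlift
        (AddMonoidHom.mk' (fun h => AddMonoidHom.mk' (fun k => AddMonoidHom.mk'
          (fun l : H => B.tmk M (B.TObj N P) ((op h • m) ⊗ₜ B.tmk N P ((op k • n) ⊗ₜ (op l • p))))
          (fun l l' => by simp [add_smul, TensorProduct.tmul_add]))
          (fun k k' => by ext l; simp [add_smul, TensorProduct.add_tmul, TensorProduct.tmul_add]))
          (fun h h' => by ext k l; simp [add_smul, TensorProduct.add_tmul])))
      (fun h r k => by
        ext l
        simp only [tlift_tmul, AddMonoidHom.mk'_apply, op_mul, mul_smul, tmk_balance, t_smul_tmk])))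
    (fun h k r l => by
      simp only [tlift_tmul, Bal.lift_mk, AddMonoidHom.mk'_apply, op_mul, mul_smul, tmk_balance])

theorem orbit3_mk (m : M) (n : N) (p : P) (h k l : H) :
    B.orbit3 m n p (Bal3.mkL _ _ _ _ (Bal.mk _ _ (h ⊗ₜ k) ⊗ₜ l)) =
      B.tmk M (B.TObj N P) ((op h • m) ⊗ₜ B.tmk N P ((op k • n) ⊗ₜ (op l • p))) := rfl

/-- The triadditive map `(m, n, p) ↦ m ⊗ (n ⊗ p)`. -/
def assocAux₁ (m : M) (n : N) : P →+ B.TObj M (B.TObj N P) :=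
  (B.tpure M (B.TObj N P) m).comp (B.tpure N P n)

theorem assocAux₁_apply (m : M) (n : N) (p : P) :
    B.assocAux₁ m n p = B.tmk M (B.TObj N P) (m ⊗ₜ B.tmk N P (n ⊗ₜ p)) := rfl

/-- The map `m ⊗ n ↦ (p ↦ m ⊗ (n ⊗ p))`. -/
def assocAux₂ : B.TObj M N →+ P →+ B.TObj M (B.TObj N P) :=
  B.tLift (AddMonoidHom.mk' (fun m => AddMonoidHom.mk' (fun n => B.assocAux₁ m n)
      (fun n n' => by
        ext p; simp [assocAux₁_apply, TensorProduct.add_tmul, TensorProduct.tmul_add]))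
      (fun m m' => by ext n p; simp [assocAux₁_apply, TensorProduct.add_tmul]))
    (fun m r n => by
      ext p
      simp only [AddMonoidHom.mk'_apply, assocAux₁_apply, tmk_balance, t_smul_tmk])

theorem assocAux₂_tmk (m : M) (n : N) (p : P) :
    B.assocAux₂ (B.tmk M N (m ⊗ₜ n)) p = B.tmk M (B.TObj N P) (m ⊗ₜ B.tmk N P (n ⊗ₜ p)) := rfl

variable (M N P) in
/-- The map `(m ⊗ n) ⊗ p ↦ m ⊗ (n ⊗ p)`. -/
def assocAdd : B.TObj (B.TObj M N) P →+ B.TObj M (B.TObj N P) :=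
  B.tLift B.assocAux₂ (fun x r p => by
    obtain ⟨x, rfl⟩ := B.tmk_surjective x
    induction x with
    | zero => simp
    | tmul m n => rw [s_smul_tmk, assocAux₂_tmk, assocAux₂_tmk, tmk_balance]
    | add x y hx hy => simp only [map_add, smul_add, hx, hy, AddMonoidHom.add_apply])

theorem assocAdd_tmk (m : M) (n : N) (p : P) :
    B.assocAdd M N P (B.tmk _ _ (B.tmk _ _ (m ⊗ₜ n) ⊗ₜ p)) =
      B.tmk _ _ (m ⊗ₜ B.tmk _ _ (n ⊗ₜ p)) := rfl

theorem assoc_orbit (m : M) (n : N) (p : P) (w : H ⊗[ℤ] H) :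
    B.assocAdd M N P (B.orbit (B.tmk M N (m ⊗ₜ n)) p (Bal.mk _ _ w)) =
      B.orbit3 m n p (Bal3.mkL _ _ _ _ (tmap B.γ (.id H) w)) := by
  induction w with
  | zero => simp
  | add x y hx hy => simp only [map_add, hx, hy]
  | tmul x y =>
    rw [orbit_mk_tmul, op_smul_tmk, tmap_tmul, AddMonoidHom.id_apply]
    obtain ⟨z, hz⟩ := Bal.mk_surjective (B.γ x)
    rw [← hz]
    clear hz
    induction z with
    | zero => simp
    | add x y hx hy => simp only [map_add, TensorProduct.add_tmul, hx, hy]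
    | tmul x' y' => rw [orbit_mk_tmul, assocAdd_tmk, orbit3_mk]

theorem orbit_assoc (m : M) (n : N) (p : P) (w : H ⊗[ℤ] H) :
    B.orbit m (B.tmk N P (n ⊗ₜ p)) (Bal.mk _ _ w) =
      B.orbit3 m n p (Bal3.mkR _ _ _ _ (tmap (.id H) B.γ w)) := by
  induction w with
  | zero => simp
  | add x y hx hy => simp only [map_add, hx, hy]
  | tmul x y =>
    rw [orbit_mk_tmul, op_smul_tmk, tmap_tmul, AddMonoidHom.id_apply]
    obtain ⟨z, hz⟩ := Bal.mk_surjective (B.γ y)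
    rw [← hz]
    clear hz
    induction z with
    | zero => simp
    | add x y hx hy => simp only [map_add, TensorProduct.tmul_add, hx, hy]
    | tmul x' y' => rw [orbit_mk_tmul, Bal3.mkR_tmul, orbit3_mk]

/-- The map `n ⊗ p ↦ (m ⊗ n) ⊗ p`. -/
def assocInvAux (m : M) : B.TObj N P →+ B.TObj (B.TObj M N) P :=
  B.tLift ((B.tpure (B.TObj M N) P).comp (B.tpure M N m)) (fun n r p => by
    simp only [AddMonoidHom.comp_apply, tpure_apply]
    rw [← s_smul_tmk, tmk_balance])

theorem assocInvAux_tmk (m : M) (n : N) (p : P) :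
    B.assocInvAux m (B.tmk N P (n ⊗ₜ p)) = B.tmk _ _ (B.tmk _ _ (m ⊗ₜ n) ⊗ₜ p) := rfl

variable (M N P) in
/-- The map `m ⊗ (n ⊗ p) ↦ (m ⊗ n) ⊗ p`. -/
def assocInvAdd : B.TObj M (B.TObj N P) →+ B.TObj (B.TObj M N) P :=
  B.tLift (AddMonoidHom.mk' (fun m => B.assocInvAux m) (fun m m' => by
      refine TObj.hom_ext B fun n p => ?_
      simp [assocInvAux_tmk, TensorProduct.add_tmul]))
    (fun m r x => by
      obtain ⟨x, rfl⟩ := B.tmk_surjective x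
      induction x with
      | zero => simp
      | tmul n p =>
        rw [t_smul_tmk, AddMonoidHom.mk'_apply, assocInvAux_tmk, assocInvAux_tmk, tmk_balance]
      | add x y hx hy => simp only [map_add, smul_add, hx, hy])

theorem assocInvAdd_tmk (m : M) (n : N) (p : P) :
    B.assocInvAdd M N P (B.tmk _ _ (m ⊗ₜ B.tmk _ _ (n ⊗ₜ p))) =
      B.tmk _ _ (B.tmk _ _ (m ⊗ₜ n) ⊗ₜ p) := rfl

theorem hom_ext₃ {T : Type*} [AddCommGroup T] {f g : B.TObj (B.TObj M N) P →+ T}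
    (h : ∀ m n p, f (B.tmk _ _ (B.tmk _ _ (m ⊗ₜ n) ⊗ₜ p)) =
      g (B.tmk _ _ (B.tmk _ _ (m ⊗ₜ n) ⊗ₜ p))) : f = g := by
  refine TObj.hom_ext B fun x p => ?_
  obtain ⟨x, rfl⟩ := B.tmk_surjective x
  induction x with
  | zero => simp
  | tmul m n => exact h m n p
  | add x y hx hy => simp only [map_add, TensorProduct.add_tmul, hx, hy]

theorem hom_ext₃' {T : Type*} [AddCommGroup T] {f g : B.TObj M (B.TObj N P) →+ T}
    (h : ∀ m n p, f (B.tmk _ _ (m ⊗ₜ B.tmk _ _ (n ⊗ₜ p))) =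
      g (B.tmk _ _ (m ⊗ₜ B.tmk _ _ (n ⊗ₜ p)))) : f = g := by
  refine TObj.hom_ext B fun m x => ?_
  obtain ⟨x, rfl⟩ := B.tmk_surjective x
  induction x with
  | zero => simp
  | tmul n p => exact h m n p
  | add x y hx hy => simp only [map_add, TensorProduct.tmul_add, hx, hy]

theorem assocAdd_smul (k : H) (x : B.TObj (B.TObj M N) P) :
    B.assocAdd M N P (op k • x) = op k • B.assocAdd M N P x := by
  have : (B.assocAdd M N P).comp (B.act k) = (B.act k).comp (B.assocAdd M N P) := by
    refine B.hom_ext₃ fun m n p => ?_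
    obtain ⟨w, hw⟩ := Bal.mk_surjective (B.γ k)
    rw [AddMonoidHom.comp_apply, AddMonoidHom.comp_apply, assocAdd_tmk, act_tmk, act_tmk, ← hw,
      assoc_orbit, orbit_assoc, B.coassoc k w hw]
  exact DFunLike.congr_fun this x

variable (M N P) in
/-- The associativity isomorphism `(M ⊗_R N) ⊗_R P ≅ M ⊗_R (N ⊗_R P)`. -/
def assocEquiv : B.TObj (B.TObj M N) P ≃ₗ[Hᵐᵒᵖ] B.TObj M (B.TObj N P) where
  toFun := B.assocAdd M N P
  map_add' := map_add _
  map_smul' x := B.assocAdd_smul x.unop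
  invFun := B.assocInvAdd M N P
  left_inv x := by
    have : (B.assocInvAdd M N P).comp (B.assocAdd M N P) = .id _ :=
      B.hom_ext₃ fun m n p => rfl
    exact DFunLike.congr_fun this x
  right_inv x := by
    have : (B.assocAdd M N P).comp (B.assocInvAdd M N P) = .id _ :=
      B.hom_ext₃' fun m n p => rfl
    exact DFunLike.congr_fun this x

@[simp] theorem assocEquiv_tmk (m : M) (n : N) (p : P) :
    B.assocEquiv M N P (B.tmk _ _ (B.tmk _ _ (m ⊗ₜ n) ⊗ₜ p)) =
      B.tmk _ _ (m ⊗ₜ B.tmk _ _ (n ⊗ₜ p)) := rfl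

variable (R) in
/-- The monoidal unit: the abelian group `R` with the action `r · h = π(s(r) h)`. -/
def UnitMod (_ : RightBialgebroid H R) : Type u := R

instance : AddCommGroup B.UnitMod := inferInstanceAs (AddCommGroup R)

/-- An element of `R` as an element of the monoidal unit. -/
def toUnit : R ≃+ B.UnitMod := AddEquiv.refl R

instance : Module Hᵐᵒᵖ B.UnitMod where
  smul x r := B.toUnit (B.π (B.s (B.toUnit.symm r) * x.unop))
  one_smul r := by
    change B.toUnit (B.π (B.s (B.toUnit.symm r) * 1)) = r
    have := B.π_right (B.toUnit.symm r) 1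
    rw [one_mul, B.π_one, one_mul] at this
    rw [mul_one, this, AddEquiv.apply_symm_apply]
  mul_smul x y r := by
    change B.toUnit (B.π (B.s (B.toUnit.symm r) * (y.unop * x.unop))) =
      B.toUnit (B.π (B.s (B.π (B.s (B.toUnit.symm r) * y.unop)) * x.unop))
    rw [B.π_s_mul, mul_assoc]
  smul_zero x := by
    change B.toUnit (B.π (B.s (B.toUnit.symm 0) * x.unop)) = 0
    simp
  smul_add x r r' := by
    change B.toUnit (B.π (B.s (B.toUnit.symm (r + r')) * x.unop)) =
      B.toUnit (B.π (B.s (B.toUnit.symm r) * x.unop)) +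
      B.toUnit (B.π (B.s (B.toUnit.symm r') * x.unop))
    simp [add_mul]
  add_smul x y r := by
    change B.toUnit (B.π (B.s (B.toUnit.symm r) * (x.unop + y.unop))) =
      B.toUnit (B.π (B.s (B.toUnit.symm r) * x.unop)) +
      B.toUnit (B.π (B.s (B.toUnit.symm r) * y.unop))
    simp [mul_add]
  zero_smul r := by
    change B.toUnit (B.π (B.s (B.toUnit.symm r) * 0)) = 0
    simp

theorem smul_toUnit (h : H) (r : R) : op h • B.toUnit r = B.toUnit (B.π (B.s r * h)) := rfl

theorem s_smul_toUnit (r r' : R) : op (B.s r) • B.toUnit r' = B.toUnit (r' * r) := by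
  have := B.π_right r' 1
  rw [one_mul, B.π_one, one_mul] at this
  rw [smul_toUnit, B.π_right, this]

theorem t_smul_toUnit (r r' : R) : op (B.t (op r)) • B.toUnit r' = B.toUnit (r * r') := by
  have := B.π_right r' 1
  rw [one_mul, B.π_one, one_mul] at this
  rw [smul_toUnit, B.π_left, this]

variable (M) in
/-- The additive map `(r ⊗ m) ↦ m · t(r)`. -/
def lunitAdd : B.TObj B.UnitMod M →+ M :=
  B.tLift (AddMonoidHom.mk' (fun r => AddMonoidHom.mk'
      (fun m => op (B.t (op (B.toUnit.symm r))) • m) (fun m m' => smul_add _ _ _))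
      (fun r r' => by ext m; simp [add_smul]))
    (fun r' r m => by
      obtain ⟨r', rfl⟩ := B.toUnit.surjective r'
      simp [s_smul_toUnit, mul_smul])

theorem lunitAdd_tmk (r : R) (m : M) :
    B.lunitAdd M (B.tmk _ _ (B.toUnit r ⊗ₜ m)) = op (B.t (op r)) • m := rfl

variable (M) in
/-- The additive map `(m ⊗ r) ↦ m · s(r)`. -/
def runitAdd : B.TObj M B.UnitMod →+ M :=
  B.tLift (AddMonoidHom.mk' (fun m => AddMonoidHom.mk'
      (fun r => op (B.s (B.toUnit.symm r)) • m) (fun r r' => by simp [add_smul]))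
      (fun m m' => by ext r; simp))
    (fun m r r' => by
      obtain ⟨r', rfl⟩ := B.toUnit.surjective r'
      simp [t_smul_toUnit, mul_smul])

theorem runitAdd_tmk (m : M) (r : R) :
    B.runitAdd M (B.tmk _ _ (m ⊗ₜ B.toUnit r)) = op (B.s r) • m := rfl

theorem π_s (r : R) : B.π (B.s r) = r := by
  have := B.π_right r 1
  rwa [one_mul, B.π_one, one_mul] at this

theorem π_s_mul' (r : R) (h : H) : B.π (B.s r * h) = B.π (B.t (op r) * h) := by
  have h1 := B.π_s_mul (B.s r) h
  have h2 := B.π_t_mul (B.s r) h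
  rw [π_s] at h1 h2
  rw [h2]

theorem γ_t_mul (r : R) (k : H) (w : H ⊗[ℤ] H) (hw : Bal.mk _ _ w = B.γ k) :
    Bal.mk _ _ (tmap (.mulLeft (B.t (op r))) (.id H) w) = B.γ (B.t (op r) * k) := by
  rw [B.γ_mul _ _ _ w (B.γ_t r).symm hw]
  congr 1
  clear hw
  induction w with
  | zero => simp
  | add x y hx hy => simp only [map_add, hx, hy, mul_add]
  | tmul x y => simp

theorem γ_s_mul (r : R) (k : H) (w : H ⊗[ℤ] H) (hw : Bal.mk _ _ w = B.γ k) :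
    Bal.mk _ _ (tmap (.id H) (.mulLeft (B.s r)) w) = B.γ (B.s r * k) := by
  rw [B.γ_mul _ _ _ w (B.γ_s r).symm hw]
  congr 1
  clear hw
  induction w with
  | zero => simp
  | add x y hx hy => simp only [map_add, hx, hy, mul_add]
  | tmul x y => simp

theorem lunit_orbit (r : R) (m : M) (w : H ⊗[ℤ] H) :
    B.lunitAdd M (B.orbit (B.toUnit r) m (Bal.mk _ _ w)) =
      op (mulMapSwap ((addOp B.t).comp B.π) (.id H)
        (tmap (.mulLeft (B.t (op r))) (.id H) w)) • m := by
  induction w with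
  | zero => simp
  | add x y hx hy => rw [map_add, map_add, map_add, hx, hy, map_add, map_add, MulOpposite.op_add, add_smul]
  | tmul x y => simp [smul_toUnit, lunitAdd_tmk, mul_smul, π_s_mul']

theorem runit_orbit (r : R) (m : M) (w : H ⊗[ℤ] H) :
    B.runitAdd M (B.orbit m (B.toUnit r) (Bal.mk _ _ w)) =
      op (mulMap (.id H) (B.s.toAddMonoidHom.comp B.π)
        (tmap (.id H) (.mulLeft (B.s r)) w)) • m := by
  induction w with
  | zero => simp
  | add x y hx hy => rw [map_add, map_add, map_add, hx, hy, map_add, map_add, MulOpposite.op_add, add_smul]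
  | tmul x y => simp [smul_toUnit, runitAdd_tmk, mul_smul]

theorem lunitAdd_smul (k : H) (x : B.TObj B.UnitMod M) :
    B.lunitAdd M (op k • x) = op k • B.lunitAdd M x := by
  have : (B.lunitAdd M).comp (B.act k) =
      (DistribSMul.toAddMonoidHom M (op k)).comp (B.lunitAdd M) := by
    refine TObj.hom_ext B fun r m => ?_
    obtain ⟨r, rfl⟩ := B.toUnit.surjective r
    obtain ⟨w, hw⟩ := Bal.mk_surjective (B.γ k)
    rw [AddMonoidHom.comp_apply, AddMonoidHom.comp_apply, act_tmk, ← hw, lunit_orbit,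
      B.counit_left _ _ (B.γ_t_mul r k w hw), lunitAdd_tmk, op_mul, mul_smul]
    rfl
  exact DFunLike.congr_fun this x

theorem runitAdd_smul (k : H) (x : B.TObj M B.UnitMod) :
    B.runitAdd M (op k • x) = op k • B.runitAdd M x := by
  have : (B.runitAdd M).comp (B.act k) =
      (DistribSMul.toAddMonoidHom M (op k)).comp (B.runitAdd M) := by
    refine TObj.hom_ext B fun m r => ?_
    obtain ⟨r, rfl⟩ := B.toUnit.surjective r
    obtain ⟨w, hw⟩ := Bal.mk_surjective (B.γ k)
    rw [AddMonoidHom.comp_apply, AddMonoidHom.comp_apply, act_tmk, ← hw, runit_orbit,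
      B.counit_right _ _ (B.γ_s_mul r k w hw), runitAdd_tmk, op_mul, mul_smul]
    rfl
  exact DFunLike.congr_fun this x

variable (M) in
/-- The unit isomorphism `R ⊗_R M ≅ M`, `r ⊗ m ↦ m · t(r)`. -/
def lunitEquiv : B.TObj B.UnitMod M ≃ₗ[Hᵐᵒᵖ] M where
  toFun := B.lunitAdd M
  map_add' := map_add _
  map_smul' x := B.lunitAdd_smul x.unop
  invFun m := B.tmk _ _ (B.toUnit 1 ⊗ₜ m)
  left_inv x := by
    have : (B.tpure B.UnitMod M (B.toUnit 1)).comp (B.lunitAdd M) = .id _ := by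
      refine TObj.hom_ext B fun r m => ?_
      obtain ⟨r, rfl⟩ := B.toUnit.surjective r
      rw [AddMonoidHom.comp_apply, lunitAdd_tmk, tpure_apply, ← tmk_balance, s_smul_toUnit, one_mul]
      rfl
    exact DFunLike.congr_fun this x
  right_inv m := by
    change B.lunitAdd M (B.tmk _ _ (B.toUnit 1 ⊗ₜ m)) = m
    simp [lunitAdd_tmk]

variable (M) in
/-- The unit isomorphism `M ⊗_R R ≅ M`, `m ⊗ r ↦ m · s(r)`. -/
def runitEquiv : B.TObj M B.UnitMod ≃ₗ[Hᵐᵒᵖ] M where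
  toFun := B.runitAdd M
  map_add' := map_add _
  map_smul' x := B.runitAdd_smul x.unop
  invFun m := B.tmk _ _ (m ⊗ₜ B.toUnit 1)
  left_inv x := by
    have : ((B.tpure M B.UnitMod).flip (B.toUnit 1)).comp (B.runitAdd M) = .id _ := by
      refine TObj.hom_ext B fun m r => ?_
      obtain ⟨r, rfl⟩ := B.toUnit.surjective r
      rw [AddMonoidHom.comp_apply, runitAdd_tmk, AddMonoidHom.flip_apply, tpure_apply, tmk_balance,
        t_smul_toUnit, mul_one]
      rfl
    exact DFunLike.congr_fun this x
  right_inv m := by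
    change B.runitAdd M (B.tmk _ _ (m ⊗ₜ B.toUnit 1)) = m
    simp [runitAdd_tmk]

theorem lunitEquiv_tmk (r : R) (m : M) :
    B.lunitEquiv M (B.tmk _ _ (B.toUnit r ⊗ₜ m)) = op (B.t (op r)) • m := rfl

theorem runitEquiv_tmk (m : M) (r : R) :
    B.runitEquiv M (B.tmk _ _ (m ⊗ₜ B.toUnit r)) = op (B.s r) • m := rfl

end TObj

end RightBialgebroid

end RightModules
section ModuleCategory

open MonoidalCategory

variable {H R : Type u} [Ring H] [Ring R] (B : RightBialgebroid H R)

namespace RightBialgebroid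

/-- The category `ℳ_H` of right `H`-modules, that is, of modules over `Hᵐᵒᵖ`. Its monoidal structure
depends on the right bialgebroid `B`. -/
def RMod (_ : RightBialgebroid H R) : Type (u + 1) := ModuleCat.{u} Hᵐᵒᵖ

instance : Category.{u} B.RMod := inferInstanceAs (Category.{u} (ModuleCat.{u} Hᵐᵒᵖ))

instance : Preadditive B.RMod := inferInstanceAs (Preadditive (ModuleCat.{u} Hᵐᵒᵖ))

instance : HasCoequalizers B.RMod := inferInstanceAs (HasCoequalizers (ModuleCat.{u} Hᵐᵒᵖ))

namespace RMod

variable {B}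

/-- The underlying type of a right `H`-module. -/
def carrier (M : B.RMod) : Type u := (show ModuleCat.{u} Hᵐᵒᵖ from M).carrier

instance : CoeSort B.RMod (Type u) := ⟨carrier⟩

instance (M : B.RMod) : AddCommGroup M :=
  inferInstanceAs (AddCommGroup (show ModuleCat.{u} Hᵐᵒᵖ from M).carrier)

instance (M : B.RMod) : Module Hᵐᵒᵖ M :=
  inferInstanceAs (Module Hᵐᵒᵖ (show ModuleCat.{u} Hᵐᵒᵖ from M).carrier)

variable (B) in
/-- A right `H`-module as an object of `ℳ_H`. -/
def of (M : Type u) [AddCommGroup M] [Module Hᵐᵒᵖ M] : B.RMod := ModuleCat.of Hᵐᵒᵖ M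

/-- The linear map underlying a morphism. -/
def lin {M N : B.RMod} (f : M ⟶ N) : M →ₗ[Hᵐᵒᵖ] N := ModuleCat.Hom.hom f

/-- The morphism given by a linear map. -/
def ofLin {M N : B.RMod} (f : M →ₗ[Hᵐᵒᵖ] N) : M ⟶ N :=
  ModuleCat.ofHom (X := M.carrier) (Y := N.carrier) f

@[simp] theorem lin_ofLin {M N : B.RMod} (f : M →ₗ[Hᵐᵒᵖ] N) : lin (ofLin f) = f := rfl

@[simp] theorem lin_id (M : B.RMod) : lin (𝟙 M) = LinearMap.id := rfl

@[simp] theorem lin_comp {M N P : B.RMod} (f : M ⟶ N) (g : N ⟶ P) :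
    lin (f ≫ g) = lin g ∘ₗ lin f := rfl

@[simp] theorem lin_add {M N : B.RMod} (f g : M ⟶ N) : lin (f + g) = lin f + lin g := rfl

@[simp] theorem lin_zero (M N : B.RMod) : lin (0 : M ⟶ N) = 0 := rfl

theorem hom_ext {M N : B.RMod} {f g : M ⟶ N} (h : lin f = lin g) : f = g :=
  ModuleCat.hom_ext h

/-- The isomorphism given by a linear equivalence. -/
def isoOfEquiv {M N : B.RMod} (e : M ≃ₗ[Hᵐᵒᵖ] N) : M ≅ N where
  hom := ofLin e.toLinearMap
  inv := ofLin e.symm.toLinearMap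
  hom_inv_id := hom_ext (by ext x; simp)
  inv_hom_id := hom_ext (by ext x; simp)

@[simp] theorem lin_isoOfEquiv {M N : B.RMod} (e : M ≃ₗ[Hᵐᵒᵖ] N) :
    lin (isoOfEquiv e).hom = e.toLinearMap := rfl

instance : MonoidalCategoryStruct B.RMod where
  tensorObj M N := of B (B.TObj M N)
  whiskerLeft _ _ _ f := ofLin (B.tMap LinearMap.id (lin f))
  whiskerRight f _ := ofLin (B.tMap (lin f) LinearMap.id)
  tensorHom f g := ofLin (B.tMap (lin f) (lin g))
  tensorUnit := of B B.UnitMod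
  associator M N P := isoOfEquiv (B.assocEquiv M N P)
  leftUnitor M := isoOfEquiv (B.lunitEquiv M)
  rightUnitor M := isoOfEquiv (B.runitEquiv M)

/-- The element `m ⊗ n` of `M ⊗_R N`. -/
def pure {M N : B.RMod} (m : M) (n : N) : (M ⊗ N : B.RMod) := B.tmk M N (m ⊗ₜ n)

@[simp] theorem lin_whiskerLeft (M : B.RMod) {N N' : B.RMod} (f : N ⟶ N') (m : M) (n : N) :
    lin (M ◁ f) (pure m n) = pure m (lin f n) := rfl

@[simp] theorem lin_whiskerRight {M M' : B.RMod} (f : M ⟶ M') (N : B.RMod) (m : M) (n : N) :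
    lin (f ▷ N) (pure m n) = pure (lin f m) n := rfl

@[simp] theorem lin_tensorHom {M M' N N' : B.RMod} (f : M ⟶ M') (g : N ⟶ N') (m : M) (n : N) :
    lin (f ⊗ₘ g) (pure m n) = pure (lin f m) (lin g n) := rfl

@[simp] theorem lin_associator (M N P : B.RMod) (m : M) (n : N) (p : P) :
    lin (α_ M N P).hom (pure (pure m n) p) = pure m (pure n p) := rfl

/-- An element of `R` as an element of the monoidal unit of `ℳ_H`. -/
def unitElt (r : R) : (𝟙_ B.RMod : B.RMod) := B.toUnit r

theorem unitElt_surjective : Function.Surjective (unitElt (B := B)) := fun x => ⟨x, rfl⟩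

@[simp] theorem lin_leftUnitor (M : B.RMod) (r : R) (m : M) :
    lin (λ_ M).hom (pure (unitElt r) m) = op (B.t (op r)) • m := rfl

@[simp] theorem lin_rightUnitor (M : B.RMod) (m : M) (r : R) :
    lin (ρ_ M).hom (pure m (unitElt r)) = op (B.s r) • m := rfl

theorem pure_balance {M N : B.RMod} (m : M) (r : R) (n : N) :
    pure (op (B.s r) • m) n = pure m (op (B.t (op r)) • n) := B.tmk_balance m r n

theorem pure_add_left {M N : B.RMod} (m m' : M) (n : N) :
    pure (m + m') n = pure m n + pure m' n := by
  simp only [pure, TensorProduct.add_tmul, map_add]; rfl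

theorem pure_add_right {M N : B.RMod} (m : M) (n n' : N) :
    pure m (n + n') = pure m n + pure m n' := by
  simp only [pure, TensorProduct.tmul_add, map_add]; rfl

theorem tensor_induction {M N : B.RMod} {p : (M ⊗ N : B.RMod) → Prop} (h0 : p 0)
    (hp : ∀ m n, p (pure m n)) (ha : ∀ x y, p x → p y → p (x + y)) (x) : p x := by
  obtain ⟨x, rfl⟩ := B.tmk_surjective x
  induction x with
  | zero => rw [map_zero]; exact h0
  | tmul m n => exact hp m n
  | add x y hx hy => rw [map_add]; exact ha _ _ hx hy

theorem hom_ext₂ {M N P : B.RMod} {f g : M ⊗ N ⟶ P}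
    (h : ∀ m n, lin f (pure m n) = lin g (pure m n)) : f = g :=
  hom_ext (B.lin_ext h)

theorem hom_ext₃ {M N P Q : B.RMod} {f g : (M ⊗ N) ⊗ P ⟶ Q}
    (h : ∀ m n p, lin f (pure (pure m n) p) = lin g (pure (pure m n) p)) : f = g := by
  refine hom_ext₂ fun x p => ?_
  induction x using tensor_induction with
  | h0 =>
    have : pure (0 : (M ⊗ N : B.RMod)) p = 0 := by
      have := pure_add_left (0 : (M ⊗ N : B.RMod)) 0 p
      simpa using this
    simp [this]
  | hp m n => exact h m n p
  | ha x y hx hy => simp only [pure_add_left, map_add, hx, hy]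

theorem hom_ext₄ {M N P Q T : B.RMod} {f g : ((M ⊗ N) ⊗ P) ⊗ Q ⟶ T}
    (h : ∀ m n p q, lin f (pure (pure (pure m n) p) q) = lin g (pure (pure (pure m n) p) q)) :
    f = g := by
  refine hom_ext₃ fun x p q => ?_
  induction x using tensor_induction with
  | h0 =>
    have h1 : pure (0 : (M ⊗ N : B.RMod)) p = 0 := by
      have := pure_add_left (0 : (M ⊗ N : B.RMod)) 0 p
      simpa using this
    have h2 : pure (0 : ((M ⊗ N) ⊗ P : B.RMod)) q = 0 := by
      have := pure_add_left (0 : ((M ⊗ N) ⊗ P : B.RMod)) 0 q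
      simpa using this
    simp [h1, h2]
  | hp m n => exact h m n p q
  | ha x y hx hy => simp only [pure_add_left, map_add, hx, hy]

instance : MonoidalCategory B.RMod where
  tensorHom_def f g := hom_ext₂ fun m n => by simp
  id_tensorHom_id M N := hom_ext₂ fun m n => by simp
  tensorHom_comp_tensorHom f₁ f₂ g₁ g₂ := hom_ext₂ fun m n => by simp
  whiskerLeft_id M N := hom_ext₂ fun m n => by simp
  id_whiskerRight M N := hom_ext₂ fun m n => by simp
  associator_naturality f₁ f₂ f₃ := hom_ext₃ fun m n p => by simp
  leftUnitor_naturality f := hom_ext₂ fun r m => by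
    obtain ⟨r, rfl⟩ := unitElt_surjective r
    simp
  rightUnitor_naturality f := hom_ext₂ fun m r => by
    obtain ⟨r, rfl⟩ := unitElt_surjective r
    simp
  pentagon M N P Q := hom_ext₄ fun m n p q => by simp
  triangle M N := hom_ext₃ fun m r n => by
    obtain ⟨r, rfl⟩ := unitElt_surjective r
    simp [pure_balance]

instance : MonoidalPreadditive B.RMod where
  whiskerLeft_zero {M N P} := hom_ext₂ fun m n => by
    have := pure_add_right (N := P) m 0 0
    simpa using this
  zero_whiskerRight {M N P} := hom_ext₂ fun m n => by
    have := pure_add_left (M := P) 0 0 n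
    simpa using this
  whiskerLeft_add f g := hom_ext₂ fun m n => by simp [pure_add_right]
  add_whiskerRight f g := hom_ext₂ fun m n => by simp [pure_add_left]

/-- The underlying abelian groups. -/
def forgetAb (B : RightBialgebroid H R) : B.RMod ⥤ AddCommGrpCat.{u} :=
  forget₂ (ModuleCat.{u} Hᵐᵒᵖ) AddCommGrpCat.{u}

instance : PreservesColimitsOfSize.{0, 0} (forgetAb B) :=
  have : HasColimitsOfSize.{0, 0} AddCommGrpCat.{u} := inferInstance
  ModuleCat.forget₂PreservesColimitsOfSize Hᵐᵒᵖ

section Colimits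

variable {J : Type} [SmallCategory J] {K : J ⥤ B.RMod} {c : Cocone K}

/-- The additive map out of a colimit of modules given by a compatible family of additive maps. -/
def descAb (hc : IsColimit c) {T : Type u} [AddCommGroup T] (f : ∀ x, K.obj x →+ T)
    (hf : ∀ {x y} (a : x ⟶ y) (n : K.obj x), f y (lin (K.map a) n) = f x n) : c.pt →+ T :=
  ((isColimitOfPreserves (forgetAb B) hc).desc
    { pt := AddCommGrpCat.of T
      ι :=
        { app := fun x => AddCommGrpCat.ofHom (X := K.obj x) (f x)
          naturality := fun x y a => by
            ext n
            exact hf a n } }).hom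

theorem descAb_ι (hc : IsColimit c) {T : Type u} [AddCommGroup T] (f : ∀ x, K.obj x →+ T)
    (hf : ∀ {x y} (a : x ⟶ y) (n : K.obj x), f y (lin (K.map a) n) = f x n) (x : J)
    (n : K.obj x) : descAb hc f hf (lin (c.ι.app x) n) = f x n :=
  ConcreteCategory.congr_hom ((isColimitOfPreserves (forgetAb B) hc).fac
    { pt := AddCommGrpCat.of T
      ι :=
        { app := fun x => AddCommGrpCat.ofHom (X := K.obj x) (f x)
          naturality := fun x y a => by
            ext n
            exact hf a n } } x) n

theorem colimit_ab_ext (hc : IsColimit c) {T : Type u} [AddCommGroup T] {f g : c.pt →+ T}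
    (h : ∀ x (n : K.obj x), f (lin (c.ι.app x) n) = g (lin (c.ι.app x) n)) : f = g := by
  have : AddCommGrpCat.ofHom (X := c.pt) (Y := T) f = AddCommGrpCat.ofHom (X := c.pt) (Y := T) g := by
    refine (isColimitOfPreserves (forgetAb B) hc).hom_ext fun x => ?_
    ext n
    exact h x n
  exact congrArg AddCommGrpCat.Hom.hom this

variable (M : B.RMod)

theorem map_cocone_ι {s : Cocone K} {x y : J} (a : x ⟶ y) (n : K.obj x) :
    lin (s.ι.app y) (lin (K.map a) n) = lin (s.ι.app x) n := by
  rw [← s.w a]; rfl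

/-- The biadditive map `(m, n) ↦ m ⊗ n`. -/
def pureHom (M N : B.RMod) : M →+ N →+ (M ⊗ N : B.RMod) := B.tpure M N

theorem pureHom_apply {M N : B.RMod} (m : M) (n : N) : pureHom M N m n = pure m n := rfl

theorem tensor_add_ext {M N : B.RMod} {T : Type*} [AddCommGroup T]
    {f g : (M ⊗ N : B.RMod) →+ T} (h : ∀ m n, f (pure m n) = g (pure m n)) : f = g :=
  TObj.hom_ext B h

/-- An additive map out of `M ⊗_R N`, from a balanced biadditive map. -/
def liftHom {M N T : B.RMod} (f : M →+ N →+ T)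
    (h : ∀ m (r : R) n, f (op (B.s r) • m) n = f m (op (B.t (op r)) • n)) :
    (M ⊗ N : B.RMod) →+ T :=
  B.tLift f h

theorem liftHom_pure {M N T : B.RMod} (f : M →+ N →+ T)
    (h : ∀ m (r : R) n, f (op (B.s r) • m) n = f m (op (B.t (op r)) • n)) (m : M) (n : N) :
    liftHom f h (pure m n) = f m n := rfl

/-- A morphism out of `M ⊗_R N`, from a biadditive map. -/
def homMk {M N T : B.RMod} (f : M →+ N →+ T)
    (h : ∀ m (r : R) n, f (op (B.s r) • m) n = f m (op (B.t (op r)) • n))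
    (h' : ∀ (k : H) m n, liftHom f h (op k • pure m n) = op k • f m n) : M ⊗ N ⟶ T :=
  ofLin (M := M ⊗ N) (B.tLiftLin (B.tLift f h) h')

theorem homMk_pure {M N T : B.RMod} (f : M →+ N →+ T)
    (h : ∀ m (r : R) n, f (op (B.s r) • m) n = f m (op (B.t (op r)) • n))
    (h' : ∀ (k : H) m n, liftHom f h (op k • pure m n) = op k • f m n) (m : M) (n : N) :
    lin (homMk f h h') (pure m n) = f m n := rfl

section Left

variable (hc : IsColimit c) (s : Cocone (K ⋙ tensorLeft M))

/-- The map `n ↦ s(m ⊗ n)` on one module of the diagram. -/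
def leftFam (m : M) (x : J) : K.obj x →+ s.pt :=
  (lin (s.ι.app x)).toAddMonoidHom.comp (pureHom M (K.obj x) m)

theorem left_compat (m : M) {x y : J} (a : x ⟶ y) (n : K.obj x) :
    leftFam M s m y (lin (K.map a) n) = leftFam M s m x n := by
  change lin (s.ι.app y) (lin ((K ⋙ tensorLeft M).map a) (pure m n)) = _
  rw [map_cocone_ι]; rfl

/-- The map `n ↦ s(m ⊗ n)` out of a colimit. -/
def descLeftAux (m : M) : c.pt →+ s.pt :=
  descAb hc (leftFam M s m) (left_compat M s m)

theorem descLeftAux_ι (m : M) (x : J) (n : K.obj x) :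
    descLeftAux M hc s m (lin (c.ι.app x) n) = lin (s.ι.app x) (pure m n) :=
  descAb_ι hc (leftFam M s m) (left_compat M s m) x n

/-- The map `(m, n) ↦ s(m ⊗ n)`. -/
def descLeftBi : M →+ c.pt →+ s.pt :=
  AddMonoidHom.mk' (descLeftAux M hc s) fun m m' => by
    refine colimit_ab_ext hc fun x n => ?_
    rw [AddMonoidHom.add_apply, descLeftAux_ι, descLeftAux_ι, descLeftAux_ι, pure_add_left, map_add]

theorem descLeftBi_ι (m : M) (x : J) (n : K.obj x) :
    descLeftBi M hc s m (lin (c.ι.app x) n) = lin (s.ι.app x) (pure m n) :=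
  descLeftAux_ι M hc s m x n

/-- The action of an element of `H` on a module. -/
def actHom (N : B.RMod) (h : H) : N →+ N := DistribSMul.toAddMonoidHom N (op h)

theorem descLeftBi_balance (m : M) (r : R) (n : c.pt) :
    descLeftBi M hc s (op (B.s r) • m) n = descLeftBi M hc s m (op (B.t (op r)) • n) := by
  have : descLeftBi M hc s (op (B.s r) • m) =
      (descLeftBi M hc s m).comp (actHom c.pt (B.t (op r))) := by
    refine colimit_ab_ext hc fun x n => ?_
    rw [AddMonoidHom.comp_apply]
    change _ = descLeftBi M hc s m (op (B.t (op r)) • lin (c.ι.app x) n)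
    rw [← map_smul, descLeftBi_ι, descLeftBi_ι, pure_balance]
  exact DFunLike.congr_fun this n

theorem descLeftBi_smul (k : H) (m : M) (n : c.pt) :
    liftHom (descLeftBi M hc s) (descLeftBi_balance M hc s) (op k • pure m n) =
      op k • descLeftBi M hc s m n := by
  have : (liftHom (descLeftBi M hc s) (descLeftBi_balance M hc s)).comp
      ((actHom (M ⊗ c.pt) k).comp (pureHom M c.pt m)) =
      (actHom s.pt k).comp (descLeftBi M hc s m) := by
    refine colimit_ab_ext hc fun x n => ?_
    change liftHom (descLeftBi M hc s) (descLeftBi_balance M hc s)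
      (op k • lin (M ◁ c.ι.app x) (pure m n)) = op k • descLeftBi M hc s m (lin (c.ι.app x) n)
    rw [← map_smul, descLeftBi_ι, ← map_smul]
    have key : (liftHom (descLeftBi M hc s) (descLeftBi_balance M hc s)).comp
        (lin (M ◁ c.ι.app x)).toAddMonoidHom = (lin (s.ι.app x)).toAddMonoidHom :=
      tensor_add_ext fun m n => descLeftBi_ι M hc s m x n
    exact DFunLike.congr_fun key (op k • pure m n)
  exact DFunLike.congr_fun this n

end Left

instance : PreservesColimitsOfSize.{0, 0} (tensorLeft M) where
  preservesColimitsOfShape {J} _ :=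
    { preservesColimit := fun {K} =>
      { preserves := fun {c} hc => ⟨
        { desc := fun s => homMk (descLeftBi M hc s) (descLeftBi_balance M hc s)
            (descLeftBi_smul M hc s)
          fac := fun s x => hom_ext₂ fun m n => descLeftBi_ι M hc s m x n
          uniq := fun s f hf => hom_ext₂ fun m n => by
            rw [homMk_pure, ← pureHom_apply]
            have : (lin f).toAddMonoidHom.comp (pureHom M c.pt m) = descLeftBi M hc s m := by
              refine colimit_ab_ext hc fun x n => ?_
              rw [descLeftBi_ι, ← hf x]
              rfl
            exact DFunLike.congr_fun this n }⟩ } }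

section Right

variable (hc : IsColimit c) (s : Cocone (K ⋙ tensorRight M))

/-- The map `n ↦ s(n ⊗ m)` on one module of the diagram. -/
def rightFam (m : M) (x : J) : K.obj x →+ s.pt :=
  (lin (s.ι.app x)).toAddMonoidHom.comp ((pureHom (K.obj x) M).flip m)

theorem right_compat (m : M) {x y : J} (a : x ⟶ y) (n : K.obj x) :
    rightFam M s m y (lin (K.map a) n) = rightFam M s m x n := by
  change lin (s.ι.app y) (lin ((K ⋙ tensorRight M).map a) (pure n m)) = _
  rw [map_cocone_ι]; rfl

/-- The map `n ↦ s(n ⊗ m)` out of a colimit. -/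
def descRightAux (m : M) : c.pt →+ s.pt :=
  descAb hc (rightFam M s m) (right_compat M s m)

theorem descRightAux_ι (m : M) (x : J) (n : K.obj x) :
    descRightAux M hc s m (lin (c.ι.app x) n) = lin (s.ι.app x) (pure n m) :=
  descAb_ι hc (rightFam M s m) (right_compat M s m) x n

/-- The map `(n, m) ↦ s(n ⊗ m)`. -/
def descRightBi : c.pt →+ M →+ s.pt :=
  (AddMonoidHom.mk' (descRightAux M hc s) fun m m' => by
    refine colimit_ab_ext hc fun x n => ?_
    rw [AddMonoidHom.add_apply, descRightAux_ι, descRightAux_ι, descRightAux_ι, pure_add_right,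
      map_add]).flip

theorem descRightBi_ι (m : M) (x : J) (n : K.obj x) :
    descRightBi M hc s (lin (c.ι.app x) n) m = lin (s.ι.app x) (pure n m) :=
  descRightAux_ι M hc s m x n

theorem descRightBi_balance (n : c.pt) (r : R) (m : M) :
    descRightBi M hc s (op (B.s r) • n) m = descRightBi M hc s n (op (B.t (op r)) • m) := by
  have : ((descRightBi M hc s).flip m).comp (actHom c.pt (B.s r)) =
      (descRightBi M hc s).flip (op (B.t (op r)) • m) := by
    refine colimit_ab_ext hc fun x n => ?_
    change descRightBi M hc s (op (B.s r) • lin (c.ι.app x) n) m =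
      descRightBi M hc s (lin (c.ι.app x) n) (op (B.t (op r)) • m)
    rw [← map_smul, descRightBi_ι, descRightBi_ι, pure_balance]
  exact DFunLike.congr_fun this n

theorem descRightBi_smul (k : H) (n : c.pt) (m : M) :
    liftHom (descRightBi M hc s) (descRightBi_balance M hc s) (op k • pure n m) =
      op k • descRightBi M hc s n m := by
  have : (liftHom (descRightBi M hc s) (descRightBi_balance M hc s)).comp
      ((actHom (c.pt ⊗ M) k).comp ((pureHom c.pt M).flip m)) =
      (actHom s.pt k).comp ((descRightBi M hc s).flip m) := by
    refine colimit_ab_ext hc fun x n => ?_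
    change liftHom (descRightBi M hc s) (descRightBi_balance M hc s)
      (op k • lin (c.ι.app x ▷ M) (pure n m)) = op k • descRightBi M hc s (lin (c.ι.app x) n) m
    rw [← map_smul, descRightBi_ι, ← map_smul]
    have key : (liftHom (descRightBi M hc s) (descRightBi_balance M hc s)).comp
        (lin (c.ι.app x ▷ M)).toAddMonoidHom = (lin (s.ι.app x)).toAddMonoidHom :=
      tensor_add_ext fun n m => descRightBi_ι M hc s m x n
    exact DFunLike.congr_fun key (op k • pure n m)
  exact DFunLike.congr_fun this n

end Right

instance : PreservesColimitsOfSize.{0, 0} (tensorRight M) where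
  preservesColimitsOfShape {J} _ :=
    { preservesColimit := fun {K} =>
      { preserves := fun {c} hc => ⟨
        { desc := fun s => homMk (descRightBi M hc s) (descRightBi_balance M hc s)
            (descRightBi_smul M hc s)
          fac := fun s x => hom_ext₂ fun n m => descRightBi_ι M hc s m x n
          uniq := fun s f hf => hom_ext₂ fun n m => by
            rw [homMk_pure, ← pureHom_apply]
            have : (lin f).toAddMonoidHom.comp ((pureHom c.pt M).flip m) =
                (descRightBi M hc s).flip m := by
              refine colimit_ab_ext hc fun x n => ?_
              change lin f (pure (lin (c.ι.app x) n) m) =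
                descRightBi M hc s (lin (c.ι.app x) n) m
              rw [descRightBi_ι, ← hf x]
              rfl
            exact DFunLike.congr_fun this n }⟩ } }

end Colimits

end RMod

end RightBialgebroid

end ModuleCategory
section InternalBimodules

open MonoidalCategory MonObj

namespace Bim

section Preadditive

variable {C : Type u₁} [Category.{v} C] [MonoidalCategory C] [Preadditive C]
  [MonoidalPreadditive C]

instance {M N : Mon C} (P Q : Bimod M N) : Add (P ⟶ Q) :=
  ⟨fun f g =>
    { hom := f.hom + g.hom
      left_act_hom := by
        rw [Preadditive.comp_add, f.left_act_hom, g.left_act_hom, MonoidalPreadditive.whiskerLeft_add,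
          Preadditive.add_comp]
      right_act_hom := by
        rw [Preadditive.comp_add, f.right_act_hom, g.right_act_hom,
          MonoidalPreadditive.add_whiskerRight, Preadditive.add_comp] }⟩

instance {M N : Mon C} (P Q : Bimod M N) : Zero (P ⟶ Q) :=
  ⟨{ hom := 0
     left_act_hom := by simp
     right_act_hom := by simp }⟩

instance {M N : Mon C} (P Q : Bimod M N) : Neg (P ⟶ Q) :=
  ⟨fun f =>
    { hom := -f.hom
      left_act_hom := by
        have : M.X ◁ (-f.hom) = -(M.X ◁ f.hom) := by
          rw [eq_neg_iff_add_eq_zero, ← MonoidalPreadditive.whiskerLeft_add]; simp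
        rw [this, Preadditive.comp_neg, Preadditive.neg_comp, f.left_act_hom]
      right_act_hom := by
        have : (-f.hom) ▷ N.X = -(f.hom ▷ N.X) := by
          rw [eq_neg_iff_add_eq_zero, ← MonoidalPreadditive.add_whiskerRight]; simp
        rw [this, Preadditive.comp_neg, Preadditive.neg_comp, f.right_act_hom] }⟩

/-- The bimodule maps between two internal bimodules form an abelian group. -/
instance bimodHomGroup {M N : Mon C} (P Q : Bimod M N) : AddCommGroup (P ⟶ Q) where
  add_assoc f g h := Bimod.hom_ext _ _ (add_assoc f.hom g.hom h.hom)
  zero_add f := Bimod.hom_ext _ _ (zero_add f.hom)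
  add_zero f := Bimod.hom_ext _ _ (add_zero f.hom)
  neg_add_cancel f := Bimod.hom_ext _ _ (neg_add_cancel f.hom)
  add_comm f g := Bimod.hom_ext _ _ (add_comm f.hom g.hom)
  nsmul := nsmulRec
  zsmul := zsmulRec

theorem add_hom {M N : Mon C} {P Q : Bimod M N} (f g : P ⟶ Q) :
    Bimod.Hom.hom (f + g) = f.hom + g.hom := rfl

instance bimodPreadditive (M N : Mon C) : Preadditive (Bimod M N) where
  homGroup := bimodHomGroup
  add_comp _ _ _ f f' g := Bimod.hom_ext _ _ (Preadditive.add_comp _ _ _ f.hom f'.hom g.hom)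
  comp_add _ _ _ f g g' := Bimod.hom_ext _ _ (Preadditive.comp_add _ _ _ f.hom g.hom g'.hom)

end Preadditive

section Regular

variable {C : Type u₁} [Category.{v} C] [MonoidalCategory C]

/-- The bimodule `(Q, l_Q, μ)` over the trivial monoid and a monoid `Q`. -/
def unitReg (Q : Mon C) : Bimod (Mon.trivial C) Q where
  X := Q.X
  actLeft := (λ_ Q.X).hom
  one_actLeft := by
    change 𝟙 (𝟙_ C) ▷ Q.X ≫ (λ_ Q.X).hom = _
    simp
  left_assoc := by
    change (λ_ (𝟙_ C)).hom ▷ Q.X ≫ (λ_ Q.X).hom =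
      (α_ (𝟙_ C) (𝟙_ C) Q.X).hom ≫ 𝟙_ C ◁ (λ_ Q.X).hom ≫ (λ_ Q.X).hom
    monoidal
  actRight := μ
  middle_assoc := by
    change (λ_ Q.X).hom ▷ Q.X ≫ μ = (α_ (𝟙_ C) Q.X Q.X).hom ≫ 𝟙_ C ◁ μ ≫ (λ_ Q.X).hom
    rw [leftUnitor_naturality]
    monoidal

/-- The bimodule `(Q, μ, r_Q)` over a monoid `Q` and the trivial monoid. -/
def regUnit (Q : Mon C) : Bimod Q (Mon.trivial C) where
  X := Q.X
  actLeft := μ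
  actRight := (ρ_ Q.X).hom
  actRight_one := by
    change Q.X ◁ 𝟙 (𝟙_ C) ≫ (ρ_ Q.X).hom = _
    simp
  right_assoc := by
    change Q.X ◁ (λ_ (𝟙_ C)).hom ≫ (ρ_ Q.X).hom =
      (α_ Q.X (𝟙_ C) (𝟙_ C)).inv ≫ (ρ_ Q.X).hom ▷ 𝟙_ C ≫ (ρ_ Q.X).hom
    monoidal
  middle_assoc := by
    change μ ▷ 𝟙_ C ≫ (ρ_ Q.X).hom = (α_ Q.X Q.X (𝟙_ C)).hom ≫ Q.X ◁ (ρ_ Q.X).hom ≫ μ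
    rw [rightUnitor_naturality]
    monoidal

end Regular

variable {C : Type u₁} [Category.{v} C] [MonoidalCategory C] [HasCoequalizers C]
  [∀ X : C, PreservesColimitsOfSize.{0, 0} (tensorLeft X)]
  [∀ X : C, PreservesColimitsOfSize.{0, 0} (tensorRight X)]

/-- The projection `P ⊗ Q → P ⊗_N Q`. -/
def proj {M N T : Mon C} (P : Bimod M N) (Q : Bimod N T) : P.X ⊗ Q.X ⟶ (P.tensorBimod Q).X :=
  coequalizer.π (P.actRight ▷ Q.X) ((α_ P.X N.X Q.X).hom ≫ P.X ◁ Q.actLeft)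

theorem proj_hom_ext {M N T : Mon C} {P : Bimod M N} {Q : Bimod N T} {Z : C}
    {f g : (P.tensorBimod Q).X ⟶ Z} (h : proj P Q ≫ f = proj P Q ≫ g) : f = g :=
  coequalizer.hom_ext h

theorem proj_whiskerLeft {M N T : Mon C} (P : Bimod M N) {Q Q' : Bimod N T} (f : Q ⟶ Q') :
    proj P Q ≫ (Bimod.whiskerLeft P f).hom = P.X ◁ f.hom ≫ proj P Q' :=
  ι_colimMap _ WalkingParallelPair.one

theorem proj_whiskerRight {M N T : Mon C} {P P' : Bimod M N} (f : P ⟶ P') (Q : Bimod N T) :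
    proj P Q ≫ (Bimod.whiskerRight f Q).hom = f.hom ▷ Q.X ≫ proj P' Q :=
  ι_colimMap _ WalkingParallelPair.one

/-- The map `Q ⊗_Q Q → Q` induced by the multiplication of a monoid `Q`. -/
def mulDesc (Q : Mon C) : ((unitReg Q).tensorBimod (regUnit Q)).X ⟶ Q.X :=
  coequalizer.desc (μ : Q.X ⊗ Q.X ⟶ Q.X) (by
    change (μ : Q.X ⊗ Q.X ⟶ Q.X) ▷ Q.X ≫ μ = ((α_ Q.X Q.X Q.X).hom ≫ Q.X ◁ μ) ≫ μ
    rw [Category.assoc]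
    exact MonObj.mul_assoc Q.X)

section Additive

variable [Preadditive C] [MonoidalPreadditive C]

theorem bimod_whiskerLeft_add {M N T : Mon C} (P : Bimod M N) {Q Q' : Bimod N T}
    (f g : Q ⟶ Q') :
    Bimod.whiskerLeft P (f + g) = Bimod.whiskerLeft P f + Bimod.whiskerLeft P g :=
  Bimod.hom_ext _ _ <| proj_hom_ext <| by
    rw [add_hom, Preadditive.comp_add, proj_whiskerLeft, proj_whiskerLeft, proj_whiskerLeft,
      ← Preadditive.add_comp, ← MonoidalPreadditive.whiskerLeft_add, add_hom]

theorem bimod_add_whiskerRight {M N T : Mon C} {P P' : Bimod M N} (f g : P ⟶ P')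
    (Q : Bimod N T) :
    Bimod.whiskerRight (f + g) Q = Bimod.whiskerRight f Q + Bimod.whiskerRight g Q :=
  Bimod.hom_ext _ _ <| proj_hom_ext <| by
    rw [add_hom, Preadditive.comp_add, proj_whiskerRight, proj_whiskerRight, proj_whiskerRight,
      ← Preadditive.add_comp, ← MonoidalPreadditive.add_whiskerRight, add_hom]

end Additive

end Bim

/-- The 0-morphisms of the bicategory `BIM(C)` of internal bimodules: the monoids in `C`. -/
def Bim (C : Type u₁) [Category.{v} C] [MonoidalCategory C] : Type (max u₁ v) := Mon C

variable {C : Type u₁} [Category.{v} C] [MonoidalCategory C] [HasCoequalizers C]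
  [∀ X : C, PreservesColimitsOfSize.{0, 0} (tensorLeft X)]
  [∀ X : C, PreservesColimitsOfSize.{0, 0} (tensorRight X)]

/-- The bicategory `BIM(C)` of internal bimodules. The 1-morphisms `M ⟶ N` are the `M`-`N`
bimodules, the composite `P ≫ Q` is the tensor product over the monoid in the middle. -/
instance : Bicategory (Bim C) := Bimod.monBicategory (C := C)

namespace Bim

instance [Preadditive C] [MonoidalPreadditive C] : PreadditiveBicategory (Bim C) where
  homPreadditive M N := bimodPreadditive (C := C) M N
  whiskerLeft_add P _ _ f g := bimod_whiskerLeft_add (C := C) P f g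
  add_whiskerRight f g Q := bimod_add_whiskerRight (C := C) f g Q

/-- A monoid as a 0-morphism. -/
def of (Q : Mon C) : Bim C := Q

/-- A bimodule as a 1-morphism. -/
def ofBimod {M N : Mon C} (P : Bimod M N) : of M ⟶ of N := P

/-- The object of `C` underlying a 1-morphism. -/
def obj {M N : Bim C} (P : M ⟶ N) : C := Bimod.X (C := C) P

/-- The morphism of `C` underlying a 2-morphism. -/
def hom {M N : Bim C} {P Q : M ⟶ N} (f : P ⟶ Q) : obj P ⟶ obj Q := Bimod.Hom.hom f

/-- The 1-morphism `𝒳 = (Q, l_Q, μ)` from the trivial monoid to the monoid `Q`. -/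
def X (Q : Mon C) : of (Mon.trivial C) ⟶ of Q := ofBimod (unitReg Q)

/-- The 1-morphism `(Q, μ, r_Q)` from the monoid `Q` to the trivial monoid. -/
def XBar (Q : Mon C) : of Q ⟶ of (Mon.trivial C) := ofBimod (regUnit Q)

/-- The canonical projection `Q ⊗ Q → obj (XBar Q ≫ X Q)`. -/
def τ (Q : Mon C) : Q.X ⊗ Q.X ⟶ obj (XBar Q ≫ X Q) := proj (regUnit Q) (unitReg Q)

/-- The canonical map `Q ⊗_Q Q → Q`. -/
def m (Q : Mon C) : obj (X Q ≫ XBar Q) ⟶ Q.X := mulDesc Q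

/-- For a monoid `Q` with comultiplication `δ` and counit `ε`, the two-sided dual `(Q, μ, r_Q)` of
`(Q, l_Q, μ)` is exhibited by `ev_L = μ`, `coev_L = η`, `ev_R = ε` and `coev_R = δ`, up to the
canonical maps `Q ⊗ Q → Q ⊗_U Q` and `Q ⊗_Q Q → Q`. -/
structure IsCanonicalDual (Q : Mon C) (δ : Q.X ⟶ Q.X ⊗ Q.X) (ε : Q.X ⟶ 𝟙_ C)
    (F : FrobeniusDual (X Q) (XBar Q)) : Prop where
  evL : τ Q ≫ hom F.evL = μ
  coevL : hom F.coevL ≫ m Q = η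
  evR : hom F.evR = m Q ≫ ε
  coevR : hom F.coevR = δ ≫ τ Q

end Bim

end InternalBimodules

section RegularModule

open MonoidalCategory MonObj

variable {H R : Type u} [Ring H] [Ring R] (B : RightBialgebroid H R)

namespace RightBialgebroid

/-- The right regular module `H_H` as an object of `ℳ_H`. -/
def regObj : B.RMod := RMod.of B H

/-- An element of `H` as an element of `H_H`. -/
def toReg (h : H) : B.regObj := h

/-- Left multiplication `Λ(h) : k ↦ h k` as an endomorphism of `H_H`. -/
def Λ (h : H) : B.regObj ⟶ B.regObj :=
  RMod.ofLin (M := B.regObj) (N := B.regObj)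
    (show H →ₗ[Hᵐᵒᵖ] H from
      { toFun := fun k => h * k
        map_add' := mul_add h
        map_smul' := fun x k => (mul_assoc h k x.unop).symm })

/-- The morphism `H_H → M` with `1 ↦ m`, that is, `h ↦ m · h`. -/
def fromReg {M : B.RMod} (m : M) : B.regObj ⟶ M :=
  RMod.ofLin (M := B.regObj) (N := M)
    (show H →ₗ[Hᵐᵒᵖ] M from
      { toFun := fun h => op h • m
        map_add' := fun h k => by simp [add_smul]
        map_smul' := fun x h => by simp [← mul_smul] })

/-- The coproduct of `B` as a morphism `H_H → H_H ⊗ H_H`,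
`h ↦ (1 ⊗ 1) · h = h⁽¹⁾ ⊗ h⁽²⁾`. -/
def comulHom : B.regObj ⟶ B.regObj ⊗ B.regObj :=
  B.fromReg (RMod.pure (B.toReg 1) (B.toReg 1))

theorem lin_comulHom (h : H) (w : H ⊗[ℤ] H) (hw : Bal.mk _ _ w = B.γ h) :
    RMod.lin B.comulHom (B.toReg h) = B.tmk H H w := by
  change B.orbit (1 : H) (1 : H) (B.γ h) = _
  rw [← hw]
  clear hw
  induction w with
  | zero => simp
  | tmul x y => rw [orbit_mk_tmul]; simp
  | add x y hx hy => rw [map_add, map_add, hx, hy, map_add]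

/-- The counit of `B` as a morphism from `H_H` to the monoidal unit,
`h ↦ 1 · h = π(h)`. -/
def counitHom : B.regObj ⟶ 𝟙_ B.RMod := B.fromReg (RMod.unitElt 1)

theorem lin_counitHom (h : H) :
    RMod.lin B.counitHom (B.toReg h) = RMod.unitElt (B.π h) := by
  change B.toUnit (B.π (B.s 1 * h)) = B.toUnit (B.π h)
  rw [map_one, _root_.one_mul]

end RightBialgebroid

open RightBialgebroid

namespace HopfAlgebroid

variable {L : Type u} [Ring L] (ℋ : HopfAlgebroid H L R)

/-- The monoid structure `m` on `H_H` is given by the convolution product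
`(i ↽ φ) ∗ (i ↽ ψ) = i ↽ (φ ψ)`, where `φ` and `ψ` belong to the dual ring `_*H`, with the unit
`r ↦ i s_R(r)`. -/
structure IsConvolution (i : H) (m : MonObj ℋ.right.regObj) : Prop where
  mul : ∀ φ ψ : ℋ.left.LDual,
    RMod.lin m.mul (RMod.pure (ℋ.right.toReg (ℋ.left.actLDual φ i))
      (ℋ.right.toReg (ℋ.left.actLDual ψ i))) = ℋ.right.toReg (ℋ.left.actLDual (φ.mul ψ) i)
  one : ∀ r : R, RMod.lin m.one (RMod.unitElt r) = ℋ.right.toReg (i * ℋ.right.s r)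

/-- The monoid `𝒬 = (H_H, ∗, η)`. -/
def convMon (m : MonObj ℋ.right.regObj) : Mon ℋ.right.RMod where
  X := ℋ.right.regObj
  mon := m

end HopfAlgebroid

end RegularModule
end

end Algebroid

open Algebroid

/-! The theorem is Frobenius theory for the total ring, written in Sweedler sums (lower indices for
γ_L, upper indices for γ_R). For a right integral `i`, non-degeneracy amounts to the existence of
one functional `p : H → L`, the Frobenius form, for which p(· S(i₍₁₎)), i₍₂₎ and p(i₍₂₎ S(·)), i₍₁₎
are dual bases (`exists_isFrobeniusForm`, `isRightNondegenerate`). It is the preimage of 1 under φ ↦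
i ↽ φ; the transfer rule i₍₁₎h ⊗ i₍₂₎ = i₍₁₎ ⊗ i₍₂₎S(h) of right integrals
(`IsRightIntegral.ev_mul_left`) does the rest. Every such `i` has p(i) = 1. If `i` is also a left
integral, then p(bi) = π_L(b), and the dual basis expansion of S⁻¹(i) is the counit expansion of
`i`, so S(i) = i (`S_self`). Conversely S turns right integrals into left ones. All of this needs
that S reverses products and coproducts (`S_mul`, `ev_S`), which also exchanges left and right
non-degeneracy (`isLeftNondegenerate_S_iff`).

Given `i` and `p`, the product a ∗ k = t_L(p(a₍₂₎S(k)))a₍₁₎ is the product of the dual ring carried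
over to H. It has two descriptions (`star` and `star_eq`), unit `i`, satisfies a ∗ 1 = s_L(p(a)), is
H-linear, and γ_R is a bimodule map for it (`ev_star`, `ev_star_left`, `ev_star_right`). So (H, ∗,
i, γ_R, π_R) is a Frobenius algebra in ℳ_H, and its regular bimodules over the trivial monoid form a
Frobenius 1-morphism. The composite 𝒳 × 𝒳̄ is the regular module H_H, whose endomorphisms are the
left multiplications; linearity over the monoid cuts out s_L(L) and s_R(R) as the endomorphisms of 𝒳
and of 𝒳̄. Evaluated on elements, φ_L becomes `p`, i_A becomes `i`, the convolution of
2-endomorphisms becomes ∗, and the double Fourier transform becomes S. The symmetry is obtained by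
transporting the Hopf algebroid along these ring isomorphisms, and the prescribed formulas are then
verified. Depth 2 is witnessed by S(i₍₁₎) ⊗ i₍₂₎ and by its mirror image.

For the converse, in the symmetry of any D2 Frobenius 1-morphism the element i_A is a left integral
fixed by S, hence two-sided. A D2 quasi-basis is a pair of dual bases for φ_L, and γ_L(i_A) = ∑
S⁻¹(y_k) ⊗ x_k because i_A is the unit of the convolution product; so φ_L is a Frobenius form for
i_A (`IsSymmetry.exists_frobeniusIntegral`). -/

namespace Algebroid

noncomputable section

/-! ### Sweedler calculus for tensor products over noncommutative rings -/

section SweedlerSums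

variable {R R' M N P T : Type*} [AddCommGroup M] [AddCommGroup N] [AddCommGroup P]
  [AddCommGroup T]

/-- Biadditive maps which are balanced over `R`. -/
structure IsBal (ρ : M → R → M) (l : R → N → N) (f : M → N → T) : Prop where
  add_left : ∀ m m' n, f (m + m') n = f m n + f m' n
  add_right : ∀ m n n', f m (n + n') = f m n + f m n'
  bal : ∀ m r n, f (ρ m r) n = f m (l r n)

/-- Triadditive maps which are balanced over `R` and over `R'`. -/
structure IsBal3 (ρ : M → R → M) (l : R → N → N) (ρ' : N → R' → N) (l' : R' → P → P)
    (F : M → N → P → T) : Prop where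
  add₁ : ∀ m m' n p, F (m + m') n p = F m n p + F m' n p
  add₂ : ∀ m n n' p, F m (n + n') p = F m n p + F m n' p
  add₃ : ∀ m n p p', F m n (p + p') = F m n p + F m n p'
  bal₁ : ∀ m r n p, F (ρ m r) n p = F m (l r n) p
  bal₂ : ∀ m n r p, F m (ρ' n r) p = F m n (l' r p)

variable {ρ : M → R → M} {l : R → N → N} {ρ' : N → R' → N} {l' : R' → P → P}

namespace IsBal

variable {f : M → N → T}

/-- The additive map on the tensor product over `R`. -/
def lift (hf : IsBal ρ l f) : Bal ρ l →+ T :=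
  Bal.lift (tlift (AddMonoidHom.mk' (fun m => AddMonoidHom.mk' (f m) (hf.add_right m))
    (fun m m' => by ext n; exact hf.add_left m m' n))) hf.bal

theorem sum_left (hf : IsBal ρ l f) {ι : Type*} (s : Finset ι) (g : ι → M) (n : N) :
    f (∑ k ∈ s, g k) n = ∑ k ∈ s, f (g k) n :=
  map_sum (AddMonoidHom.mk' (fun m => f m n) fun m m' => hf.add_left m m' n) g s

theorem sum_right (hf : IsBal ρ l f) {ι : Type*} (s : Finset ι) (m : M) (g : ι → N) :
    f m (∑ k ∈ s, g k) = ∑ k ∈ s, f m (g k) :=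
  map_sum (AddMonoidHom.mk' (f m) (hf.add_right m)) g s

end IsBal

namespace Bal

theorem exists_rep (x : Bal ρ l) : ∃ s : Finset (M × N), x = ∑ p ∈ s, mk ρ l (p.1 ⊗ₜ p.2) := by
  obtain ⟨w, rfl⟩ := mk_surjective x
  obtain ⟨s, hs⟩ := TensorProduct.exists_finset (R := ℤ) w
  exact ⟨s, by rw [← map_sum, ← hs]⟩

/-- A finite family of pairs which represents an element of a tensor product. -/
def rep (x : Bal ρ l) : Finset (M × N) := (exists_rep x).choose

theorem rep_spec (x : Bal ρ l) : x = ∑ p ∈ rep x, mk ρ l (p.1 ⊗ₜ p.2) := (exists_rep x).choose_spec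

/-- The representing family as an element of `M ⊗ N`. -/
def repT (x : Bal ρ l) : M ⊗[ℤ] N := ∑ p ∈ rep x, p.1 ⊗ₜ p.2

theorem mk_repT (x : Bal ρ l) : mk ρ l (repT x) = x := by
  rw [repT, map_sum, ← rep_spec]

/-- The Sweedler sum of `f` over a representing family. -/
def sw (x : Bal ρ l) (f : M → N → T) : T := ∑ p ∈ rep x, f p.1 p.2

/-- The sum `sw` makes sense for every function, being taken over one chosen family of
representatives. Balance is what makes its value independent of that choice, and only through this
lemma do relations in the tensor product become usable. -/
theorem sw_eq_lift {f : M → N → T} (hf : IsBal ρ l f) (x : Bal ρ l) : sw x f = hf.lift x := by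
  conv_rhs => rw [rep_spec x, map_sum]
  rfl

theorem lift_eq_sw {f : M ⊗[ℤ] N →+ T} (h : ∀ m r n, f (ρ m r ⊗ₜ n) = f (m ⊗ₜ l r n))
    (x : Bal ρ l) : Bal.lift f h x = sw x fun m n => f (m ⊗ₜ n) := by
  conv_lhs => rw [rep_spec x, map_sum]
  rfl

theorem sw_mk_tmul {f : M → N → T} (hf : IsBal ρ l f) (m : M) (n : N) :
    sw (mk ρ l (m ⊗ₜ n)) f = f m n := by
  rw [sw_eq_lift hf]; rfl

theorem sw_add_fun (x : Bal ρ l) (f g : M → N → T) :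
    sw x (fun m n => f m n + g m n) = sw x f + sw x g := Finset.sum_add_distrib

theorem map_sw {T' F : Type*} [AddCommGroup T'] [FunLike F T T'] [AddMonoidHomClass F T T'] (φ : F)
    (x : Bal ρ l) (f : M → N → T) : φ (sw x f) = sw x fun m n => φ (f m n) :=
  map_sum φ _ _

theorem sw_mk (x : Bal ρ l) : sw x (fun m n => mk ρ l (m ⊗ₜ n)) = x := (rep_spec x).symm

/-- Both sides are sums over fixed finite sets, so no balance is required. This permits the
interchange of two unrelated coproducts inside an expression. -/
theorem sw_comm {R₂ M₂ N₂ : Type*} [AddCommGroup M₂] [AddCommGroup N₂] {ρ₂ : M₂ → R₂ → M₂}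
    {l₂ : R₂ → N₂ → N₂} (x : Bal ρ l) (y : Bal ρ₂ l₂) (f : M → N → M₂ → N₂ → T) :
    sw x (fun m n => sw y fun m' n' => f m n m' n') =
      sw y fun m' n' => sw x fun m n => f m n m' n' := Finset.sum_comm

theorem mul_sw {A : Type*} [Ring A] (x : Bal ρ l) (f : M → N → A) (a : A) :
    a * sw x f = sw x fun m n => a * f m n := Finset.mul_sum _ _ _

theorem sw_mul {A : Type*} [Ring A] (x : Bal ρ l) (f : M → N → A) (a : A) :
    sw x f * a = sw x fun m n => f m n * a := Finset.sum_mul _ _ _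

theorem isBal_mk : IsBal ρ l fun m n => mk ρ l (m ⊗ₜ n) where
  add_left m m' n := by rw [TensorProduct.add_tmul, map_add]
  add_right m n n' := by rw [TensorProduct.tmul_add, map_add]
  bal := mk_balance

end Bal

namespace IsBal

variable {f : M → N → T}

theorem sw_left (hf : IsBal ρ l f) {R₂ M₂ N₂ : Type*} [AddCommGroup M₂] [AddCommGroup N₂] {ρ₂ : M₂ → R₂ → M₂}
    {l₂ : R₂ → N₂ → N₂} (x : Bal ρ₂ l₂) (g : M₂ → N₂ → M) (n : N) :
    f (x.sw g) n = x.sw fun a b => f (g a b) n := hf.sum_left _ _ _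

theorem sw_right (hf : IsBal ρ l f) {R₂ M₂ N₂ : Type*} [AddCommGroup M₂] [AddCommGroup N₂] {ρ₂ : M₂ → R₂ → M₂}
    {l₂ : R₂ → N₂ → N₂} (x : Bal ρ₂ l₂) (g : M₂ → N₂ → N) (m : M) :
    f m (x.sw g) = x.sw fun a b => f m (g a b) := hf.sum_right _ _ _

theorem comp (hf : IsBal ρ l f) {T' : Type*} [AddCommGroup T'] {F : Type*} [FunLike F T T'] [AddMonoidHomClass F T T']
    (φ : F) : IsBal ρ l fun m n => φ (f m n) where
  add_left m m' n := by rw [hf.add_left, map_add]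
  add_right m n n' := by rw [hf.add_right, map_add]
  bal m r n := by rw [hf.bal]

end IsBal

namespace IsBal3

variable {F : M → N → P → T}

theorem isBal_left (hF : IsBal3 ρ l ρ' l' F) (p : P) : IsBal ρ l fun m n => F m n p :=
  ⟨fun m m' n => hF.add₁ m m' n p, fun m n n' => hF.add₂ m n n' p, fun m r n => hF.bal₁ m r n p⟩

theorem isBal_right (hF : IsBal3 ρ l ρ' l' F) (m : M) : IsBal ρ' l' fun n p => F m n p :=
  ⟨hF.add₂ m, hF.add₃ m, hF.bal₂ m⟩

/-- The additive map on the triple tensor product. -/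
def lift (hF : IsBal3 ρ l ρ' l' F) : Bal3 ρ l ρ' l' →+ T :=
  Bal3.lift (tlift (AddMonoidHom.mk' (fun x => AddMonoidHom.mk'
      (fun p => (hF.isBal_left p).lift x) (fun p p' => by
        rw [← AddMonoidHom.add_apply]
        congr 1
        exact Bal.hom_ext fun m n => hF.add₃ m n p p'))
      (fun x y => by ext p; exact map_add (hF.isBal_left p).lift x y)))
    (fun m n r p => hF.bal₂ m n r p)

theorem lift_mkL (hF : IsBal3 ρ l ρ' l' F) (p : P) (y : Bal ρ l) :
    hF.lift (Bal3.mkL ρ l ρ' l' (y ⊗ₜ p)) = y.sw fun m n => F m n p :=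
  (Bal.sw_eq_lift (hF.isBal_left p) y).symm

/-- Together with `lift_mkL` this reads an equation in a triple tensor product as an equation
between nested Sweedler sums, the form in which every coassociativity axiom is applied. -/
theorem lift_mkR (hF : IsBal3 ρ l ρ' l' F) (m : M) (y : Bal ρ' l') :
    hF.lift (Bal3.mkR ρ l ρ' l' (m ⊗ₜ y)) = y.sw fun n p => F m n p := by
  rw [Bal.sw_eq_lift (hF.isBal_right m) y]
  have : hF.lift.comp ((Bal3.mkR ρ l ρ' l').comp (TensorProduct.mk ℤ M (Bal ρ' l') m).toAddMonoidHom) =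
      (hF.isBal_right m).lift := Bal.hom_ext fun n p => rfl
  exact DFunLike.congr_fun this y

end IsBal3

end SweedlerSums

/-! ### The axioms as identities between Sweedler sums -/

section Bialgebroids

variable {A L R T : Type*} [Ring A] [Ring L] [Ring R] [AddCommGroup T]

namespace LeftBialgebroid

variable (B : LeftBialgebroid A L)

theorem γ_t (l : L) : B.γ (B.t (op l)) = Bal.mk _ _ (1 ⊗ₜ B.t (op l)) := by
  simpa using B.γ_right l 1 (1 ⊗ₜ 1) B.γ_one.symm

theorem π_s (l : L) : B.π (B.s l) = l := by
  simpa [B.π_one] using B.π_left l 1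

theorem π_t (l : L) : B.π (B.t (op l)) = l := by
  simpa [B.π_one] using B.π_right l 1

/-- Biadditive maps on `A` which are balanced with respect to `A_L ⊗ _L A`. -/
abbrev IsBal (f : A → A → T) : Prop :=
  Algebroid.IsBal (fun (a : A) (l : L) => B.t (op l) * a) (fun (l : L) (a : A) => B.s l * a) f

/-- The Sweedler sum `f(a₍₁₎, a₍₂₎)`. -/
def ev (f : A → A → T) (a : A) : T := (B.γ a).sw f

variable {B} {f : A → A → T}

theorem map_ev {T' F : Type*} [AddCommGroup T'] [FunLike F T T'] [AddMonoidHomClass F T T']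
    (φ : F) (f : A → A → T) (a : A) : φ (B.ev f a) = B.ev (fun x y => φ (f x y)) a :=
  Bal.map_sw φ _ f

theorem mul_ev (c : A) (f : A → A → A) (a : A) : c * B.ev f a = B.ev (fun x y => c * f x y) a :=
  Bal.mul_sw _ f c

theorem ev_mul_const (c : A) (f : A → A → A) (a : A) :
    B.ev f a * c = B.ev (fun x y => f x y * c) a :=
  Bal.sw_mul _ f c

theorem ev_add_fun (f g : A → A → T) (a : A) :
    B.ev (fun x y => f x y + g x y) a = B.ev f a + B.ev g a := Bal.sw_add_fun _ f g

theorem ev_isBal_left {R₂ M₂ N₂ : Type*} [AddCommGroup M₂] [AddCommGroup N₂]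
    {ρ₂ : M₂ → R₂ → M₂} {l₂ : R₂ → N₂ → N₂} {g : M₂ → N₂ → T} (hg : Algebroid.IsBal ρ₂ l₂ g)
    (f : A → A → M₂) (n : N₂) (a : A) : g (B.ev f a) n = B.ev (fun x y => g (f x y) n) a :=
  hg.sw_left _ f n

theorem ev_isBal_right {R₂ M₂ N₂ : Type*} [AddCommGroup M₂] [AddCommGroup N₂]
    {ρ₂ : M₂ → R₂ → M₂} {l₂ : R₂ → N₂ → N₂} {g : M₂ → N₂ → T} (hg : Algebroid.IsBal ρ₂ l₂ g)
    (m : M₂) (f : A → A → N₂) (a : A) : g m (B.ev f a) = B.ev (fun x y => g m (f x y)) a :=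
  hg.sw_right _ f m

theorem ev_add (hf : B.IsBal f) (a b : A) : B.ev f (a + b) = B.ev f a + B.ev f b := by
  simp only [ev, Bal.sw_eq_lift hf, map_add]

theorem ev_sum (hf : B.IsBal f) {ι : Type*} (s : Finset ι) (g : ι → A) :
    B.ev f (∑ k ∈ s, g k) = ∑ k ∈ s, B.ev f (g k) := by
  simp only [ev, Bal.sw_eq_lift hf, map_sum]

theorem ev_sw (hf : B.IsBal f) {R₂ M₂ N₂ : Type*} [AddCommGroup M₂] [AddCommGroup N₂]
    {ρ₂ : M₂ → R₂ → M₂} {l₂ : R₂ → N₂ → N₂} (x : Bal ρ₂ l₂) (g : M₂ → N₂ → A) :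
    B.ev f (x.sw g) = x.sw fun p q => B.ev f (g p q) := ev_sum hf _ _

theorem ev_one (hf : B.IsBal f) : B.ev f 1 = f 1 1 := by
  rw [ev, B.γ_one, Bal.sw_mk_tmul hf]

theorem ev_s_mul (hf : B.IsBal f) (l : L) (a : A) :
    B.ev f (B.s l * a) = B.ev (fun x y => f (B.s l * x) y) a := by
  rw [ev, B.γ_left l a _ (Bal.mk_repT _), Bal.sw_eq_lift hf, Bal.repT]
  simp only [map_sum]
  rfl

theorem ev_t_mul (hf : B.IsBal f) (l : L) (a : A) :
    B.ev f (B.t (op l) * a) = B.ev (fun x y => f x (B.t (op l) * y)) a := by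
  rw [ev, B.γ_right l a _ (Bal.mk_repT _), Bal.sw_eq_lift hf, Bal.repT]
  simp only [map_sum]
  rfl

/-- The product of representatives of γ(a) and γ(b) represents γ(ab). Only `f` itself has to be
balanced, since the double sum runs over these fixed representatives. -/
theorem ev_mul (hf : B.IsBal f) (a b : A) :
    B.ev f (a * b) = B.ev (fun x y => B.ev (fun x' y' => f (x * x') (y * y')) b) a := by
  rw [ev, B.γ_mul a b _ _ (Bal.mk_repT _) (Bal.mk_repT _), Bal.sw_eq_lift hf, Bal.repT, Bal.repT,
    Finset.sum_mul_sum]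
  simp only [map_sum, Algebra.TensorProduct.tmul_mul_tmul]
  rfl

theorem ev_mul_t (hf : B.IsBal f) (a : A) (l : L) :
    B.ev f (a * B.t (op l)) = B.ev (fun x y => f x (y * B.t (op l))) a := by
  rw [ev, B.γ_mul a (B.t (op l)) _ (1 ⊗ₜ B.t (op l)) (Bal.mk_repT _) (B.γ_t l).symm,
    Bal.sw_eq_lift hf, Bal.repT, Finset.sum_mul]
  simp only [map_sum, Algebra.TensorProduct.tmul_mul_tmul, mul_one]
  rfl

theorem isBal_mul_mul (hf : B.IsBal f) (a b : A) : B.IsBal fun x y => f (x * a) (y * b) :=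
  ⟨fun m m' n => by rw [add_mul, hf.add_left], fun m n n' => by rw [add_mul, hf.add_right],
    fun m r n => by rw [mul_assoc, hf.bal, mul_assoc]⟩

theorem isBal_mul_left (hf : B.IsBal f) (a : A) : B.IsBal fun x y => f (x * a) y := by
  simpa using isBal_mul_mul hf a 1

theorem isBal_mul_right (hf : B.IsBal f) (b : A) : B.IsBal fun x y => f x (y * b) := by
  simpa using isBal_mul_mul hf 1 b

/-- Balance over L concerns multiplication from the left. An element of the base ring multiplied
from the right crosses the tensor sign only by the Takeuchi condition, hence only next to a
coproduct. -/
theorem ev_takeuchi (hf : B.IsBal f) (l : L) (a : A) :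
    B.ev (fun x y => f (x * B.t (op l)) y) a = B.ev (fun x y => f x (y * B.s l)) a := by
  have h := congrArg hf.lift (B.takeuchi l a _ (Bal.mk_repT _))
  simp only [Bal.repT, map_sum] at h
  exact h

theorem ev_counit_left (a : A) : B.ev (fun x y => B.s (B.π x) * y) a = a := by
  have h := B.counit_left a _ (Bal.mk_repT _)
  simp only [Bal.repT, map_sum] at h
  exact h

theorem ev_counit_right (a : A) : B.ev (fun x y => B.t (op (B.π y)) * x) a = a := by
  have h := B.counit_right a _ (Bal.mk_repT _)
  simp only [Bal.repT, map_sum] at h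
  exact h

/-- Triadditive maps on `A` which are balanced with respect to `A_L ⊗ _L A_L ⊗ _L A`. -/
abbrev IsBal3 (B : LeftBialgebroid A L) (F : A → A → A → T) : Prop :=
  Algebroid.IsBal3 (fun (a : A) (l : L) => B.t (op l) * a) (fun (l : L) (a : A) => B.s l * a)
    (fun (a : A) (l : L) => B.t (op l) * a) (fun (l : L) (a : A) => B.s l * a) F

theorem ev_coassoc {F : A → A → A → T} (hF : B.IsBal3 F) (a : A) :
    B.ev (fun x z => B.ev (fun x y => F x y z) x) a =
      B.ev (fun x y => B.ev (fun y z => F x y z) y) a := by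
  have h := congrArg hF.lift (B.coassoc a _ (Bal.mk_repT _))
  simp only [Bal.repT, map_sum, tmap_tmul, hF.lift_mkL, hF.lift_mkR] at h
  exact h

end LeftBialgebroid

namespace RightBialgebroid

variable (B : RightBialgebroid A R)

theorem π_t (r : R) : B.π (B.t (op r)) = r := by
  simpa [B.π_one] using B.π_left r 1

theorem γ_s_of_right (r : R) : B.γ (B.s r) = Bal.mk _ _ (1 ⊗ₜ B.s r) := by
  simpa using B.γ_right r 1 (1 ⊗ₜ 1) B.γ_one.symm

theorem γ_t_of_right (r : R) : B.γ (B.t (op r)) = Bal.mk _ _ (B.t (op r) ⊗ₜ 1) := by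
  simpa using B.γ_left r 1 (1 ⊗ₜ 1) B.γ_one.symm

/-- Biadditive maps on `A` which are balanced with respect to `A^R ⊗ ^R A`. -/
abbrev IsBal (f : A → A → T) : Prop :=
  Algebroid.IsBal (fun (a : A) (r : R) => a * B.s r) (fun (r : R) (a : A) => a * B.t (op r)) f

/-- The Sweedler sum `f(a⁽¹⁾, a⁽²⁾)`. -/
def ev (f : A → A → T) (a : A) : T := (B.γ a).sw f

variable {B} {f : A → A → T}

theorem map_ev {T' F : Type*} [AddCommGroup T'] [FunLike F T T'] [AddMonoidHomClass F T T']
    (φ : F) (f : A → A → T) (a : A) : φ (B.ev f a) = B.ev (fun x y => φ (f x y)) a :=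
  Bal.map_sw φ _ f

theorem mul_ev (c : A) (f : A → A → A) (a : A) : c * B.ev f a = B.ev (fun x y => c * f x y) a :=
  Bal.mul_sw _ f c

theorem ev_add_fun (f g : A → A → T) (a : A) :
    B.ev (fun x y => f x y + g x y) a = B.ev f a + B.ev g a := Bal.sw_add_fun _ f g

theorem ev_isBal_left {R₂ M₂ N₂ : Type*} [AddCommGroup M₂] [AddCommGroup N₂]
    {ρ₂ : M₂ → R₂ → M₂} {l₂ : R₂ → N₂ → N₂} {g : M₂ → N₂ → T} (hg : Algebroid.IsBal ρ₂ l₂ g)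
    (f : A → A → M₂) (n : N₂) (a : A) : g (B.ev f a) n = B.ev (fun x y => g (f x y) n) a :=
  hg.sw_left _ f n

theorem ev_isBal_right {R₂ M₂ N₂ : Type*} [AddCommGroup M₂] [AddCommGroup N₂]
    {ρ₂ : M₂ → R₂ → M₂} {l₂ : R₂ → N₂ → N₂} {g : M₂ → N₂ → T} (hg : Algebroid.IsBal ρ₂ l₂ g)
    (m : M₂) (f : A → A → N₂) (a : A) : g m (B.ev f a) = B.ev (fun x y => g m (f x y)) a :=
  hg.sw_right _ f m

theorem ev_add (hf : B.IsBal f) (a b : A) : B.ev f (a + b) = B.ev f a + B.ev f b := by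
  simp only [ev, Bal.sw_eq_lift hf, map_add]

theorem ev_sum (hf : B.IsBal f) {ι : Type*} (s : Finset ι) (g : ι → A) :
    B.ev f (∑ k ∈ s, g k) = ∑ k ∈ s, B.ev f (g k) := by
  simp only [ev, Bal.sw_eq_lift hf, map_sum]

theorem ev_sw (hf : B.IsBal f) {R₂ M₂ N₂ : Type*} [AddCommGroup M₂] [AddCommGroup N₂]
    {ρ₂ : M₂ → R₂ → M₂} {l₂ : R₂ → N₂ → N₂} (x : Bal ρ₂ l₂) (g : M₂ → N₂ → A) :
    B.ev f (x.sw g) = x.sw fun p q => B.ev f (g p q) := ev_sum hf _ _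

theorem ev_s (hf : B.IsBal f) (r : R) : B.ev f (B.s r) = f 1 (B.s r) := by
  rw [ev, γ_s_of_right, Bal.sw_mk_tmul hf]

theorem ev_t (hf : B.IsBal f) (r : R) : B.ev f (B.t (op r)) = f (B.t (op r)) 1 := by
  rw [ev, γ_t_of_right, Bal.sw_mk_tmul hf]

theorem ev_mul (hf : B.IsBal f) (a b : A) :
    B.ev f (a * b) = B.ev (fun x y => B.ev (fun x' y' => f (x * x') (y * y')) b) a := by
  rw [ev, B.γ_mul a b _ _ (Bal.mk_repT _) (Bal.mk_repT _), Bal.sw_eq_lift hf, Bal.repT, Bal.repT,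
    Finset.sum_mul_sum]
  simp only [map_sum, Algebra.TensorProduct.tmul_mul_tmul]
  rfl

theorem ev_s_mul (hf : B.IsBal f) (r : R) (a : A) :
    B.ev f (B.s r * a) = B.ev (fun x y => f x (B.s r * y)) a := by
  rw [ev, B.γ_mul (B.s r) a (1 ⊗ₜ B.s r) _ (B.γ_s_of_right r).symm (Bal.mk_repT _),
    Bal.sw_eq_lift hf, Bal.repT, Finset.mul_sum]
  simp only [map_sum, Algebra.TensorProduct.tmul_mul_tmul, one_mul]
  rfl

theorem ev_t_mul (hf : B.IsBal f) (r : R) (a : A) :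
    B.ev f (B.t (op r) * a) = B.ev (fun x y => f (B.t (op r) * x) y) a := by
  rw [ev, B.γ_mul (B.t (op r)) a (B.t (op r) ⊗ₜ 1) _ (B.γ_t_of_right r).symm (Bal.mk_repT _),
    Bal.sw_eq_lift hf, Bal.repT, Finset.mul_sum]
  simp only [map_sum, Algebra.TensorProduct.tmul_mul_tmul, one_mul]
  rfl

theorem isBal_mul_mul (hf : B.IsBal f) (a b : A) : B.IsBal fun x y => f (a * x) (b * y) :=
  ⟨fun m m' n => by rw [mul_add, hf.add_left], fun m n n' => by rw [mul_add, hf.add_right],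
    fun m r n => by rw [← mul_assoc, hf.bal, mul_assoc]⟩

theorem isBal_mul_left (hf : B.IsBal f) (a : A) : B.IsBal fun x y => f (a * x) y := by
  simpa using isBal_mul_mul hf a 1

theorem isBal_mul_right (hf : B.IsBal f) (b : A) : B.IsBal fun x y => f x (b * y) := by
  simpa using isBal_mul_mul hf 1 b

theorem ev_takeuchi (hf : B.IsBal f) (r : R) (a : A) :
    B.ev (fun x y => f (B.s r * x) y) a = B.ev (fun x y => f x (B.t (op r) * y)) a := by
  have h := congrArg hf.lift (B.takeuchi r a _ (Bal.mk_repT _))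
  simp only [Bal.repT, map_sum] at h
  exact h

theorem ev_counit_left (a : A) : B.ev (fun x y => y * B.t (op (B.π x))) a = a := by
  have h := B.counit_left a _ (Bal.mk_repT _)
  simp only [Bal.repT, map_sum] at h
  exact h

theorem ev_counit_right (a : A) : B.ev (fun x y => x * B.s (B.π y)) a = a := by
  have h := B.counit_right a _ (Bal.mk_repT _)
  simp only [Bal.repT, map_sum] at h
  exact h

end RightBialgebroid

namespace HopfAlgebroid

variable {H : HopfAlgebroid A L R}

/-- Triadditive maps on `A` which are balanced with respect to `A_L ⊗ _L A^R ⊗ ^R A`. -/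
abbrev IsBalLR (H : HopfAlgebroid A L R) (F : A → A → A → T) : Prop :=
  Algebroid.IsBal3 (fun (a : A) (l : L) => H.left.t (op l) * a)
    (fun (l : L) (a : A) => H.left.s l * a)
    (fun (a : A) (r : R) => a * H.right.s r) (fun (r : R) (a : A) => a * H.right.t (op r)) F

/-- Triadditive maps on `A` which are balanced with respect to `A^R ⊗ ^R A_L ⊗ _L A`. -/
abbrev IsBalRL (H : HopfAlgebroid A L R) (F : A → A → A → T) : Prop :=
  Algebroid.IsBal3 (fun (a : A) (r : R) => a * H.right.s r)
    (fun (r : R) (a : A) => a * H.right.t (op r))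
    (fun (a : A) (l : L) => H.left.t (op l) * a) (fun (l : L) (a : A) => H.left.s l * a) F

theorem ev_coassocLR {F : A → A → A → T} (hF : H.IsBalLR F) (a : A) :
    H.right.ev (fun x z => H.left.ev (fun x y => F x y z) x) a =
      H.left.ev (fun x y => H.right.ev (fun y z => F x y z) y) a := by
  have h := congrArg hF.lift (H.coassoc_left_right a _ _ (Bal.mk_repT _) (Bal.mk_repT _))
  simp only [Bal.repT, map_sum, tmap_tmul, hF.lift_mkL, hF.lift_mkR] at h
  exact h

theorem ev_coassocRL {F : A → A → A → T} (hF : H.IsBalRL F) (a : A) :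
    H.left.ev (fun x z => H.right.ev (fun x y => F x y z) x) a =
      H.right.ev (fun x y => H.left.ev (fun y z => F x y z) y) a := by
  have h := congrArg hF.lift (H.coassoc_right_left a _ _ (Bal.mk_repT _) (Bal.mk_repT _))
  simp only [Bal.repT, map_sum, tmap_tmul, hF.lift_mkL, hF.lift_mkR] at h
  exact h

theorem ev_antipode_left (a : A) :
    H.left.ev (fun x y => H.S x * y) a = H.right.s (H.right.π a) := by
  have h := H.antipode_left a _ (Bal.mk_repT _)
  simp only [Bal.repT, map_sum] at h
  exact h

theorem ev_antipode_right (a : A) :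
    H.right.ev (fun x y => x * H.S y) a = H.left.s (H.left.π a) := by
  have h := H.antipode_right a _ (Bal.mk_repT _)
  simp only [Bal.repT, map_sum] at h
  exact h

end HopfAlgebroid

end Bialgebroids

/-! ### The antipode reverses products and coproducts -/

section Antipode

variable {A L R T : Type*} [Ring A] [Ring L] [Ring R] [AddCommGroup T]

namespace HopfAlgebroid

variable (H : HopfAlgebroid A L R)

theorem exists_sL_eq_tR (l : L) : ∃ r : R, H.left.s l = H.right.t (op r) := by
  have h : H.left.s l ∈ H.right.t.range := H.range_sL ▸ ⟨l, rfl⟩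
  obtain ⟨r, hr⟩ := h
  exact ⟨r.unop, hr.symm⟩

theorem exists_tR_eq_sL (r : R) : ∃ l : L, H.right.t (op r) = H.left.s l := by
  have h : H.right.t (op r) ∈ H.left.s.range := H.range_sL ▸ ⟨op r, rfl⟩
  obtain ⟨l, hl⟩ := h
  exact ⟨l, hl.symm⟩

theorem exists_tL_eq_sR (l : L) : ∃ r : R, H.left.t (op l) = H.right.s r := by
  have h : H.left.t (op l) ∈ H.right.s.range := H.range_tL ▸ ⟨op l, rfl⟩
  obtain ⟨r, hr⟩ := h
  exact ⟨r, hr.symm⟩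

theorem exists_sR_eq_tL (r : R) : ∃ l : L, H.right.s r = H.left.t (op l) := by
  have h : H.right.s r ∈ H.left.t.range := H.range_tL ▸ ⟨r, rfl⟩
  obtain ⟨l, hl⟩ := h
  exact ⟨l.unop, hl.symm⟩

theorem S_tL_mul (l : L) (a : A) : H.S (H.left.t (op l) * a) = H.S a * H.left.s l := by
  simpa using H.S_left l 1 a

theorem S_mul_tL (l : L) (a : A) : H.S (a * H.left.t (op l)) = H.left.s l * H.S a := by
  simpa using H.S_left 1 l a

theorem S_tR_mul (r : R) (a : A) : H.S (H.right.t (op r) * a) = H.S a * H.right.s r := by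
  simpa using H.S_right 1 r a

theorem S_mul_tR (r : R) (a : A) : H.S (a * H.right.t (op r)) = H.right.s r * H.S a := by
  simpa using H.S_right r 1 a

theorem isBal_S_mul : H.left.IsBal fun x y => H.S x * y :=
  ⟨fun m m' n => by rw [map_add, add_mul], fun m n n' => mul_add _ _ _, fun m l n => by
    rw [S_tL_mul, mul_assoc]⟩

theorem S_one : H.S 1 = 1 := by
  have h := H.ev_antipode_left 1
  rw [LeftBialgebroid.ev_one H.isBal_S_mul, mul_one, H.right.π_one] at h
  exact h.trans (map_one _)

theorem S_tL (l : L) : H.S (H.left.t (op l)) = H.left.s l := by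
  simpa [H.S_one] using H.S_tL_mul l 1

theorem S_tR (r : R) : H.S (H.right.t (op r)) = H.right.s r := by
  simpa [H.S_one] using H.S_tR_mul r 1

variable {H}

/-- `g⁽¹⁾₍₁₎ ⊗ g⁽¹⁾₍₂₎ S(g⁽²⁾) = g ⊗ 1`. -/
theorem ev_ev_mul_S {f : A → A → T} (hf : H.left.IsBal f) (g : A) :
    H.right.ev (fun x y => H.left.ev (fun a b => f a (b * H.S y)) x) g = f g 1 := by
  have hF : H.IsBalLR fun a b y => f a (b * H.S y) :=
    ⟨fun _ _ _ _ => hf.add_left _ _ _, fun _ _ _ _ => by rw [add_mul, hf.add_right],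
      fun _ _ _ _ => by rw [map_add, mul_add, hf.add_right], fun _ _ _ _ => by
        rw [hf.bal, mul_assoc], fun _ _ _ _ => by rw [S_mul_tR, mul_assoc]⟩
  -- After mixed coassociativity the inner sum is g₍₂₎⁽¹⁾S(g₍₂₎⁽²⁾) = s_Lπ_L(g₍₂₎); it crosses the
  -- tensor sign as t_Lπ_L(g₍₂₎) and is absorbed by the counit axiom.
  have h1 : ∀ a z, H.right.ev (fun b y => f a (b * H.S y)) z = f (H.left.t (op (H.left.π z)) * a) 1 :=
    fun a z => by
      rw [← RightBialgebroid.ev_isBal_right hf, ev_antipode_right, hf.bal, mul_one]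
  rw [ev_coassocLR hF]
  simp only [h1]
  rw [← LeftBialgebroid.ev_isBal_left hf, LeftBialgebroid.ev_counit_right]

/-- `S(h₍₁₎) h₍₂₎⁽¹⁾ ⊗ h₍₂₎⁽²⁾ = 1 ⊗ h`. -/
theorem ev_ev_S_mul {f : A → A → T} (hf : H.right.IsBal f) (h : A) :
    H.left.ev (fun x y => H.right.ev (fun a b => f (H.S x * a) b) y) h = f 1 h := by
  have hF : H.IsBalLR fun x a b => f (H.S x * a) b :=
    ⟨fun _ _ _ _ => by rw [map_add, add_mul, hf.add_left], fun _ _ _ _ => by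
      rw [mul_add, hf.add_left], fun _ _ _ _ => hf.add_right _ _ _, fun _ _ _ _ => by
        rw [S_tL_mul, mul_assoc], fun _ _ _ _ => by rw [← mul_assoc, hf.bal]⟩
  have h1 : ∀ z b, H.left.ev (fun x a => f (H.S x * a) b) z = f 1 (b * H.right.t (op (H.right.π z))) :=
    fun z b => by
      rw [← LeftBialgebroid.ev_isBal_left hf, ev_antipode_left, ← hf.bal, one_mul]
  rw [← ev_coassocLR hF]
  simp only [h1]
  rw [← RightBialgebroid.ev_isBal_right hf, RightBialgebroid.ev_counit_left]

theorem isBal_sR_π_mul_S : H.right.IsBal fun x g => H.right.s (H.right.π x) * H.S g :=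
  ⟨fun _ _ _ => by rw [map_add, map_add, add_mul], fun _ _ _ => by rw [map_add, mul_add],
    fun _ _ _ => by rw [H.right.π_right, map_mul, S_mul_tR, mul_assoc]⟩

/-- Since s_R(r)S(g) = S(g t_R(r)), this is S applied to the counit axiom. It introduces a factor
s_Rπ_R, which the antipode axiom can then expand. -/
theorem ev_sR_π_mul_S (k : A) :
    H.right.ev (fun x g => H.right.s (H.right.π x) * H.S g) k = H.S k := by
  conv_rhs => rw [← RightBialgebroid.ev_counit_left (B := H.right) k, RightBialgebroid.map_ev]
  simp only [S_mul_tR]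

theorem ev_S_mul_sL_π (k : A) :
    H.left.ev (fun x y => H.S x * H.left.s (H.left.π y)) k = H.S k := by
  conv_rhs => rw [← LeftBialgebroid.ev_counit_right (B := H.left) k, LeftBialgebroid.map_ev]
  simp only [S_tL_mul]

theorem isBal_S_mul_mul (k : A) : H.left.IsBal fun a b => H.S (a * k) * b :=
  LeftBialgebroid.isBal_mul_left H.isBal_S_mul k

/-- Write k = t_Lπ_L(k₍₂₎)k₍₁₎. By the Takeuchi condition t_Lπ_L(k₍₂₎) passes to the right of h₍₂₎
as s_Lπ_L(k₍₂₎) = k₍₂₎⁽¹⁾S(k₍₂₎⁽²⁾). Mixed coassociativity then produces the antipode axiom for the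
product hk⁽¹⁾, and what remains is s_Rπ_R(hk⁽¹⁾)S(k⁽²⁾), in which h may be replaced by t_Rπ_R(h). It
is the main step towards anti-multiplicativity. -/
theorem ev_S_mul_mul (h k : A) :
    H.left.ev (fun a b => H.S (a * k) * b) h = H.S k * H.right.s (H.right.π h) := by
  have e1 : ∀ a b : A, H.S (a * k) * b = H.left.ev
      (fun c d => H.S (a * H.left.t (op (H.left.π d)) * c) * b) k := fun a b => by
    conv_lhs => rw [← LeftBialgebroid.ev_counit_right (B := H.left) k]
    rw [LeftBialgebroid.mul_ev, LeftBialgebroid.map_ev, LeftBialgebroid.ev_mul_const]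
    simp only [mul_assoc]
  have hF : H.IsBalLR fun c e g => H.left.ev (fun a b => H.S (a * c) * (b * (e * H.S g))) h := by
    refine ⟨fun c c' e g => ?_, fun c e e' g => ?_, fun c e g g' => ?_, fun c l e g => ?_,
      fun c e r g => ?_⟩
    · rw [← LeftBialgebroid.ev_add_fun]; simp only [mul_add, map_add, add_mul]
    · rw [← LeftBialgebroid.ev_add_fun]; simp only [mul_add, add_mul]
    · rw [← LeftBialgebroid.ev_add_fun]; simp only [mul_add, map_add]
    · have := LeftBialgebroid.ev_takeuchi
        (LeftBialgebroid.isBal_mul_right (isBal_S_mul_mul (H := H) c) (e * H.S g)) l h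
      simp only [mul_assoc] at this ⊢
      exact this
    · simp only [S_mul_tR, mul_assoc]
  have e2 : ∀ x g, H.left.ev (fun c e => H.left.ev (fun a b => H.S (a * c) * (b * (e * H.S g))) h) x =
      H.right.s (H.right.π (H.right.t (op (H.right.π h)) * x)) * H.S g := fun x g => by
    rw [H.right.π_t_mul, ← ev_antipode_left, LeftBialgebroid.ev_mul H.isBal_S_mul,
      LeftBialgebroid.ev_mul_const]
    simp only [LeftBialgebroid.ev_mul_const, mul_assoc]
    exact Bal.sw_comm _ _ _
  simp only [e1]
  calc _ = H.left.ev (fun c d => H.left.ev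
        (fun a b => H.S (a * H.left.t (op (H.left.π d)) * c) * b) h) k := Bal.sw_comm _ _ _
    _ = H.left.ev (fun c d => H.right.ev (fun e g =>
        H.left.ev (fun a b => H.S (a * c) * (b * (e * H.S g))) h) d) k := by
      congr 1; funext c d
      rw [LeftBialgebroid.ev_takeuchi (isBal_S_mul_mul (H := H) c)]
      simp only [← ev_antipode_right, RightBialgebroid.mul_ev]
      exact Bal.sw_comm _ _ _
    _ = _ := by
      rw [← ev_coassocLR hF]
      simp only [e2]
      rw [← RightBialgebroid.ev_t_mul isBal_sR_π_mul_S, ev_sR_π_mul_S, S_tR_mul]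

/-- The antipode is anti-multiplicative. -/
theorem S_mul (h k : A) : H.S (h * k) = H.S k * H.S h := by
  have hF : H.IsBalLR fun a b y => H.S (a * k) * (b * H.S y) :=
    ⟨fun _ _ _ _ => by rw [add_mul, map_add, add_mul], fun _ _ _ _ => by rw [add_mul, mul_add],
      fun _ _ _ _ => by rw [map_add, mul_add, mul_add], fun _ _ _ _ => by
        rw [mul_assoc, S_tL_mul]; simp only [mul_assoc],
      fun _ _ _ _ => by rw [S_mul_tR]; simp only [mul_assoc]⟩
  -- This computes S(h⁽¹⁾₍₁₎k)h⁽¹⁾₍₂₎S(h⁽²⁾) in two ways. One bracketing collapses to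
  -- S(t_Lπ_L(h₍₂₎)h₍₁₎k) = S(hk), the other by `ev_S_mul_mul` to S(k)s_Rπ_R(h⁽¹⁾)S(h⁽²⁾) =
  -- S(k)S(h).
  have e := ev_coassocLR hF h
  have e1 : ∀ a z, H.right.ev (fun b y => H.S (a * k) * (b * H.S y)) z =
      H.S (H.left.t (op (H.left.π z)) * a * k) := fun a z => by
    rw [← RightBialgebroid.mul_ev, ev_antipode_right, mul_assoc, S_tL_mul]
  have e2 : ∀ x y, H.left.ev (fun a b => H.S (a * k) * (b * H.S y)) x =
      H.S k * (H.right.s (H.right.π x) * H.S y) := fun x y => by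
    simp only [← mul_assoc]
    rw [← LeftBialgebroid.ev_mul_const, ev_S_mul_mul]
  simp only [e1, e2] at e
  rw [← RightBialgebroid.mul_ev, ev_sR_π_mul_S] at e
  rw [e]
  conv_lhs => rw [← LeftBialgebroid.ev_counit_right (B := H.left) h]
  rw [LeftBialgebroid.ev_mul_const, LeftBialgebroid.map_ev]

/-- An identity for the coproduct of the antipode. -/
theorem isBal_S_S {f : A → A → T} (hf : H.right.IsBal f) :
    H.left.IsBal fun a b => f (H.S b) (H.S a) :=
  ⟨fun _ _ _ => by rw [map_add, hf.add_right], fun _ _ _ => by rw [map_add, hf.add_left],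
    fun a l b => by
      obtain ⟨r, hr⟩ := H.exists_sL_eq_tR l
      rw [S_tL_mul, hr, S_tR_mul, hf.bal]⟩

theorem isBal_ev_S_mul {f : A → A → T} (hf : H.right.IsBal f) (z : A) :
    H.left.IsBal fun a b => H.right.ev (fun c d => f (H.S b * c) (H.S a * d)) z :=
  ⟨fun _ _ _ => by
      rw [← RightBialgebroid.ev_add_fun]; simp only [map_add, add_mul, hf.add_right],
    fun _ _ _ => by
      rw [← RightBialgebroid.ev_add_fun]; simp only [map_add, add_mul, hf.add_left],
    fun a l b => by
      obtain ⟨r, hr⟩ := H.exists_sL_eq_tR l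
      simp only [S_tL_mul, hr, S_tR_mul, mul_assoc]
      exact (RightBialgebroid.ev_takeuchi
        (RightBialgebroid.isBal_mul_mul hf (H.S b) (H.S a)) r z).symm⟩

/-- In effect S(h₍₂₎) ⊗ S(h₍₁₎) is a left convolution inverse of γ_R. By coassociativity the inner
pair S(h₍₂₎)h₍₃₎⁽¹⁾ ⊗ h₍₃₎⁽²⁾ collapses first, to 1 ⊗ h₍₂₎, and S(h₍₁₎)h₍₂₎ is left over. -/
theorem ev_S_S_mul {f : A → A → T} (hf : H.right.IsBal f) (h : A) :
    H.left.ev (fun x y => H.left.ev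
      (fun a b => H.right.ev (fun c d => f (H.S b * c) (H.S a * d)) y) x) h =
      f 1 (H.right.s (H.right.π h)) := by
  have hF : H.left.IsBal3 fun a b y => H.right.ev (fun c d => f (H.S b * c) (H.S a * d)) y := by
    refine ⟨fun _ _ b y => (isBal_ev_S_mul hf y).add_left _ _ _,
      fun _ _ b y => (isBal_ev_S_mul hf y).add_right _ _ _,
      fun a b y y' => RightBialgebroid.ev_add
        (RightBialgebroid.isBal_mul_mul hf (H.S b) (H.S a)) _ _,
      fun a l b y => (isBal_ev_S_mul hf y).bal _ _ _, fun a b l y => ?_⟩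
    obtain ⟨r, hr⟩ := H.exists_sL_eq_tR l
    simp only [S_tL_mul, hr]
    rw [RightBialgebroid.ev_t_mul (RightBialgebroid.isBal_mul_mul hf (H.S b) (H.S a))]
    simp only [mul_assoc]
  rw [LeftBialgebroid.ev_coassoc hF]
  have e1 : ∀ x y, H.left.ev (fun b y => H.right.ev (fun c d => f (H.S b * c) (H.S x * d)) y) y =
      f 1 (H.S x * y) := fun x y =>
    ev_ev_S_mul (RightBialgebroid.isBal_mul_right hf (H.S x)) y
  simp only [e1]
  rw [← LeftBialgebroid.ev_isBal_right hf, ev_antipode_left]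

/-- The antipode is anti-comultiplicative. -/
theorem ev_S {f : A → A → T} (hf : H.right.IsBal f) (h : A) :
    H.right.ev f (H.S h) = H.left.ev (fun a b => f (H.S b) (H.S a)) h := by
  have hf' : ∀ y, H.right.IsBal fun c d => H.right.ev (fun p q => f (c * p) (d * q)) y := fun y =>
    ⟨fun _ _ _ => by
        rw [← RightBialgebroid.ev_add_fun]; simp only [add_mul, hf.add_left],
      fun _ _ _ => by rw [← RightBialgebroid.ev_add_fun]; simp only [add_mul, hf.add_right],
      fun c r d => by
        simp only [mul_assoc]
        exact RightBialgebroid.ev_takeuchi (RightBialgebroid.isBal_mul_mul hf c d) r y⟩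
  have hG := fun z => isBal_ev_S_mul hf z
  have hF : H.IsBalLR fun x₁ x₂ y => H.left.ev (fun a b => H.right.ev
      (fun c d => f (H.S b * c) (H.S a * d)) (x₂ * H.S y)) x₁ := by
    have hs : ∀ a b, H.right.IsBal fun c d => f (H.S b * c) (H.S a * d) :=
      fun a b => RightBialgebroid.isBal_mul_mul hf (H.S b) (H.S a)
    refine ⟨fun _ _ _ _ => LeftBialgebroid.ev_add (hG _) _ _, fun x₁ x₂ x₂' y => ?_,
      fun x₁ x₂ y y' => ?_, fun x₁ l x₂ y => ?_, fun x₁ x₂ r y => ?_⟩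
    · rw [← LeftBialgebroid.ev_add_fun]
      simp only [add_mul, RightBialgebroid.ev_add (hs _ _)]
    · rw [← LeftBialgebroid.ev_add_fun]
      simp only [map_add, mul_add, RightBialgebroid.ev_add (hs _ _)]
    · obtain ⟨r, hr⟩ := H.exists_sL_eq_tR l
      rw [LeftBialgebroid.ev_t_mul (hG _)]
      simp only [S_tL_mul, hr, mul_assoc, RightBialgebroid.ev_t_mul (hs _ _)]
    · simp only [S_mul_tR, mul_assoc]
  -- The classical argument with convolution inverses: γ_R(S(h)) is multiplied from the left by 1 ⊗
  -- s_Rπ_R, this factor is expanded by `ev_S_S_mul`, and γ_R then cancels against γ_R ∘ S.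
  calc H.right.ev f (H.S h) = H.right.ev (fun x y => H.right.ev f
        (H.right.s (H.right.π x) * H.S y)) h := by
        conv_lhs => rw [← ev_sR_π_mul_S h]
        exact RightBialgebroid.ev_sw hf _ _
    _ = H.right.ev (fun x y => H.left.ev (fun x₁ x₂ => H.left.ev (fun a b => H.right.ev
      (fun c d => f (H.S b * c) (H.S a * d)) (x₂ * H.S y)) x₁) x) h := by
        congr 1; funext x y
        have := ev_S_S_mul (hf' (H.S y)) x
        rw [RightBialgebroid.ev_s_mul hf]
        simp only [one_mul] at this
        rw [← this]
        congr 1; funext x₁ x₂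
        congr 1; funext a b
        rw [RightBialgebroid.ev_mul (RightBialgebroid.isBal_mul_mul hf (H.S b) (H.S a))]
        simp only [mul_assoc]
    _ = _ := by
        rw [ev_coassocLR hF]
        -- The sum over `b` and `y` produces s_Lπ_L(x₂), which lies in t_R(R), so its coproduct sits
        -- in the first leg only. There it turns S(b) into S(t_Lπ_L(x₂)b), ready for the counit
        -- axiom.
        have e1 : ∀ x₁ x₂, H.right.ev (fun b y => H.left.ev (fun a b' => H.right.ev
            (fun c d => f (H.S b' * c) (H.S a * d)) (b * H.S y)) x₁) x₂ =
            H.left.ev (fun a b => f (H.S b) (H.S a))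
              (H.left.t (op (H.left.π x₂)) * x₁) := fun x₁ x₂ => by
          obtain ⟨r, hr⟩ := H.exists_sL_eq_tR (H.left.π x₂)
          rw [LeftBialgebroid.ev_t_mul (isBal_S_S hf)]
          refine (Bal.sw_comm _ _ _).trans ?_
          change H.left.ev _ x₁ = _
          congr 1; funext a b
          have hs := RightBialgebroid.isBal_mul_mul hf (H.S b) (H.S a)
          change H.right.ev (fun m n => H.right.ev
            (fun c d => f (H.S b * c) (H.S a * d)) (m * H.S n)) x₂ = _
          refine (RightBialgebroid.ev_sw hs _ _).symm.trans ?_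
          change H.right.ev _ (H.right.ev (fun m n => m * H.S n) x₂) = _
          rw [ev_antipode_right, S_tL_mul, hr, RightBialgebroid.ev_t hs, mul_one]
        simp only [e1]
        conv_rhs => rw [← LeftBialgebroid.ev_counit_right (B := H.left) h]
        exact (LeftBialgebroid.ev_sw (isBal_S_S hf) _ _).symm

end HopfAlgebroid

end Antipode

/-! ### Integrals, Frobenius forms and non-degeneracy -/

section Integrals

variable {A L R T : Type*} [Ring A] [Ring L] [Ring R] [AddCommGroup T]

namespace LeftBialgebroid

variable {B : LeftBialgebroid A L}

theorem t_op_add (l l' : L) : B.t (op (l + l')) = B.t (op l) + B.t (op l') := map_add (addOp B.t) l l'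

theorem t_op_mul (l l' : L) : B.t (op (l * l')) = B.t (op l') * B.t (op l) :=
  map_mul B.t (op l') (op l)

theorem actLDual_eq (φ : B.LDual) (a : A) :
    B.actLDual φ a = B.ev (fun x y => B.t (op (φ.1 y)) * x) a :=
  Bal.lift_eq_sw (fun a l b => by simp [φ.2, mul_assoc]) _

theorem actRDual_eq (φ : B.RDual) (a : A) :
    B.actRDual φ a = B.ev (fun x y => B.s (φ.1 x) * y) a :=
  Bal.lift_eq_sw (fun a l b => by simp [φ.2, mul_assoc]) _

theorem isBal_t_mul_of_LDual (φ : B.LDual) : B.IsBal fun x y => B.t (op (φ.1 y)) * x :=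
  ⟨fun _ _ _ => mul_add _ _ _, fun _ _ _ => by rw [map_add, t_op_add, add_mul],
    fun _ _ _ => by rw [φ.2, t_op_mul, mul_assoc]⟩

/-- By coassociativity the total ring is a right module over `_*A`; this is why the product of the
dual ring has the form it has. -/
theorem actLDual_actLDual (φ ψ : B.LDual) (a : A) :
    B.actLDual ψ (B.actLDual φ a) = B.actLDual (φ.mul ψ) a := by
  have hψ := isBal_t_mul_of_LDual ψ
  have hF : B.IsBal3 fun x y z => B.t (op (ψ.1 (B.t (op (φ.1 z)) * y))) * x := by
    refine ⟨fun _ _ _ _ => mul_add _ _ _, fun _ _ _ _ => ?_, fun _ _ _ _ => ?_,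
      fun _ _ _ _ => ?_, fun _ _ _ _ => ?_⟩
    · rw [mul_add, map_add, t_op_add, add_mul]
    · rw [map_add, t_op_add, add_mul, map_add, t_op_add, add_mul]
    · rw [← mul_assoc (B.t _) (B.s _), ← B.s_comm_t, mul_assoc (B.s _), ψ.2, t_op_mul,
        mul_assoc]
    · rw [φ.2, t_op_mul, mul_assoc]
  rw [actLDual_eq φ a, actLDual_eq ψ, actLDual_eq (φ.mul ψ)]
  refine (ev_sw hψ _ _).trans ?_
  simp only [ev_t_mul hψ]
  refine (ev_coassoc hF a).trans ?_
  congr 1; funext x y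
  change _ = B.t (op (ψ.1 (B.actLDual φ y))) * x
  rw [actLDual_eq, map_ev, ← addOp_apply, map_ev, ev_mul_const]
  rfl

end LeftBialgebroid

namespace RightBialgebroid

variable {B : RightBialgebroid A R}

theorem actRDual_eq (φ : B.RDual) (a : A) :
    B.actRDual φ a = B.ev (fun x y => y * B.t (op (φ.1 x))) a :=
  Bal.lift_eq_sw (fun a l b => by simp [φ.2, mul_assoc]) _

theorem actLDual_eq (φ : B.LDual) (a : A) :
    B.actLDual φ a = B.ev (fun x y => x * B.s (φ.1 y)) a :=
  Bal.lift_eq_sw (fun a l b => by simp [φ.2, mul_assoc]) _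

end RightBialgebroid

namespace HopfAlgebroid

variable {H : HopfAlgebroid A L R}

/-- Write S(h) = S(h₍₁₎)s_Lπ_L(h₍₂₎). Under π_L the last factor may be replaced by h₍₂₎, and the
antipode axiom applies. -/
theorem πL_S (h : A) : H.left.π (H.S h) = H.left.π (H.right.s (H.right.π h)) := by
  rw [← ev_antipode_left, LeftBialgebroid.map_ev]
  conv_lhs => rw [← ev_S_mul_sL_π h, LeftBialgebroid.map_ev]
  simp only [H.left.π_mul_s]

theorem πR_S (h : A) : H.right.π (H.S h) = H.right.π (H.left.s (H.left.π h)) := by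
  rw [← ev_antipode_right, RightBialgebroid.map_ev]
  conv_lhs => rw [← ev_sR_π_mul_S h, RightBialgebroid.map_ev]
  simp only [H.right.π_s_mul]

theorem tL_πL_sR (r : R) : H.left.t (op (H.left.π (H.right.s r))) = H.right.s r := by
  obtain ⟨l, hl⟩ := H.exists_sR_eq_tL r
  rw [hl, H.left.π_t]

theorem tR_πR_sL (l : L) : H.right.t (op (H.right.π (H.left.s l))) = H.left.s l := by
  obtain ⟨r, hr⟩ := H.exists_sL_eq_tR l
  rw [hr, H.right.π_t]

theorem S_sR (r : R) : H.S (H.right.s r) = H.left.s (H.left.π (H.right.s r)) := by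
  rw [← S_tL, tL_πL_sR]

theorem S_sL (l : L) : H.S (H.left.s l) = H.right.s (H.right.π (H.left.s l)) := by
  rw [← S_tR, tR_πR_sL]

/-- The antipode reverses products and, up to the identification of the base rings, interchanges π_L
and π_R; hence it interchanges the two kinds of integrals. The `of_S` versions follow from its
injectivity. -/
theorem IsRightIntegral.S {i : A} (hi : H.IsRightIntegral i) : H.IsLeftIntegral (H.S i) := by
  intro a
  obtain ⟨b, rfl⟩ := H.S.surjective a
  rw [← S_mul, hi b, S_mul, S_sR, πL_S]

theorem IsLeftIntegral.S {i : A} (hi : H.IsLeftIntegral i) : H.IsRightIntegral (H.S i) := by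
  intro a
  obtain ⟨b, rfl⟩ := H.S.surjective a
  rw [← S_mul, hi b, S_mul, S_sL, πR_S]

theorem IsRightIntegral.of_S {i : A} (hi : H.IsLeftIntegral (H.S i)) : H.IsRightIntegral i := by
  intro a
  apply H.S.injective
  rw [S_mul, hi, S_mul, S_sR, πL_S]

theorem IsLeftIntegral.of_S {i : A} (hi : H.IsRightIntegral (H.S i)) : H.IsLeftIntegral i := by
  intro a
  apply H.S.injective
  rw [S_mul, hi, S_mul, S_sL, πR_S]

theorem isBal_ev_mul_mul {f : A → A → T} (hf : H.left.IsBal f) (c : A) :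
    H.left.IsBal fun a b => H.left.ev (fun x y => f (x * a) (y * b)) c :=
  ⟨fun _ _ _ => by rw [← LeftBialgebroid.ev_add_fun]; simp only [mul_add, hf.add_left],
    fun _ _ _ => by rw [← LeftBialgebroid.ev_add_fun]; simp only [mul_add, hf.add_right],
    fun a l b => by
      have := LeftBialgebroid.ev_takeuchi (LeftBialgebroid.isBal_mul_mul hf a b) l c
      simpa only [mul_assoc] using this⟩

theorem isBal_ev_mul_mul_right {f : A → A → T} (hf : H.right.IsBal f) (c : A) :
    H.right.IsBal fun a b => H.right.ev (fun x y => f (a * x) (b * y)) c :=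
  ⟨fun _ _ _ => by rw [← RightBialgebroid.ev_add_fun]; simp only [add_mul, hf.add_left],
    fun _ _ _ => by rw [← RightBialgebroid.ev_add_fun]; simp only [add_mul, hf.add_right],
    fun a r b => by
      have := RightBialgebroid.ev_takeuchi (RightBialgebroid.isBal_mul_mul hf a b) r c
      simpa only [mul_assoc] using this⟩

/-- `i₍₁₎ h ⊗ i₍₂₎ = i₍₁₎ ⊗ i₍₂₎ S(h)` for a right integral `i`. -/
theorem IsRightIntegral.ev_mul_left {i : A} (hi : H.IsRightIntegral i) {f : A → A → T}
    (hf : H.left.IsBal f) (h : A) :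
    H.left.ev (fun a b => f (a * h) b) i = H.left.ev (fun a b => f a (b * H.S h)) i := by
  have e := ev_ev_mul_S (isBal_ev_mul_mul hf i) h
  simp only [mul_one] at e
  rw [← e]
  -- Behind i₍₁₎ ⊗ i₍₂₎ the element h ⊗ 1 has been replaced by h⁽¹⁾₍₁₎ ⊗ h⁽¹⁾₍₂₎S(h⁽²⁾). The factors
  -- coming from h⁽¹⁾ combine to the coproduct of ih⁽¹⁾ = i s_Rπ_R(h⁽¹⁾); as s_R(R) = t_L(L), the
  -- new factor appears in the second leg only.
  have e1 : ∀ x y, H.left.ev (fun a b => H.left.ev (fun c d => f (c * a) (d * (b * H.S y))) i) x =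
      H.left.ev (fun a b => f a (b * (H.right.s (H.right.π x) * H.S y))) i := fun x y => by
    have hf' := LeftBialgebroid.isBal_mul_right hf (H.S y)
    have h1 := LeftBialgebroid.ev_mul hf' i x
    obtain ⟨l, hl⟩ := H.exists_sR_eq_tL (H.right.π x)
    rw [hi x, hl, LeftBialgebroid.ev_mul_t hf', ← hl] at h1
    simp only [mul_assoc] at h1
    rw [h1]
    exact Bal.sw_comm _ _ _
  simp only [e1]
  refine (Bal.sw_comm _ _ _).trans ?_
  change H.left.ev (fun a b => H.right.ev
    (fun x y => f a (b * (H.right.s (H.right.π x) * H.S y))) h) i = _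
  congr 1; funext a b
  rw [← RightBialgebroid.ev_isBal_right hf, ← RightBialgebroid.mul_ev, ev_sR_π_mul_S]

/-- `S(h) i⁽¹⁾ ⊗ i⁽²⁾ = i⁽¹⁾ ⊗ h i⁽²⁾` for a left integral `i`. -/
theorem IsLeftIntegral.ev_S_mul_left {i : A} (hi : H.IsLeftIntegral i) {f : A → A → T}
    (hf : H.right.IsBal f) (h : A) :
    H.right.ev (fun a b => f (H.S h * a) b) i = H.right.ev (fun a b => f a (h * b)) i := by
  have e := ev_ev_S_mul (isBal_ev_mul_mul_right hf i) h
  simp only [one_mul] at e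
  rw [← e]
  -- The mirror image: the factors coming from h₍₂₎ combine to γ_R(h₍₂₎i), and h₍₂₎i =
  -- s_Lπ_L(h₍₂₎)i, where s_L(L) = t_R(R) affects the first leg only.
  have e1 : ∀ x y, H.right.ev (fun a b => H.right.ev (fun c d => f (H.S x * a * c) (b * d)) i) y =
      H.right.ev (fun a b => f (H.S x * H.left.s (H.left.π y) * a) b) i := fun x y => by
    have hf' := RightBialgebroid.isBal_mul_left hf (H.S x)
    have h1 := RightBialgebroid.ev_mul hf' y i
    obtain ⟨r, hr⟩ := H.exists_sL_eq_tR (H.left.π y)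
    rw [hi y, hr, RightBialgebroid.ev_t_mul hf', ← hr] at h1
    simp only [mul_assoc] at h1 ⊢
    rw [h1]
  simp only [e1]
  refine Eq.trans ?_ (Bal.sw_comm _ _ _)
  change _ = H.right.ev (fun a b => H.left.ev
    (fun x y => f (H.S x * H.left.s (H.left.π y) * a) b) h) i
  congr 1; funext a b
  rw [← LeftBialgebroid.ev_isBal_left hf, ← LeftBialgebroid.ev_mul_const, ev_S_mul_sL_π]

/-- A functional `p` on the total ring for which `p(· S(i₍₁₎)), i₍₂₎` and `p(i₍₂₎ S(·)), i₍₁₎` are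
dual bases. -/
structure IsFrobeniusForm (H : HopfAlgebroid A L R) (i : A) (p : A →+ L) : Prop where
  s_mul : ∀ l a, p (H.left.s l * a) = l * p a
  mul_s : ∀ l a, p (a * H.left.s l) = p a * l
  dual_left : ∀ k, H.left.ev (fun a b => H.left.t (op (p (b * H.S k))) * a) i = k
  dual_right : ∀ k, H.left.ev (fun a b => H.left.s (p (k * H.S a)) * b) i = k

section FrobeniusForm

variable {i : A} {p : A →+ L}

/-- The functional `p(· S(k))`. -/
def dualOf (hp : ∀ l a, p (H.left.s l * a) = l * p a) (k : A) : H.left.LDual :=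
  ⟨p.comp (AddMonoidHom.mulRight (H.S k)), fun l a => by
    change p (H.left.s l * a * H.S k) = l * p (a * H.S k)
    rw [mul_assoc, hp]⟩

theorem dualOf_apply (hp : ∀ l a, p (H.left.s l * a) = l * p a) (k a : A) :
    (dualOf (H := H) hp k).1 a = p (a * H.S k) := rfl

namespace IsFrobeniusForm

/-- Expand `x` by `dual_right` and pull the coefficients out of φ; the scalars φ(i₍₂₎) are collected
inside `p` as S(i ↽ φ). Thus φ can be recovered from i ↽ φ. -/
theorem apply_LDual (h : H.IsFrobeniusForm i p) (φ : H.left.LDual) (x : A) :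
    φ.1 x = p (x * H.S (H.left.actLDual φ i)) := by
  conv_lhs => rw [← h.dual_right x, LeftBialgebroid.map_ev]
  rw [LeftBialgebroid.actLDual_eq, LeftBialgebroid.map_ev, LeftBialgebroid.mul_ev,
    LeftBialgebroid.map_ev]
  simp only [φ.2, S_tL_mul, ← mul_assoc, h.mul_s]

theorem apply_RDual (h : H.IsFrobeniusForm i p) (φ : H.left.RDual) (x : A) :
    φ.1 x = p (H.left.actRDual φ i * H.S x) := by
  conv_lhs => rw [← h.dual_left x, LeftBialgebroid.map_ev]
  rw [LeftBialgebroid.actRDual_eq, LeftBialgebroid.ev_mul_const, LeftBialgebroid.map_ev]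
  simp only [φ.2, mul_assoc, h.s_mul]

/-- The inverse maps are explicit: k ↦ p(· S(k)) for the action of `_*A` and k ↦ p(k S(·)) for that
of `A_*`. That they are inverse is `apply_LDual` and `apply_RDual` on one side and the dual basis
identities on the other. -/
theorem isRightNondegenerate (h : H.IsFrobeniusForm i p) : H.IsRightNondegenerate i := by
  refine ⟨⟨fun φ ψ e => ?_, fun k => ⟨dualOf h.s_mul k, ?_⟩⟩,
    ⟨fun φ ψ e => ?_, fun k => ⟨⟨p.comp ((AddMonoidHom.mulLeft k).comp H.S.toAddMonoidHom), ?_⟩, ?_⟩⟩⟩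
  · refine Subtype.ext (AddMonoidHom.ext fun x => ?_)
    rw [h.apply_LDual, h.apply_LDual]
    exact congrArg (fun z => p (x * H.S z)) e
  · exact (LeftBialgebroid.actLDual_eq _ _).trans (h.dual_left k)
  · refine Subtype.ext (AddMonoidHom.ext fun x => ?_)
    rw [h.apply_RDual, h.apply_RDual]
    exact congrArg (fun z => p (z * H.S x)) e
  · intro l a
    change p (k * H.S (H.left.t (op l) * a)) = p (k * H.S a) * l
    rw [S_tL_mul, ← mul_assoc, h.mul_s]
  · exact (LeftBialgebroid.actRDual_eq _ _).trans (h.dual_right k)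

theorem separates (h : H.IsFrobeniusForm i p) {k k' : A} (e : ∀ c, p (k * H.S c) = p (k' * H.S c)) : k = k' := by
  rw [← h.dual_right k, ← h.dual_right k']
  simp only [e]

end IsFrobeniusForm

end FrobeniusForm

/-- The form `p` is the preimage of 1 under φ ↦ i ↽ φ. The transfer rule for `i` turns the single
equation i ↽ p = 1 into `dual_left`. The preimage `q` of 1 under the other action satisfies a
similar identity, which becomes `dual_right` once q = p ∘ S is known. -/
theorem IsRightIntegral.exists_isFrobeniusForm {i : A} (hi : H.IsRightIntegral i)
    (hn : H.IsRightNondegenerate i) : ∃ p, H.IsFrobeniusForm i p := by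
  obtain ⟨φ, hφ⟩ := hn.1.2 1
  have hp := φ.2
  obtain ⟨p, hp'⟩ := φ
  simp only at hp
  have hφ' : H.left.ev (fun a b => H.left.t (op (p b)) * a) i = 1 :=
    (LeftBialgebroid.actLDual_eq _ _).symm.trans hφ
  have d1 : ∀ k, H.left.ev (fun a b => H.left.t (op (p (b * H.S k))) * a) i = k := fun k => by
    have e := hi.ev_mul_left (LeftBialgebroid.isBal_t_mul_of_LDual (B := H.left) ⟨p, hp⟩) k
    refine e.symm.trans ?_
    simp only [← mul_assoc]
    rw [← LeftBialgebroid.ev_mul_const, hφ', one_mul]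
  -- The functionals p(· s_L(l)) and p(·)l have the same image t_L(l) under φ ↦ i ↽ φ, the first by
  -- the Takeuchi condition; injectivity makes them equal.
  have ms : ∀ l a, p (a * H.left.s l) = p a * l := fun l => by
    have e : (⟨p.comp (.mulRight (H.left.s l)), fun l' a => by
        change p (H.left.s l' * a * H.left.s l) = l' * p (a * H.left.s l)
        rw [mul_assoc, hp]⟩ : H.left.LDual) = ⟨(AddMonoidHom.mulRight l).comp p, fun l' a => by
        change p (H.left.s l' * a) * l = l' * (p a * l)
        rw [hp, mul_assoc]⟩ := by
      apply hn.1.1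
      have e1 := LeftBialgebroid.ev_takeuchi
        (LeftBialgebroid.isBal_t_mul_of_LDual (B := H.left) ⟨p, hp⟩) l i
      simp only [← mul_assoc] at e1
      rw [← LeftBialgebroid.ev_mul_const] at e1
      refine (LeftBialgebroid.actLDual_eq _ _).trans (Eq.trans (e1.symm.trans ?_)
        (LeftBialgebroid.actLDual_eq _ _).symm)
      change _ = H.left.ev (fun x y => H.left.t (op (p y * l)) * x) i
      rw [hφ']
      simp only [LeftBialgebroid.t_op_mul, mul_assoc]
      rw [← LeftBialgebroid.mul_ev, hφ', mul_one, one_mul]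
    intro a
    exact DFunLike.congr_fun (congrArg Subtype.val e) a
  obtain ⟨q, hq⟩ := hn.2.2 1
  have hq1 := (LeftBialgebroid.actRDual_eq _ _).symm.trans hq
  have hqb : H.left.IsBal fun x y => H.left.s (q.1 x) * y :=
    ⟨fun _ _ _ => by rw [map_add, map_add, add_mul], fun _ _ _ => mul_add _ _ _, fun _ _ _ => by
      rw [q.2, map_mul, mul_assoc]⟩
  have d2 : ∀ k, H.left.ev (fun a b => H.left.s (q.1 (a * k)) * b) i = H.S k := fun k => by
    rw [hi.ev_mul_left hqb]
    simp only [← mul_assoc]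
    rw [← LeftBialgebroid.ev_mul_const, hq1, one_mul]
  -- Apply `p` to S(k) = s_L(q(i₍₁₎k))i₍₂₎. The result q(i₍₁₎k)p(i₍₂₎) is q(t_L(p(i₍₂₎))i₍₁₎k), that
  -- is, q(k).
  have hqp : ∀ k, q.1 k = p (H.S k) := fun k => by
    rw [← d2 k, LeftBialgebroid.map_ev]
    simp only [hp, ← q.2, ← mul_assoc]
    have e : H.left.ev (fun x y => q.1 (H.left.t (op (p y)) * x * k)) i =
        q.1 (H.left.ev (fun x y => H.left.t (op (p y)) * x) i * k) := by
      rw [LeftBialgebroid.ev_mul_const, LeftBialgebroid.map_ev]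
    rw [e, hφ', one_mul]
  refine ⟨p, hp, ms, d1, fun k => ?_⟩
  obtain ⟨k, rfl⟩ := H.S.surjective k
  simp only [← S_mul, ← hqp]
  exact d2 k

section TwoSided

variable {i : A} {p : A →+ L}

/-- Apply π_L to t_L(p(i₍₂₎))i₍₁₎ = 1: the left side becomes π_L(i₍₁₎)p(i₍₂₎) = p(s_Lπ_L(i₍₁₎)i₍₂₎),
and the counit axiom applies. -/
theorem IsFrobeniusForm.apply_self (h : H.IsFrobeniusForm i p) : p i = 1 := by
  have e : H.left.ev (fun a b => H.left.t (op (p b)) * a) i = 1 := by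
    simpa [H.S_one] using h.dual_left 1
  have e1 := congrArg H.left.π e
  rw [LeftBialgebroid.map_ev, H.left.π_one] at e1
  simp only [H.left.π_right, ← h.s_mul] at e1
  rw [← LeftBialgebroid.map_ev, LeftBialgebroid.ev_counit_left] at e1
  exact e1

/-- For a left integral p(bi) = π_L(b)p(i) = π_L(b). Hence the expansion of S⁻¹(i) by `dual_left`
coincides with the counit expansion of `i`. -/
theorem IsFrobeniusForm.S_self (h : H.IsFrobeniusForm i p) (hl : H.IsLeftIntegral i) : H.S i = i := by
  have e := h.dual_left (H.S.symm i)
  have e1 : ∀ b, p (b * H.S (H.S.symm i)) = H.left.π b := fun b => by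
    rw [AddEquiv.apply_symm_apply, hl, h.s_mul, h.apply_self, mul_one]
  simp only [e1, LeftBialgebroid.ev_counit_right] at e
  rw [AddEquiv.eq_symm_apply] at e
  exact e

end TwoSided

/-! ### Left against right non-degeneracy -/

section LeftNondegenerate

theorem sL_πL_tR (r : R) : H.left.s (H.left.π (H.right.t (op r))) = H.right.t (op r) := by
  obtain ⟨l, hl⟩ := H.exists_tR_eq_sL r
  rw [hl, H.left.π_s]

theorem πL_tR_mul (r r' : R) : H.left.π (H.right.t (op (r * r'))) =
    H.left.π (H.right.t (op r')) * H.left.π (H.right.t (op r)) := by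
  rw [op_mul, map_mul, ← sL_πL_tR r', H.left.π_left, sL_πL_tR]

theorem πL_tR_πR_sL (l : L) : H.left.π (H.right.t (op (H.right.π (H.left.s l)))) = l := by
  rw [tR_πR_sL, H.left.π_s]

theorem πR_sL_πL_tR (r : R) : H.right.π (H.left.s (H.left.π (H.right.t (op r)))) = r := by
  rw [sL_πL_tR, H.right.π_t]

theorem πR_sL_mul (l l' : L) : H.right.π (H.left.s (l * l')) =
    H.right.π (H.left.s l') * H.right.π (H.left.s l) := by
  conv_lhs => rw [← πL_tR_πR_sL (H := H) l, ← πL_tR_πR_sL (H := H) l', ← πL_tR_mul,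
    πR_sL_πL_tR]

/-- The anti-isomorphism of the base rings which corresponds to `s_L(L) = t_R(R)`. -/
def baseEquiv (H : HopfAlgebroid A L R) : R ≃+ L where
  toFun r := H.left.π (H.right.t (op r))
  invFun l := H.right.π (H.left.s l)
  left_inv := πR_sL_πL_tR
  right_inv := πL_tR_πR_sL
  map_add' r r' := by rw [MulOpposite.op_add, map_add, map_add]

theorem sL_baseEquiv (r : R) : H.left.s (H.baseEquiv r) = H.right.t (op r) := sL_πL_tR r

theorem tR_baseEquiv_symm (l : L) : H.right.t (op (H.baseEquiv.symm l)) = H.left.s l := tR_πR_sL l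

theorem baseEquiv_mul (r r' : R) : H.baseEquiv (r * r') = H.baseEquiv r' * H.baseEquiv r :=
  πL_tR_mul r r'

theorem baseEquiv_symm_mul (l l' : L) :
    H.baseEquiv.symm (l * l') = H.baseEquiv.symm l' * H.baseEquiv.symm l := πR_sL_mul l l'

theorem S_sL_mul (l : L) (a : A) :
    H.S (H.left.s l * a) = H.S a * H.right.s (H.baseEquiv.symm l) := by
  rw [← tR_baseEquiv_symm, S_tR_mul]

theorem S_symm_mul_sR (r : R) (a : A) :
    H.S.symm (a * H.right.s r) = H.left.s (H.baseEquiv r) * H.S.symm a := by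
  rw [AddEquiv.symm_apply_eq, S_sL_mul, AddEquiv.apply_symm_apply, AddEquiv.symm_apply_apply]

theorem S_symm_mul_tR (r : R) (a : A) :
    H.S.symm (a * H.right.t (op r)) = H.left.t (op (H.baseEquiv r)) * H.S.symm a := by
  rw [AddEquiv.symm_apply_eq, S_tL_mul, AddEquiv.apply_symm_apply, sL_baseEquiv]

/-- Composition with the antipode, as a bijection from `A^*` to `_*A`. -/
def rDualEquiv (H : HopfAlgebroid A L R) : H.right.RDual ≃ H.left.LDual where
  toFun φ := ⟨(H.baseEquiv.toAddMonoidHom.comp φ.1).comp H.S.toAddMonoidHom, fun l a => by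
    change H.baseEquiv (φ.1 (H.S (H.left.s l * a))) = l * H.baseEquiv (φ.1 (H.S a))
    rw [S_sL_mul, φ.2, baseEquiv_mul, AddEquiv.apply_symm_apply]⟩
  invFun ψ := ⟨(H.baseEquiv.symm.toAddMonoidHom.comp ψ.1).comp H.S.symm.toAddMonoidHom,
    fun r a => by
      change H.baseEquiv.symm (ψ.1 (H.S.symm (a * H.right.s r))) =
        H.baseEquiv.symm (ψ.1 (H.S.symm a)) * r
      rw [S_symm_mul_sR, ψ.2, baseEquiv_symm_mul, AddEquiv.symm_apply_apply]⟩
  left_inv φ := Subtype.ext <| AddMonoidHom.ext fun a => by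
    change H.baseEquiv.symm (H.baseEquiv (φ.1 (H.S (H.S.symm a)))) = φ.1 a
    rw [AddEquiv.symm_apply_apply, AddEquiv.apply_symm_apply]
  right_inv ψ := Subtype.ext <| AddMonoidHom.ext fun a => by
    change H.baseEquiv (H.baseEquiv.symm (ψ.1 (H.S.symm (H.S a)))) = ψ.1 a
    rw [AddEquiv.apply_symm_apply, AddEquiv.symm_apply_apply]

/-- Composition with the antipode, as a bijection from `^*A` to `A_*`. -/
def lDualEquiv (H : HopfAlgebroid A L R) : H.right.LDual ≃ H.left.RDual where
  toFun φ := ⟨(H.baseEquiv.toAddMonoidHom.comp φ.1).comp H.S.toAddMonoidHom, fun l a => by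
    change H.baseEquiv (φ.1 (H.S (H.left.t (op l) * a))) = H.baseEquiv (φ.1 (H.S a)) * l
    rw [S_tL_mul, ← tR_baseEquiv_symm, φ.2, baseEquiv_mul, AddEquiv.apply_symm_apply]⟩
  invFun ψ := ⟨(H.baseEquiv.symm.toAddMonoidHom.comp ψ.1).comp H.S.symm.toAddMonoidHom,
    fun r a => by
      change H.baseEquiv.symm (ψ.1 (H.S.symm (a * H.right.t (op r)))) =
        r * H.baseEquiv.symm (ψ.1 (H.S.symm a))
      rw [S_symm_mul_tR, ψ.2, baseEquiv_symm_mul, AddEquiv.symm_apply_apply]⟩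
  left_inv φ := Subtype.ext <| AddMonoidHom.ext fun a => by
    change H.baseEquiv.symm (H.baseEquiv (φ.1 (H.S (H.S.symm a)))) = φ.1 a
    rw [AddEquiv.symm_apply_apply, AddEquiv.apply_symm_apply]
  right_inv ψ := Subtype.ext <| AddMonoidHom.ext fun a => by
    change H.baseEquiv (H.baseEquiv.symm (ψ.1 (H.S.symm (H.S a)))) = ψ.1 a
    rw [AddEquiv.apply_symm_apply, AddEquiv.symm_apply_apply]

/-- By γ_R(S(j)) = S(j₍₂₎) ⊗ S(j₍₁₎), the antipode intertwines the actions of the duals of the two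
bialgebroids, functionals being composed with S and with the anti-isomorphism of the base rings. -/
theorem actRDual_S (φ : H.right.RDual) (j : A) :
    H.right.actRDual φ (H.S j) = H.S (H.left.actLDual (H.rDualEquiv φ) j) := by
  have hφ : H.right.IsBal fun x y => y * H.right.t (op (φ.1 x)) :=
    ⟨fun _ _ _ => by rw [map_add, MulOpposite.op_add, map_add, mul_add],
      fun _ _ _ => add_mul _ _ _,
      fun _ _ _ => by rw [φ.2, op_mul, map_mul, mul_assoc]⟩
  rw [RightBialgebroid.actRDual_eq, ev_S hφ, LeftBialgebroid.actLDual_eq, LeftBialgebroid.map_ev]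
  congr 1; funext a b
  rw [S_tL_mul]
  change _ = H.S a * H.left.s (H.baseEquiv (φ.1 (H.S b)))
  rw [sL_baseEquiv]

theorem actLDual_S (φ : H.right.LDual) (j : A) :
    H.right.actLDual φ (H.S j) = H.S (H.left.actRDual (H.lDualEquiv φ) j) := by
  have hφ : H.right.IsBal fun x y => x * H.right.s (φ.1 y) :=
    ⟨fun _ _ _ => add_mul _ _ _, fun _ _ _ => by rw [map_add, map_add, mul_add],
      fun _ _ _ => by rw [φ.2, map_mul, mul_assoc]⟩
  rw [RightBialgebroid.actLDual_eq, ev_S hφ, LeftBialgebroid.actRDual_eq, LeftBialgebroid.map_ev]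
  congr 1; funext a b
  rw [S_sL_mul]
  change _ = H.S b * H.right.s (H.baseEquiv.symm (H.baseEquiv (φ.1 (H.S a))))
  rw [AddEquiv.symm_apply_apply]

/-- The maps that define the two conditions differ by bijections on both sides: S on the total ring,
and composition with S on the duals. -/
theorem isLeftNondegenerate_S_iff {j : A} :
    H.IsLeftNondegenerate (H.S j) ↔ H.IsRightNondegenerate j := by
  refine and_congr ?_ ?_
  · simp only [actRDual_S]
    exact (Equiv.comp_bijective (fun φ => H.left.actLDual (H.rDualEquiv φ) j) H.S.toEquiv).trans
      (Equiv.bijective_comp H.rDualEquiv fun φ => H.left.actLDual φ j)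
  · simp only [actLDual_S]
    exact (Equiv.comp_bijective (fun φ => H.left.actRDual (H.lDualEquiv φ) j) H.S.toEquiv).trans
      (Equiv.bijective_comp H.lDualEquiv fun φ => H.left.actRDual φ j)

theorem IsRightIntegral.S_eq_iff {i : A} (hi : H.IsRightIntegral i)
    (hn : H.IsRightNondegenerate i) : H.S i = i ↔ H.IsLeftIntegral i := by
  obtain ⟨p, hp⟩ := hi.exists_isFrobeniusForm hn
  exact ⟨fun h => h ▸ hi.S, hp.S_self⟩

/-- A two-sided integral which is non-degenerate on one side is so on both sides. -/
theorem nondegenerate_of_twoSided {i : A} (hl : H.IsLeftIntegral i) (hr : H.IsRightIntegral i)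
    (h : H.IsLeftNondegenerate i ∨ H.IsRightNondegenerate i) :
    H.S i = i ∧ H.IsLeftNondegenerate i ∧ H.IsRightNondegenerate i := by
  have key : ∀ {j : A}, H.IsLeftIntegral j → H.IsRightIntegral j → H.IsRightNondegenerate j →
      H.S j = j ∧ H.IsLeftNondegenerate j ∧ H.IsRightNondegenerate j := fun hl hr hn => by
    have e := (hr.S_eq_iff hn).2 hl
    exact ⟨e, e ▸ isLeftNondegenerate_S_iff.2 hn, hn⟩
  obtain h | h := h
  -- The preimage `j` under S is again a two-sided integral and is right non-degenerate, so the
  -- settled case gives S(j) = j.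
  · obtain ⟨j, rfl⟩ := H.S.surjective i
    have hj := key (IsLeftIntegral.of_S hr) (IsRightIntegral.of_S hl)
      (isLeftNondegenerate_S_iff.1 h)
    rw [hj.1]
    exact hj
  · exact key hl hr h

end LeftNondegenerate

end HopfAlgebroid

end Integrals

/-! ### The Frobenius algebra structure on the total ring -/

section Convolution

variable {A L R T : Type*} [Ring A] [Ring L] [Ring R] [AddCommGroup T]

namespace HopfAlgebroid

variable {H : HopfAlgebroid A L R} {i : A} {p : A →+ L}

/-- The convolution product `a ∗ k = t_L(p(a₍₂₎ S(k))) a₍₁₎`. -/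
def star (H : HopfAlgebroid A L R) (p : A →+ L) (a k : A) : A :=
  H.left.ev (fun x y => H.left.t (op (p (y * H.S k))) * x) a

namespace IsFrobeniusForm

/-- The element `k` acts through the functional p(· S(k)), which φ ↦ i ↽ φ sends to `k`. In this way
∗ is the product of the dual ring carried over to the total ring. -/
theorem star_eq_actLDual (h : H.IsFrobeniusForm i p) (a k : A) :
    H.star p a k = H.left.actLDual (dualOf h.s_mul k) a := by
  rw [LeftBialgebroid.actLDual_eq]
  rfl

theorem isBal_star_aux (h : H.IsFrobeniusForm i p) (k : A) :
    H.left.IsBal fun x y => H.left.t (op (p (y * H.S k))) * x :=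
  LeftBialgebroid.isBal_t_mul_of_LDual (dualOf h.s_mul k)

theorem star_add_left (h : H.IsFrobeniusForm i p) (a a' k : A) :
    H.star p (a + a') k = H.star p a k + H.star p a' k :=
  LeftBialgebroid.ev_add (h.isBal_star_aux k) a a'

theorem star_add_right (_ : H.IsFrobeniusForm i p) (a k k' : A) :
    H.star p a (k + k') = H.star p a k + H.star p a k' := by
  rw [star, star, star, ← LeftBialgebroid.ev_add_fun]
  simp only [map_add, mul_add, LeftBialgebroid.t_op_add, add_mul]

theorem star_mul_sR (h : H.IsFrobeniusForm i p) (a k : A) (r : R) :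
    H.star p (a * H.right.s r) k = H.star p a (k * H.right.t (op r)) := by
  obtain ⟨l, hl⟩ := H.exists_sR_eq_tL r
  rw [star, hl, LeftBialgebroid.ev_mul_t (h.isBal_star_aux k), ← hl]
  simp only [star, S_mul_tR, mul_assoc]

/-- The product `∗` is balanced over `R`. -/
theorem isBal_star (h : H.IsFrobeniusForm i p) : H.right.IsBal fun a k => H.star p a k :=
  ⟨h.star_add_left, h.star_add_right, fun a r k => h.star_mul_sR a k r⟩

/-- The product `∗` is a module map. -/
theorem ev_star (h : H.IsFrobeniusForm i p) (a k g : A) :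
    H.right.ev (fun x y => H.star p (a * x) (k * y)) g = H.star p a k * g := by
  -- Since S(kg⁽²⁾) = S(g⁽²⁾)S(k), the factor g⁽¹⁾₍₂₎S(g⁽²⁾) appears inside `p`; it cancels and
  -- leaves `g` on the right of the first leg.
  have e := ev_ev_mul_S (isBal_ev_mul_mul (h.isBal_star_aux k) a) g
  simp only [mul_one, ← mul_assoc] at e
  rw [star, LeftBialgebroid.ev_mul_const, ← e]
  congr 1; funext x y
  rw [star, LeftBialgebroid.ev_mul (h.isBal_star_aux (k * y))]
  simp only [S_mul, ← mul_assoc]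
  exact Bal.sw_comm _ _ _

theorem self_star (h : H.IsFrobeniusForm i p) (k : A) : H.star p i k = k := h.dual_left k

/-- The two elements are compared through the functionals ψ = p(· S(c)), which separate elements.
With φ = p(· S(1)) one has i ↽ φψ = 1 ∗ c = t_L(p(S(c))), so `apply_LDual` gives (φψ)(a) =
p(a)p(S(c)), whereas by definition (φψ)(a) = p((a ∗ 1)S(c)). -/
theorem star_one (h : H.IsFrobeniusForm i p) (a : A) : H.star p a 1 = H.left.s (p a) := by
  refine h.separates fun c => ?_
  have e := h.apply_LDual ((dualOf h.s_mul 1).mul (dualOf h.s_mul c)) a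
  rw [← LeftBialgebroid.actLDual_actLDual, ← h.star_eq_actLDual, ← h.star_eq_actLDual,
    h.self_star, star, LeftBialgebroid.ev_one (h.isBal_star_aux c), mul_one, one_mul, S_tL,
    h.mul_s] at e
  rw [h.s_mul, ← e, star_eq_actLDual h]
  rfl

/-- Insert 1 ⊗ k = S(k₍₁₎)k₍₂₎⁽¹⁾ ⊗ k₍₂₎⁽²⁾ into a ∗ k. H-linearity of ∗ turns the result into
(aS(k₍₁₎) ∗ 1)k₍₂₎, and `star_one` applies. This second description makes the properties of ∗ in its
right argument accessible. -/
theorem star_eq (h : H.IsFrobeniusForm i p) (a k : A) :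
    H.star p a k = H.left.ev (fun x y => H.left.s (p (a * H.S x)) * y) k := by
  have e := ev_ev_S_mul (RightBialgebroid.isBal_mul_left h.isBal_star a) k
  simp only [mul_one, ← mul_assoc] at e
  rw [← e]
  congr 1; funext x y
  rw [← h.star_one, ← h.ev_star]
  simp only [one_mul]

theorem star_self (h : H.IsFrobeniusForm i p) (a : A) : H.star p a i = a := by
  rw [h.star_eq, h.dual_right]

/-- By injectivity of φ ↦ i ↽ φ, the functional of k ∗ g is the product of the functionals of `k`
and `g`; and acting with two functionals in succession is acting with their product. -/
theorem star_assoc (h : H.IsFrobeniusForm i p) (a k g : A) :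
    H.star p (H.star p a k) g = H.star p a (H.star p k g) := by
  have e : (dualOf h.s_mul k).mul (dualOf h.s_mul g) = dualOf (H := H) h.s_mul (H.star p k g) := by
    apply h.isRightNondegenerate.1.1
    change H.left.actLDual _ i = H.left.actLDual _ i
    rw [← LeftBialgebroid.actLDual_actLDual, ← h.star_eq_actLDual, ← h.star_eq_actLDual,
      ← h.star_eq_actLDual, h.self_star, h.self_star]
  rw [h.star_eq_actLDual, h.star_eq_actLDual, LeftBialgebroid.actLDual_actLDual, e,
    ← h.star_eq_actLDual]

theorem star_actLDual (h : H.IsFrobeniusForm i p) (a : A) (ψ : H.left.LDual) :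
    H.star p a (H.left.actLDual ψ i) = H.left.actLDual ψ a := by
  rw [star, LeftBialgebroid.actLDual_eq ψ a]
  simp only [← h.apply_LDual]

theorem sL_mul_star (h : H.IsFrobeniusForm i p) (l : L) (a k : A) :
    H.star p (H.left.s l * a) k = H.left.s l * H.star p a k := by
  rw [star, LeftBialgebroid.ev_s_mul (h.isBal_star_aux k), star, LeftBialgebroid.mul_ev]
  simp only [← mul_assoc, H.left.s_comm_t]

theorem isBal_star_eq_aux (h : H.IsFrobeniusForm i p) (a : A) :
    H.left.IsBal fun x y => H.left.s (p (a * H.S x)) * y :=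
  ⟨fun _ _ _ => by rw [map_add, mul_add, map_add, map_add, add_mul], fun _ _ _ => mul_add _ _ _,
    fun _ _ _ => by rw [S_tL_mul, ← mul_assoc, h.mul_s, map_mul, mul_assoc]⟩

theorem star_tL_mul (h : H.IsFrobeniusForm i p) (l : L) (a k : A) :
    H.star p a (H.left.t (op l) * k) = H.left.t (op l) * H.star p a k := by
  rw [h.star_eq, LeftBialgebroid.ev_t_mul (h.isBal_star_eq_aux a), h.star_eq,
    LeftBialgebroid.mul_ev]
  simp only [← mul_assoc, H.left.s_comm_t]

theorem star_mul_right_sR (h : H.IsFrobeniusForm i p) (a k : A) (r : R) :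
    H.star p a (k * H.right.s r) = H.star p a k * H.right.s r := by
  have hb : H.right.IsBal fun x y => H.star p (a * x) (k * y) :=
    RightBialgebroid.isBal_mul_mul h.isBal_star a k
  rw [← h.ev_star, RightBialgebroid.ev_s hb, mul_one]

theorem star_mul_tR (h : H.IsFrobeniusForm i p) (a k : A) (r : R) :
    H.star p (a * H.right.t (op r)) k = H.star p a k * H.right.t (op r) := by
  have hb : H.right.IsBal fun x y => H.star p (a * x) (k * y) :=
    RightBialgebroid.isBal_mul_mul h.isBal_star a k
  rw [← h.ev_star, RightBialgebroid.ev_t hb, mul_one]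

/-- `γ_R(a ∗ k) = a⁽¹⁾ ⊗ a⁽²⁾ ∗ k`. -/
theorem ev_star_left (h : H.IsFrobeniusForm i p) {f : A → A → T} (hf : H.right.IsBal f)
    (a k : A) : H.right.ev f (H.star p a k) = H.right.ev (fun x y => f x (H.star p y k)) a := by
  have hF : H.IsBalRL fun x y z => f x (H.left.t (op (p (z * H.S k))) * y) := by
    have hk := h.isBal_star_aux k
    refine ⟨fun _ _ _ _ => hf.add_left _ _ _, fun x y y' z => ?_, fun x y z z' => ?_,
      fun x r y z => ?_, fun x y l z => ?_⟩
    · rw [mul_add, hf.add_right]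
    · rw [hk.add_right, hf.add_right]
    · rw [hf.bal, mul_assoc]
    · rw [hk.bal]
  have e1 : ∀ l x, H.right.ev f (H.left.t (op l) * x) =
      H.right.ev (fun a b => f a (H.left.t (op l) * b)) x := fun l x => by
    obtain ⟨r, hr⟩ := H.exists_tL_eq_sR l
    rw [hr, RightBialgebroid.ev_s_mul hf]
  rw [star]
  refine (RightBialgebroid.ev_sw hf _ _).trans ?_
  simp only [e1]
  refine (ev_coassocRL hF a).trans ?_
  congr 1; funext x y
  rw [star, LeftBialgebroid.ev_isBal_right hf]

/-- `γ_R(a ∗ k) = a ∗ k⁽¹⁾ ⊗ k⁽²⁾`. -/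
theorem ev_star_right (h : H.IsFrobeniusForm i p) {f : A → A → T} (hf : H.right.IsBal f)
    (a k : A) : H.right.ev f (H.star p a k) = H.right.ev (fun x y => f (H.star p a x) y) k := by
  have hF : H.IsBalLR fun x y z => f (H.left.s (p (a * H.S x)) * y) z := by
    have hk := h.isBal_star_eq_aux a
    refine ⟨fun x x' y z => ?_, fun x y y' z => ?_, fun x y z z' => hf.add_right _ _ _,
      fun x l y z => ?_, fun x y r z => ?_⟩
    · rw [hk.add_left, hf.add_left]
    · rw [mul_add, hf.add_left]
    · rw [hk.bal]
    · rw [← mul_assoc, hf.bal]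
  have e1 : ∀ l x, H.right.ev f (H.left.s l * x) =
      H.right.ev (fun a b => f (H.left.s l * a) b) x := fun l x => by
    obtain ⟨r, hr⟩ := H.exists_sL_eq_tR l
    rw [hr, RightBialgebroid.ev_t_mul hf]
  rw [h.star_eq]
  refine (RightBialgebroid.ev_sw hf _ _).trans ?_
  simp only [e1]
  refine (ev_coassocLR hF k).symm.trans ?_
  congr 1; funext x y
  rw [h.star_eq, LeftBialgebroid.ev_isBal_left hf]

/-- As `i` is the unit of ∗ and γ_R is a bimodule map, γ_R(i) plays the part of the Casimir element
of a Frobenius algebra: it generates all coproducts. -/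
theorem ev_self_left (h : H.IsFrobeniusForm i p) {f : A → A → T} (hf : H.right.IsBal f)
    (k : A) : H.right.ev (fun x y => f x (H.star p y k)) i = H.right.ev f k := by
  rw [← h.ev_star_left hf, h.self_star]

theorem ev_self_right (h : H.IsFrobeniusForm i p) {f : A → A → T} (hf : H.right.IsBal f)
    (a : A) : H.right.ev (fun x y => f (H.star p a x) y) i = H.right.ev f a := by
  rw [← h.ev_star_right hf, h.star_self]

/-- By `apply_LDual` the functional p(t_L(l) ·) is represented by (t_L(l)i) ∗ 1. A left integral
satisfies t_L(l)i = s_L(l)i, so this element is s_L(l)(i ∗ 1) = s_L(l). -/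
theorem apply_tL_mul (h : H.IsFrobeniusForm i p) (hl : H.IsLeftIntegral i) (l : L) (x : A) :
    p (H.left.t (op l) * x) = p (x * H.S (H.left.s l)) := by
  let φ : H.left.LDual := ⟨p.comp (.mulLeft (H.left.t (op l))), fun l' a => by
    change p (H.left.t (op l) * (H.left.s l' * a)) = l' * p (H.left.t (op l) * a)
    rw [← mul_assoc, ← H.left.s_comm_t, mul_assoc, h.s_mul]⟩
  have e := h.apply_LDual φ x
  refine e.trans ?_
  rw [LeftBialgebroid.actLDual_eq]
  have e1 : H.left.ev (fun x y => H.left.t (op (φ.1 y)) * x) i = H.left.s l := by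
    have e2 := LeftBialgebroid.ev_t_mul (h.isBal_star_aux 1) l i
    rw [hl, H.left.π_t] at e2
    simp only [H.S_one, mul_one] at e2
    refine e2.symm.trans ?_
    have e3 := h.sL_mul_star l i 1
    rw [h.self_star, mul_one] at e3
    simpa only [star, H.S_one, mul_one] using e3
  rw [e1]

theorem tL_mul_star (h : H.IsFrobeniusForm i p) (hl : H.IsLeftIntegral i) (l : L) (a k : A) :
    H.star p (H.left.t (op l) * a) k = H.star p a (H.left.s l * k) := by
  rw [h.star_eq, h.star_eq, LeftBialgebroid.ev_s_mul (h.isBal_star_eq_aux a)]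
  simp only [mul_assoc, h.apply_tL_mul hl, S_mul]

theorem star_sL_mul_self (h : H.IsFrobeniusForm i p) (hl : H.IsLeftIntegral i) (l : L) (a : A) :
    H.star p a (H.left.s l * i) = H.left.t (op l) * a := by
  rw [← h.tL_mul_star hl, h.star_self]

theorem isBal_mul_sR_π : H.right.IsBal fun x y => x * H.right.s (H.right.π y) :=
  ⟨fun _ _ _ => add_mul _ _ _, fun _ _ _ => by rw [map_add, map_add, mul_add],
    fun _ _ _ => by rw [H.right.π_left, map_mul, mul_assoc]⟩

/-- The antipode in terms of the Frobenius structure. -/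
theorem ev_mul_sR_π_star (h : H.IsFrobeniusForm i p) (hl : H.IsLeftIntegral i) (a n : A) :
    H.right.ev (fun x y => x * H.right.s (H.right.π (H.star p (a * y) n))) i = H.S a * n := by
  have hb : H.right.IsBal fun x y => x * H.right.s (H.right.π (H.star p y n)) :=
    ⟨fun _ _ _ => add_mul _ _ _, fun _ _ _ => by rw [h.star_add_left, map_add, map_add, mul_add],
      fun x r y => by rw [h.star_mul_tR, H.right.π_left, map_mul, mul_assoc]⟩
  -- The factor `a` of the second leg becomes S(a) in front of the first. Then i⁽¹⁾ ⊗ i⁽²⁾ ∗ n is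
  -- the coproduct of `n`, and the counit axiom finishes.
  rw [← hl.ev_S_mul_left hb]
  simp only [mul_assoc]
  rw [← RightBialgebroid.mul_ev, h.ev_self_left isBal_mul_sR_π, RightBialgebroid.ev_counit_right]

/-- The k-th term is t_L(p(c₍₂₎y_k))c₍₁₎ ⊗ x_k. The scalar crosses to x_k as s_L(p(c₍₂₎y_k)), and
the hypothesis on the family sums these to c₍₂₎. -/
theorem γL_eq_sum (_ : H.IsFrobeniusForm i p) {n : ℕ} {y x : Fin n → A}
    (hyx : ∀ a, ∑ k, H.left.s (p (a * y k)) * x k = a) (c : A) :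
    H.left.γ c = ∑ k, Bal.mk _ _ (H.star p c (H.S.symm (y k)) ⊗ₜ x k) := by
  have hb : H.left.IsBal fun a b => (Bal.mk _ _ (a ⊗ₜ b) : LTensor H.left.s H.left.t) :=
    Bal.isBal_mk
  have e1 : ∀ k, (Bal.mk _ _ (H.star p c (H.S.symm (y k)) ⊗ₜ x k) : LTensor H.left.s H.left.t) =
      H.left.ev (fun a b => Bal.mk _ _ (a ⊗ₜ (H.left.s (p (b * y k)) * x k))) c := fun k => by
    rw [star]
    refine (LeftBialgebroid.ev_isBal_left hb _ _ _).trans ?_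
    simp only [AddEquiv.apply_symm_apply]
    congr 1; funext a b
    exact hb.bal _ _ _
  simp only [e1]
  conv_lhs => rw [← Bal.sw_mk (H.left.γ c)]
  refine Eq.trans ?_ Finset.sum_comm
  refine Finset.sum_congr rfl fun q _ => ?_
  rw [← hb.sum_right Finset.univ, hyx]

/-- Start from γ_R(c) = c ∗ i⁽¹⁾ ⊗ i⁽²⁾ and, as S(i) = i, from γ_R(i) = S(i₍₂₎) ⊗ S(i₍₁₎). Expand
i₍₂₎ in the x_k and move the scalars to the other leg, which becomes S(t_L(p(i₍₂₎y_k))i₍₁₎); this is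
y_k by `dual_left` at S⁻¹(y_k). -/
theorem γR_eq_sum (h : H.IsFrobeniusForm i p) (hS : H.S i = i) {n : ℕ} {y x : Fin n → A}
    (hyx : ∀ a, ∑ k, H.left.s (p (a * y k)) * x k = a) (c : A) :
    H.right.γ c = ∑ k, Bal.mk _ _ (H.star p c (H.S (x k)) ⊗ₜ y k) := by
  have hb : H.right.IsBal fun a b => (Bal.mk _ _ (a ⊗ₜ b) : RTensor H.right.s H.right.t) :=
    Bal.isBal_mk
  have hb' : H.right.IsBal fun a b =>
      (Bal.mk _ _ (H.star p c a ⊗ₜ b) : RTensor H.right.s H.right.t) :=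
    ⟨fun _ _ _ => by rw [h.star_add_right, hb.add_left], fun _ _ _ => hb.add_right _ _ _,
      fun _ _ _ => by rw [h.star_mul_right_sR]; exact hb.bal _ _ _⟩
  have e : H.right.γ c = H.right.ev (fun a b => Bal.mk _ _ (H.star p c a ⊗ₜ b)) i := by
    rw [h.ev_self_right hb]
    exact (Bal.sw_mk _).symm
  have e1 : ∀ a b, (Bal.mk _ _ (H.star p c (H.S b) ⊗ₜ H.S a) : RTensor H.right.s H.right.t) =
      ∑ k, Bal.mk _ _ (H.star p c (H.S (x k)) ⊗ₜ H.S (H.left.t (op (p (b * y k))) * a)) :=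
    fun a b => by
      conv_lhs => rw [← hyx b, map_sum]
      rw [hb'.sum_left]
      refine Finset.sum_congr rfl fun k _ => ?_
      rw [S_sL_mul, S_tL_mul, ← tR_baseEquiv_symm]
      exact hb'.bal _ _ _
  rw [e]
  conv_lhs => rw [← hS, ev_S hb']
  rw [funext fun a => funext fun b => e1 a b]
  refine (Finset.sum_comm).trans (Finset.sum_congr rfl fun k _ => ?_)
  have e2 := h.dual_left (H.S.symm (y k))
  simp only [AddEquiv.apply_symm_apply] at e2
  change H.left.ev (fun a b => Bal.mk _ _ (H.star p c (H.S (x k)) ⊗ₜ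
    H.S (H.left.t (op (p (b * y k))) * a))) i = _
  refine (LeftBialgebroid.ev_isBal_right hb _ _ _).symm.trans ?_
  rw [← LeftBialgebroid.map_ev, e2, AddEquiv.apply_symm_apply]

end IsFrobeniusForm

end HopfAlgebroid

end Convolution

/-! ### Internal bimodules in terms of elements -/

section BimoduleElements

open RightBialgebroid RightBialgebroid.RMod

variable {H R : Type u} [Ring H] [Ring R] {B : RightBialgebroid H R}

namespace RightBialgebroid.RMod

open MonoidalCategory

theorem surjective_lin_of_epi {M N : B.RMod} (f : M ⟶ N) [Epi f] : Function.Surjective (lin f) :=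
  (ModuleCat.epi_iff_surjective (R := Hᵐᵒᵖ) f).1 ‹_›

theorem op_smul_pure {M N : B.RMod} (m : M) (n : N) (h : H) :
    op h • pure m n = B.ev (fun x y => pure (op x • m) (op y • n)) h := by
  change B.orbit m n (B.γ h) = _
  rw [orbit, Bal.lift_eq_sw]
  rfl

end RightBialgebroid.RMod

namespace Bim

open Bicategory

/-- The right `H`-module underlying a 1-morphism of bimodules. -/
abbrev El {M N : Bim B.RMod} (P : M ⟶ N) : B.RMod := obj (C := B.RMod) P

/-- The map on elements underlying a 2-morphism of bimodules. -/
def ap {M N : Bim B.RMod} {P Q : M ⟶ N} (f : P ⟶ Q) : El P →ₗ[Hᵐᵒᵖ] El Q := lin (hom f)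

/-- Equality of 2-morphisms is tested on elements, so that bicategorical identities turn into
computations with ∗ and Sweedler sums. -/
theorem ap_ext {M N : Bim B.RMod} {P Q : M ⟶ N} {f g : P ⟶ Q} (h : ∀ p, ap f p = ap g p) :
    f = g :=
  Bimod.hom_ext (C := B.RMod) f g (hom_ext (LinearMap.ext h))

theorem ap_comp {M N : Bim B.RMod} {P Q T : M ⟶ N} (f : P ⟶ Q) (g : Q ⟶ T) (p : El P) :
    ap (f ≫ g) p = ap g (ap f p) := rfl

theorem ap_id {M N : Bim B.RMod} (P : M ⟶ N) (p : El P) : ap (𝟙 P) p = p := rfl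

theorem ap_add_apply {M N : Bim B.RMod} {P Q : M ⟶ N} (f g : P ⟶ Q) (p : El P) :
    ap (f + g) p = ap f p + ap g p := rfl

theorem ap_sum_apply {M N : Bim B.RMod} {P Q : M ⟶ N} {n : ℕ} (f : Fin n → (P ⟶ Q)) (p : El P) :
    ap (∑ k, f k) p = ∑ k, ap (f k) p :=
  map_sum (AddMonoidHom.mk' (fun f : P ⟶ Q => ap f p) fun f g => ap_add_apply f g p) f Finset.univ

theorem ap_hom_inv {M N : Bim B.RMod} {P Q : M ⟶ N} (e : P ≅ Q) (p : El P) :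
    ap e.inv (ap e.hom p) = p := by
  rw [← ap_comp, e.hom_inv_id, ap_id]

theorem ap_inv_hom {M N : Bim B.RMod} {P Q : M ⟶ N} (e : P ≅ Q) (p : El Q) :
    ap e.hom (ap e.inv p) = p := by
  rw [← ap_comp, e.inv_hom_id, ap_id]

/-- The projection of the tensor product of two bimodules onto their composite. -/
def prj {M N T : Bim B.RMod} (P : M ⟶ N) (Q : N ⟶ T) :
    MonoidalCategoryStruct.tensorObj (El P) (El Q) ⟶ El (P ≫ Q) :=
  proj (C := B.RMod) (M := M) (N := N) (T := T) P Q

/-- The element `p ⊗ q` of the composite `P ≫ Q` of two bimodules. -/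
def tm {M N T : Bim B.RMod} {P : M ⟶ N} {Q : N ⟶ T} (p : El P) (q : El Q) : El (P ≫ Q) :=
  lin (prj P Q) (pure p q)

/-- The left action of the monoid `M` on a bimodule. -/
def lact {M N : Bim B.RMod} {P : M ⟶ N} (a : El (𝟙 M)) (p : El P) : El P :=
  lin (Bimod.actLeft (C := B.RMod) (A := M) (B := N) P) (pure a p)

/-- The right action of the monoid `N` on a bimodule. -/
def ract {M N : Bim B.RMod} {P : M ⟶ N} (p : El P) (a : El (𝟙 N)) : El P :=
  lin (Bimod.actRight (C := B.RMod) (A := M) (B := N) P) (pure p a)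

/-- The unit of the monoid `M`. -/
def oneElt (M : Bim B.RMod) : El (𝟙 M) :=
  lin (Mon.mon (C := B.RMod) M).one (unitElt 1)

variable {M N T U : Bim B.RMod} {P P' : M ⟶ N} {Q Q' : N ⟶ T} {W : T ⟶ U}

theorem tm_add_left (p p' : El P) (q : El Q) : tm (p + p') q = tm p q + tm p' q := by
  rw [tm, pure_add_left, map_add]
  rfl

theorem tm_add_right (p : El P) (q q' : El Q) : tm p (q + q') = tm p q + tm p q' := by
  rw [tm, pure_add_right, map_add]
  rfl

/-- The projection onto the composite is a coequalizer map, hence epi, hence a surjective map of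
modules. -/
theorem tm_induction {p : El (P ≫ Q) → Prop} (h0 : p 0) (ht : ∀ a b, p (tm a b))
    (ha : ∀ x y, p x → p y → p (x + y)) (x : El (P ≫ Q)) : p x := by
  have : Epi (prj P Q) := coequalizer.π_epi
  obtain ⟨x, rfl⟩ := surjective_lin_of_epi (prj P Q) x
  induction x using tensor_induction with
  | h0 => rw [map_zero]; exact h0
  | hp m n => exact ht m n
  | ha x y hx hy => rw [map_add]; exact ha _ _ hx hy

theorem tm_balance (p : El P) (a : El (𝟙 N)) (q : El Q) : tm (ract p a) q = tm p (lact a q) := by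
  have := coequalizer.condition
    (MonoidalCategoryStruct.whiskerRight (Bimod.actRight (C := B.RMod) (A := M) (B := N) P) (El Q))
    ((MonoidalCategoryStruct.associator _ _ _).hom ≫
      MonoidalCategoryStruct.whiskerLeft (El P) (Bimod.actLeft (C := B.RMod) (A := N) (B := T) Q))
  exact congrArg (fun f => lin f (pure (pure p a) q)) this

theorem ap_whiskerLeft (P : M ⟶ N) (f : Q ⟶ Q') (p : El P) (q : El Q) :
    ap (P ◁ f) (tm p q) = tm p (ap f q) :=
  congrArg (fun f => lin f (pure p q))
    (proj_whiskerLeft (C := B.RMod) (M := M) (N := N) (T := T) P f)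

theorem ap_whiskerRight (f : P ⟶ P') (Q : N ⟶ T) (p : El P) (q : El Q) :
    ap (f ▷ Q) (tm p q) = tm (ap f p) q :=
  congrArg (fun f => lin f (pure p q))
    (proj_whiskerRight (C := B.RMod) (M := M) (N := N) (T := T) f Q)

theorem ap_leftUnitor (P : M ⟶ N) (a : El (𝟙 M)) (p : El P) :
    ap (λ_ P).hom (tm a p) = lact a p := by
  have : proj (C := B.RMod) _ _ ≫ Bimod.LeftUnitorBimod.hom (C := B.RMod) (R := M) (S := N) P =
     Bimod.actLeft (C := B.RMod) (A := M) (B := N) P := coequalizer.π_desc _ _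
  exact congrArg (fun f => lin f (pure a p)) this

theorem ap_rightUnitor (P : M ⟶ N) (p : El P) (a : El (𝟙 N)) :
    ap (ρ_ P).hom (tm p a) = ract p a := by
  have : proj (C := B.RMod) _ _ ≫ Bimod.RightUnitorBimod.hom (C := B.RMod) (R := M) (S := N) P =
     Bimod.actRight (C := B.RMod) (A := M) (B := N) P := coequalizer.π_desc _ _
  exact congrArg (fun f => lin f (pure p a)) this

theorem ap_leftUnitor_inv (P : M ⟶ N) (p : El P) : ap (λ_ P).inv p = tm (oneElt M) p := rfl

theorem ap_rightUnitor_inv (P : M ⟶ N) (p : El P) : ap (ρ_ P).inv p = tm p (oneElt N) := rfl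

/-- The associator of bimodules is induced from that of ℳ_H through two successive coequalizers;
composition with both projections recovers the latter. -/
theorem ap_associator (P : M ⟶ N) (Q : N ⟶ T) (W : T ⟶ U) (p : El P) (q : El Q) (k : El W) :
    ap (α_ P Q W).hom (tm (tm p q) k) = tm p (tm q k) := by
  have h1 : prj (P ≫ Q) W ≫ hom (C := B.RMod) (α_ P Q W).hom =
      Bimod.AssociatorBimod.homAux (C := B.RMod) (R := M) (S := N) (T := T) (U := U) P Q W :=
    coequalizer.π_desc _ _
  have h2 : MonoidalCategoryStruct.whiskerRight (prj P Q) (El W) ≫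
      Bimod.AssociatorBimod.homAux (C := B.RMod) (R := M) (S := N) (T := T) (U := U) P Q W =
      (MonoidalCategoryStruct.associator _ _ _).hom ≫
        MonoidalCategoryStruct.whiskerLeft (El P) (prj Q W) ≫ prj P (Q ≫ W) :=
    π_tensor_id_preserves_coequalizer_inv_desc _ _ _ _
  have h3 := congrArg (fun f => lin f (pure (tm p q) k)) h1
  exact h3.trans (congrArg (fun f => lin f (pure (pure p q) k)) h2)

theorem ap_associator_inv (P : M ⟶ N) (Q : N ⟶ T) (W : T ⟶ U) (p : El P) (q : El Q)
    (k : El W) : ap (α_ P Q W).inv (tm p (tm q k)) = tm (tm p q) k := by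
  rw [← ap_associator, ap_hom_inv]

theorem lact_tm (a : El (𝟙 M)) (p : El P) (q : El Q) :
    lact a (tm p q) = tm (lact a p) q := by
  have := Bimod.TensorBimod.whiskerLeft_π_actLeft (C := B.RMod) (R := M) (S := N) (T := T) P Q
  exact congrArg (fun f => lin f (pure a (pure p q))) this

theorem ract_tm (p : El P) (q : El Q) (a : El (𝟙 T)) :
    ract (tm p q) a = tm p (ract q a) := by
  have := Bimod.TensorBimod.π_tensor_id_actRight (C := B.RMod) (R := M) (S := N) (T := T) P Q
  exact congrArg (fun f => lin f (pure (pure p q) a)) this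

theorem ap_lact (f : P ⟶ P') (a : El (𝟙 M)) (p : El P) : ap f (lact a p) = lact a (ap f p) :=
  congrArg (fun f => lin f (pure a p)) (Bimod.Hom.left_act_hom (C := B.RMod) f)

theorem ap_ract (f : P ⟶ P') (p : El P) (a : El (𝟙 N)) : ap f (ract p a) = ract (ap f p) a :=
  congrArg (fun f => lin f (pure p a)) (Bimod.Hom.right_act_hom (C := B.RMod) f)

/-- Construct a 2-morphism of bimodules from a linear map which commutes with the actions. -/
def mkHom (P P' : M ⟶ N) (f : El P →ₗ[Hᵐᵒᵖ] El P') (hl : ∀ a p, f (lact a p) = lact a (f p))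
    (hr : ∀ p a, f (ract p a) = ract (f p) a) : P ⟶ P' :=
  show Bimod.Hom (C := B.RMod) (A := M) (B := N) P P' from
  { hom := ofLin f
    left_act_hom := hom_ext₂ hl
    right_act_hom := hom_ext₂ hr }

theorem ext_tm {V : M ⟶ T} {f g : P ≫ Q ⟶ V} (h : ∀ p q, ap f (tm p q) = ap g (tm p q)) :
    f = g := by
  refine ap_ext fun x => ?_
  induction x using tm_induction with
  | h0 => simp
  | ht p q => exact h p q
  | ha x y hx hy => simp [hx, hy]

theorem op_smul_tm (p : El P) (q : El Q) (h : H) :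
    op h • tm p q = B.ev (fun x y => tm (op x • p) (op y • q)) h := by
  rw [tm, ← map_smul, op_smul_pure, RightBialgebroid.map_ev]
  rfl

theorem tm_smul_balance (p : El P) (r : R) (q : El Q) :
    tm (op (B.s r) • p) q = tm p (op (B.t (op r)) • q) :=
  congrArg (lin (prj P Q)) (pure_balance p r q)

end Bim

end BimoduleElements

/-! ### Direct sums of internal bimodules -/

section Biproducts

open MonoidalCategory MonObj

namespace Bim

variable {C : Type u₁} [Category.{v} C] [MonoidalCategory C] [Preadditive C]
  [HasBinaryBiproducts C] {M N : Mon C}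

/-- The left action on the direct sum of two bimodules. -/
def biprodActLeft (P Q : Bimod M N) : M.X ⊗ (P.X ⊞ Q.X) ⟶ P.X ⊞ Q.X :=
  biprod.lift (M.X ◁ biprod.fst ≫ P.actLeft) (M.X ◁ biprod.snd ≫ Q.actLeft)

/-- The right action on the direct sum of two bimodules. -/
def biprodActRight (P Q : Bimod M N) : (P.X ⊞ Q.X) ⊗ N.X ⟶ P.X ⊞ Q.X :=
  biprod.lift (biprod.fst ▷ N.X ≫ P.actRight) (biprod.snd ▷ N.X ≫ Q.actRight)

/-- The bimodule axioms for a direct sum are checked after projection to the summands, so no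
distributivity of the tensor product is needed. This rule and its variants carry a projection past a
whiskered action. -/
theorem whiskerLeft_biprodActLeft_fst (P Q : Bimod M N) : M.X ◁ biprodActLeft P Q ≫
    M.X ◁ biprod.fst = M.X ◁ M.X ◁ biprod.fst ≫ M.X ◁ P.actLeft := by
  rw [← MonoidalCategory.whiskerLeft_comp, biprodActLeft, biprod.lift_fst,
    MonoidalCategory.whiskerLeft_comp]

theorem whiskerLeft_biprodActLeft_snd (P Q : Bimod M N) : M.X ◁ biprodActLeft P Q ≫
    M.X ◁ biprod.snd = M.X ◁ M.X ◁ biprod.snd ≫ M.X ◁ Q.actLeft := by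
  rw [← MonoidalCategory.whiskerLeft_comp, biprodActLeft, biprod.lift_snd,
    MonoidalCategory.whiskerLeft_comp]

theorem biprodActLeft_fst_whiskerRight (P Q : Bimod M N) : biprodActLeft P Q ▷ N.X ≫
    biprod.fst ▷ N.X = (M.X ◁ biprod.fst) ▷ N.X ≫ P.actLeft ▷ N.X := by
  rw [← comp_whiskerRight, biprodActLeft, biprod.lift_fst, comp_whiskerRight]

theorem biprodActLeft_snd_whiskerRight (P Q : Bimod M N) : biprodActLeft P Q ▷ N.X ≫
    biprod.snd ▷ N.X = (M.X ◁ biprod.snd) ▷ N.X ≫ Q.actLeft ▷ N.X := by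
  rw [← comp_whiskerRight, biprodActLeft, biprod.lift_snd, comp_whiskerRight]

theorem whiskerLeft_biprodActRight_fst (P Q : Bimod M N) : M.X ◁ biprodActRight P Q ≫
    M.X ◁ biprod.fst = M.X ◁ biprod.fst ▷ N.X ≫ M.X ◁ P.actRight := by
  rw [← MonoidalCategory.whiskerLeft_comp, biprodActRight, biprod.lift_fst,
    MonoidalCategory.whiskerLeft_comp]

theorem whiskerLeft_biprodActRight_snd (P Q : Bimod M N) : M.X ◁ biprodActRight P Q ≫
    M.X ◁ biprod.snd = M.X ◁ biprod.snd ▷ N.X ≫ M.X ◁ Q.actRight := by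
  rw [← MonoidalCategory.whiskerLeft_comp, biprodActRight, biprod.lift_snd,
    MonoidalCategory.whiskerLeft_comp]

theorem biprodActRight_fst_whiskerRight (P Q : Bimod M N) : biprodActRight P Q ▷ N.X ≫
    biprod.fst ▷ N.X = biprod.fst ▷ N.X ▷ N.X ≫ P.actRight ▷ N.X := by
  rw [← comp_whiskerRight, biprodActRight, biprod.lift_fst, comp_whiskerRight]

theorem biprodActRight_snd_whiskerRight (P Q : Bimod M N) : biprodActRight P Q ▷ N.X ≫
    biprod.snd ▷ N.X = biprod.snd ▷ N.X ▷ N.X ≫ Q.actRight ▷ N.X := by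
  rw [← comp_whiskerRight, biprodActRight, biprod.lift_snd, comp_whiskerRight]

theorem biprodActLeft_fst (P Q : Bimod M N) : biprodActLeft P Q ≫ biprod.fst =
    M.X ◁ biprod.fst ≫ P.actLeft := biprod.lift_fst _ _

theorem biprodActLeft_snd (P Q : Bimod M N) : biprodActLeft P Q ≫ biprod.snd =
    M.X ◁ biprod.snd ≫ Q.actLeft := biprod.lift_snd _ _

theorem biprodActRight_fst (P Q : Bimod M N) : biprodActRight P Q ≫ biprod.fst =
    biprod.fst ▷ N.X ≫ P.actRight := biprod.lift_fst _ _

theorem biprodActRight_snd (P Q : Bimod M N) : biprodActRight P Q ≫ biprod.snd =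
    biprod.snd ▷ N.X ≫ Q.actRight := biprod.lift_snd _ _

/-- The direct sum of two bimodules. -/
def biprodBimod (P Q : Bimod M N) : Bimod M N where
  X := P.X ⊞ Q.X
  actLeft := biprodActLeft P Q
  actRight := biprodActRight P Q
  one_actLeft := by
    apply biprod.hom_ext <;> simp [biprodActLeft, ← whisker_exchange_assoc]
  left_assoc := by
    apply biprod.hom_ext
    · simp [biprodActLeft_fst, ← whisker_exchange_assoc,
        reassoc_of% whiskerLeft_biprodActLeft_fst]
    · simp [biprodActLeft_snd, ← whisker_exchange_assoc,
        reassoc_of% whiskerLeft_biprodActLeft_snd]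
  actRight_one := by
    apply biprod.hom_ext <;> simp [biprodActRight, whisker_exchange_assoc]
  right_assoc := by
    apply biprod.hom_ext
    · simp [biprodActRight_fst, whisker_exchange_assoc,
        reassoc_of% biprodActRight_fst_whiskerRight]
    · simp [biprodActRight_snd, whisker_exchange_assoc,
        reassoc_of% biprodActRight_snd_whiskerRight]
  middle_assoc := by
    apply biprod.hom_ext
    · simp [biprodActRight_fst, biprodActLeft_fst, reassoc_of% biprodActLeft_fst_whiskerRight,
        reassoc_of% whiskerLeft_biprodActRight_fst]
    · simp [biprodActRight_snd, biprodActLeft_snd, reassoc_of% biprodActLeft_snd_whiskerRight,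
        reassoc_of% whiskerLeft_biprodActRight_snd]

variable [MonoidalPreadditive C]

/-- The biproduct data of the underlying objects consist of bimodule maps. For the injections this
uses that whiskering preserves zero maps. -/
theorem hasBinaryBiproduct_bimod (P Q : Bimod M N) : HasBinaryBiproduct P Q :=
  hasBinaryBiproduct_of_total
    { pt := biprodBimod P Q
      fst := { hom := (biprod.fst : P.X ⊞ Q.X ⟶ P.X)
               left_act_hom := by simp [biprodBimod, biprodActLeft]
               right_act_hom := by simp [biprodBimod, biprodActRight] }
      snd := { hom := (biprod.snd : P.X ⊞ Q.X ⟶ Q.X)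
               left_act_hom := by simp [biprodBimod, biprodActLeft]
               right_act_hom := by simp [biprodBimod, biprodActRight] }
      inl := { hom := (biprod.inl : P.X ⟶ P.X ⊞ Q.X)
               left_act_hom := by
                apply biprod.hom_ext <;> simp [biprodBimod, biprodActLeft, ← MonoidalCategory.whiskerLeft_comp_assoc]
               right_act_hom := by
                apply biprod.hom_ext <;> simp [biprodBimod, biprodActRight, ← comp_whiskerRight_assoc] }
      inr := { hom := (biprod.inr : Q.X ⟶ P.X ⊞ Q.X)
               left_act_hom := by
                apply biprod.hom_ext <;> simp [biprodBimod, biprodActLeft, ← MonoidalCategory.whiskerLeft_comp_assoc]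
               right_act_hom := by
                apply biprod.hom_ext <;> simp [biprodBimod, biprodActRight, ← comp_whiskerRight_assoc] }
      inl_fst := Bimod.hom_ext _ _ biprod.inl_fst
      inl_snd := Bimod.hom_ext _ _ biprod.inl_snd
      inr_fst := Bimod.hom_ext _ _ biprod.inr_fst
      inr_snd := Bimod.hom_ext _ _ biprod.inr_snd }
    (Bimod.hom_ext _ _ biprod.total)

theorem hasFiniteBiproducts_bimod [HasZeroObject C] : HasFiniteBiproducts (Bimod M N) := by
  have : HasBinaryBiproducts (Bimod M N) := ⟨hasBinaryBiproduct_bimod⟩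
  obtain ⟨Z, hZ⟩ := ‹HasZeroObject C›
  have : HasZeroObject (Bimod M N) := ⟨
    { X := Z
      actLeft := 0
      actRight := 0
      one_actLeft := hZ.eq_of_tgt _ _
      left_assoc := hZ.eq_of_tgt _ _
      actRight_one := hZ.eq_of_tgt _ _
      right_assoc := hZ.eq_of_tgt _ _
      middle_assoc := hZ.eq_of_tgt _ _ },
    fun P => ⟨⟨⟨0⟩, fun f => Bimod.hom_ext _ _ (hZ.eq_of_src _ _)⟩⟩,
    fun P => ⟨⟨⟨0⟩, fun f => Bimod.hom_ext _ _ (hZ.eq_of_tgt _ _)⟩⟩⟩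
  have : HasFiniteProducts (Bimod M N) := hasFiniteProducts_of_has_binary_and_terminal
  exact HasFiniteBiproducts.of_hasFiniteProducts

end Bim

instance {H R : Type u} [Ring H] [Ring R] (B : RightBialgebroid H R) :
    IsAdditiveBicategory (Bim B.RMod) where
  hasFiniteBiproducts M N :=
    have : HasBinaryBiproducts B.RMod :=
      inferInstanceAs (HasBinaryBiproducts (ModuleCat.{u} Hᵐᵒᵖ))
    have : HasZeroObject B.RMod := inferInstanceAs (HasZeroObject (ModuleCat.{u} Hᵐᵒᵖ))
    Bim.hasFiniteBiproducts_bimod (C := B.RMod) (M := M) (N := N)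

end Biproducts

/-! ### The monoid and the 1-morphism of a two-sided integral -/

section FrobeniusIntegrals

open RightBialgebroid RightBialgebroid.RMod

namespace Bim

open Bicategory

section

variable {H R : Type u} [Ring H] [Ring R] {B : RightBialgebroid H R}
variable {M N T : Bim B.RMod} {P : M ⟶ N} {Q : N ⟶ T}

/-- The linear map on the composite of two bimodules given by a balanced map. -/
def descTm {Z : B.RMod} (f : MonoidalCategoryStruct.tensorObj (El P) (El Q) ⟶ Z)
    (hf : ∀ p a q, lin f (pure (ract p a) q) = lin f (pure p (lact a q))) :
    El (P ≫ Q) →ₗ[Hᵐᵒᵖ] Z :=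
  lin (coequalizer.desc (C := B.RMod) f (hom_ext₃ hf) : El (P ≫ Q) ⟶ Z)

theorem descTm_tm {Z : B.RMod} (f : MonoidalCategoryStruct.tensorObj (El P) (El Q) ⟶ Z)
    (hf : ∀ p a q, lin f (pure (ract p a) q) = lin f (pure p (lact a q))) (p : El P) (q : El Q) :
    descTm f hf (tm p q) = lin f (pure p q) :=
  congrArg (fun g => lin g (pure p q)) (coequalizer.π_desc f (hom_ext₃ hf))

theorem lact_add (a : El (𝟙 M)) (p p' : El P) : lact a (p + p') = lact a p + lact a p' := by
  rw [← ap_leftUnitor, tm_add_right, map_add, ap_leftUnitor, ap_leftUnitor]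

theorem lact_zero (a : El (𝟙 M)) : lact a (0 : El P) = 0 := by
  simpa using lact_add a (0 : El P) 0

theorem add_ract (p p' : El P) (a : El (𝟙 N)) : ract (p + p') a = ract p a + ract p' a := by
  rw [← ap_rightUnitor, tm_add_left, map_add, ap_rightUnitor, ap_rightUnitor]

theorem zero_ract (a : El (𝟙 N)) : ract (0 : El P) a = 0 := by
  simpa using add_ract (0 : El P) 0 a

/-- Construct a 2-morphism on the composite of two bimodules. -/
def mkHomTm {V : M ⟶ T} (f : El (P ≫ Q) →ₗ[Hᵐᵒᵖ] El V)
    (hl : ∀ a p q, f (tm (lact a p) q) = lact a (f (tm p q)))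
    (hr : ∀ p q a, f (tm p (ract q a)) = ract (f (tm p q)) a) : P ≫ Q ⟶ V :=
  mkHom (P ≫ Q) V f
    (fun a x => by
      induction x using tm_induction with
      | h0 => rw [lact_zero, map_zero, lact_zero]
      | ht p q => rw [lact_tm, hl]
      | ha x y hx hy => rw [lact_add, map_add, map_add, lact_add, hx, hy])
    (fun x a => by
      induction x using tm_induction with
      | h0 => rw [zero_ract, map_zero, zero_ract]
      | ht p q => rw [ract_tm, hr]
      | ha x y hx hy => rw [add_ract, map_add, map_add, add_ract, hx, hy])

theorem lact_ev (a : El (𝟙 M)) (f : H → H → El P) (g : H) :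
    lact a (B.ev f g) = B.ev (fun x y => lact a (f x y)) g :=
  map_sum (AddMonoidHom.mk' (fun p : El P => lact a p) (lact_add a)) _ _

theorem ev_ract (f : H → H → El P) (g : H) (a : El (𝟙 N)) :
    ract (B.ev f g) a = B.ev (fun x y => ract (f x y) a) g :=
  map_sum (AddMonoidHom.mk' (fun p : El P => ract p a) fun p p' => add_ract p p' a) _ _

theorem tm_ev_left (f : H → H → El P) (q : El Q) (g : H) :
    tm (B.ev f g) q = B.ev (fun x y => tm (f x y) q) g :=
  map_sum (AddMonoidHom.mk' (fun p : El P => tm p q) fun p p' => tm_add_left p p' q) _ _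

theorem tm_ev_right (p : El P) (f : H → H → El Q) (g : H) :
    tm p (B.ev f g) = B.ev (fun x y => tm p (f x y)) g :=
  map_sum (AddMonoidHom.mk' (fun q : El Q => tm p q) fun q q' => tm_add_right p q q') _ _

theorem isBal_tm {f : H → El P} {g : H → El Q} (hf : ∀ x y, f (x + y) = f x + f y)
    (hf' : ∀ x r, f (x * B.s r) = op (B.s r) • f x) (hg : ∀ x y, g (x + y) = g x + g y)
    (hg' : ∀ x r, g (x * B.t (op r)) = op (B.t (op r)) • g x) :
    B.IsBal fun x y => tm (f x) (g y) :=
  ⟨fun x x' y => by rw [hf, tm_add_left], fun x y y' => by rw [hg, tm_add_right],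
    fun x r y => by rw [hf', hg', tm_smul_balance]⟩

end

end Bim

variable {H L R : Type u} [Ring H] [Ring L] [Ring R] {ℋ : HopfAlgebroid H L R}

/-- Two-sided integrals with a Frobenius form. -/
structure FrobeniusIntegral (ℋ : HopfAlgebroid H L R) where
  i : H
  p : H →+ L
  form : ℋ.IsFrobeniusForm i p
  left : ℋ.IsLeftIntegral i
  right : ℋ.IsRightIntegral i

namespace FrobeniusIntegral

variable (D : FrobeniusIntegral ℋ)

/-- The convolution product as a morphism of modules. -/
def mulHom : MonoidalCategoryStruct.tensorObj ℋ.right.regObj ℋ.right.regObj ⟶ ℋ.right.regObj :=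
  homMk (M := ℋ.right.regObj) (N := ℋ.right.regObj) (T := ℋ.right.regObj)
    (AddMonoidHom.mk' (fun a : H => AddMonoidHom.mk' (fun b : H => ℋ.star D.p a b)
      (D.form.star_add_right a)) (fun a a' => AddMonoidHom.ext fun b => D.form.star_add_left a a' b))
    (fun a r b => D.form.star_mul_sR a b r)
    (fun g a b => by
      rw [op_smul_pure, RightBialgebroid.map_ev]
      exact D.form.ev_star a b g)

/-- The unit of the convolution product as a morphism of modules. -/
def oneHom : MonoidalCategoryStruct.tensorUnit ℋ.right.RMod ⟶ ℋ.right.regObj :=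
  ofLin (N := ℋ.right.regObj) (show ℋ.right.UnitMod →ₗ[Hᵐᵒᵖ] H from
    { toFun := fun r => D.i * ℋ.right.s (ℋ.right.toUnit.symm r)
      map_add' := fun r r' => by rw [map_add, map_add, mul_add]
      map_smul' := fun g r => by
        change D.i * ℋ.right.s (ℋ.right.π (ℋ.right.s (ℋ.right.toUnit.symm r) * g.unop)) =
          D.i * ℋ.right.s (ℋ.right.toUnit.symm r) * g.unop
        -- Linearity of the unit is exactly the property of a right integral, i s_R(π_R(s_R(r)g)) =
        -- i s_R(r)g.
        rw [← D.right, mul_assoc] })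

/-- The monoid structure on `H_H`. -/
@[reducible] def mon : MonObj ℋ.right.regObj where
  one := D.oneHom
  mul := D.mulHom
  one_mul := hom_ext₂ fun r a => by
    obtain ⟨r, rfl⟩ := unitElt_surjective r
    exact (D.form.star_mul_sR D.i a r).trans (D.form.self_star _)
  mul_one := hom_ext₂ fun a r => by
    obtain ⟨r, rfl⟩ := unitElt_surjective r
    exact (D.form.star_mul_right_sR a D.i r).trans
      (congrArg (· * ℋ.right.s r) (D.form.star_self a))
  mul_assoc := hom_ext₃ fun a b c => D.form.star_assoc a b c

theorem isConvolution : ℋ.IsConvolution D.i D.mon where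
  mul φ ψ := (D.form.star_actLDual _ ψ).trans (LeftBialgebroid.actLDual_actLDual φ ψ D.i)
  one _ := rfl

/-- The trivial monoid. -/
abbrev U (_ : FrobeniusIntegral ℋ) : Bim ℋ.right.RMod := Bim.of (C := ℋ.right.RMod) (Mon.trivial _)

/-- The monoid `H_H`. -/
abbrev Q : Bim ℋ.right.RMod := Bim.of (C := ℋ.right.RMod) (ℋ.convMon D.mon)

/-- The 1-morphism `𝒳`. -/
abbrev X : D.U ⟶ D.Q := Bim.X (C := ℋ.right.RMod) (ℋ.convMon D.mon)

/-- The dual of the 1-morphism `𝒳`. -/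
abbrev XBar : D.Q ⟶ D.U := Bim.XBar (C := ℋ.right.RMod) (ℋ.convMon D.mon)

open Bicategory Bim

/-- An element of `H` as an element of `𝒳`. -/
def xe (a : H) : El D.X := ℋ.right.toReg a

/-- An element of `H` as an element of the dual of `𝒳`. -/
def xb (a : H) : El D.XBar := ℋ.right.toReg a

/-- An element of `H` as an element of the identity 1-morphism. -/
def qe (a : H) : El (𝟙 D.Q) := ℋ.right.toReg a

/-- An element of `R` as an element of the identity 1-morphism. -/
def ue (r : R) : El (𝟙 D.U) := unitElt r

theorem xe_surjective : Function.Surjective D.xe := fun x => ⟨x, rfl⟩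
theorem xb_surjective : Function.Surjective D.xb := fun x => ⟨x, rfl⟩
theorem qe_surjective : Function.Surjective D.qe := fun x => ⟨x, rfl⟩
theorem ue_surjective : Function.Surjective D.ue := fun x => ⟨x, rfl⟩

theorem xe_injective : Function.Injective D.xe := fun _ _ h => h
theorem xb_injective : Function.Injective D.xb := fun _ _ h => h

theorem xe_add (a b : H) : D.xe (a + b) = D.xe a + D.xe b := rfl
theorem xb_add (a b : H) : D.xb (a + b) = D.xb a + D.xb b := rfl
theorem smul_xe (a g : H) : op g • D.xe a = D.xe (a * g) := rfl
theorem smul_xb (a g : H) : op g • D.xb a = D.xb (a * g) := rfl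
theorem lact_xe (r : R) (a : H) : lact (D.ue r) (D.xe a) = D.xe (a * ℋ.right.t (op r)) := rfl
theorem ract_xe (a b : H) : ract (D.xe a) (D.qe b) = D.xe (ℋ.star D.p a b) := rfl
theorem lact_xb (a b : H) : lact (D.qe a) (D.xb b) = D.xb (ℋ.star D.p a b) := rfl
theorem ract_xb (a : H) (r : R) : ract (D.xb a) (D.ue r) = D.xb (a * ℋ.right.s r) := rfl
theorem lact_qe (a b : H) : lact (D.qe a) (D.qe b) = D.qe (ℋ.star D.p a b) := rfl
theorem ract_qe (a b : H) : ract (D.qe a) (D.qe b) = D.qe (ℋ.star D.p a b) := rfl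

theorem oneElt_Q : oneElt D.Q = D.qe D.i := by
  change D.i * ℋ.right.s 1 = D.i
  rw [map_one, mul_one]

theorem oneElt_U : oneElt D.U = D.ue 1 := rfl

end FrobeniusIntegral

end FrobeniusIntegrals

/-! ### The two-sided dual -/

section FrobeniusIntegralDual

open RightBialgebroid RightBialgebroid.RMod Bicategory Bim

variable {H L R : Type u} [Ring H] [Ring L] [Ring R] {ℋ : HopfAlgebroid H L R}

namespace FrobeniusIntegral

variable (D : FrobeniusIntegral ℋ)

/-- The canonical map on `𝒳 × 𝒳bar`. -/
def mLin : El (D.X ≫ D.XBar) →ₗ[Hᵐᵒᵖ] ℋ.right.regObj :=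
  lin (Bim.m (C := ℋ.right.RMod) (ℋ.convMon D.mon))

theorem mLin_tm (a b : H) : D.mLin (tm (D.xe a) (D.xb b)) = ℋ.right.toReg (ℋ.star D.p a b) :=
  congrArg (fun f => lin f (pure (D.xe a) (D.xb b))) (coequalizer.π_desc (C := ℋ.right.RMod) _ _)

/-- The element of `𝒳 × 𝒳bar` which corresponds to an element of `H`. -/
def xx (k : H) : El (D.X ≫ D.XBar) := tm (D.xe D.i) (D.xb k)

theorem mLin_xx (k : H) : D.mLin (D.xx k) = ℋ.right.toReg k :=
  (D.mLin_tm D.i k).trans (congrArg ℋ.right.toReg (D.form.self_star k))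

/-- Since a = i ∗ a, balance over the monoid gives a ⊗ b = i ⊗ (a ∗ b). Therefore `xx` parametrizes
the composite by H, and multiplication recovers the parameter. -/
theorem tm_xe_xb (a b : H) : tm (D.xe a) (D.xb b) = D.xx (ℋ.star D.p a b) := by
  rw [xx, ← lact_xb, ← tm_balance, ract_xe, D.form.self_star]

theorem xx_add (a b : H) : D.xx (a + b) = D.xx a + D.xx b := tm_add_right _ _ _

theorem xx_surjective : Function.Surjective D.xx := fun x => by
  induction x using tm_induction with
  | h0 => exact ⟨0, by simpa using D.xx_add 0 0⟩
  | ht a b => exact ⟨ℋ.star D.p a b, (D.tm_xe_xb a b).symm⟩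
  | ha x y hx hy =>
    obtain ⟨a, rfl⟩ := hx
    obtain ⟨b, rfl⟩ := hy
    exact ⟨a + b, D.xx_add a b⟩

theorem mLin_injective : Function.Injective D.mLin := fun x y h => by
  obtain ⟨a, rfl⟩ := D.xx_surjective x
  obtain ⟨b, rfl⟩ := D.xx_surjective y
  rw [mLin_xx, mLin_xx] at h
  exact congrArg D.xx h

theorem smul_xx (a g : H) : op g • D.xx a = D.xx (a * g) := by
  apply D.mLin_injective
  rw [map_smul, mLin_xx, mLin_xx]
  rfl

theorem lact_xx (r : R) (a : H) : lact (D.ue r) (D.xx a) = D.xx (a * ℋ.right.t (op r)) := by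
  rw [xx, lact_tm, lact_xe, tm_xe_xb, D.form.star_mul_tR, D.form.self_star]

theorem ract_xx (a : H) (r : R) : ract (D.xx a) (D.ue r) = D.xx (a * ℋ.right.s r) := by
  rw [xx, ract_tm, ract_xb, xx]

theorem ext_xx {V : D.U ⟶ D.U} {f g : D.X ≫ D.XBar ⟶ V}
    (h : ∀ k, ap f (D.xx k) = ap g (D.xx k)) : f = g :=
  ap_ext fun x => by
    obtain ⟨k, rfl⟩ := D.xx_surjective x
    exact h k

theorem ext_xe {V : D.U ⟶ D.Q} {f g : D.X ⟶ V} (h : ∀ k, ap f (D.xe k) = ap g (D.xe k)) :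
    f = g := ap_ext h

theorem ext_xb {V : D.Q ⟶ D.U} {f g : D.XBar ⟶ V} (h : ∀ k, ap f (D.xb k) = ap g (D.xb k)) :
    f = g := ap_ext h

theorem tm_qe {M : Bim ℋ.right.RMod} {P : M ⟶ D.Q} (p : El P) (a : H) :
    tm p (D.qe a) = tm (ract p (D.qe a)) (D.qe D.i) := by
  rw [tm_balance, lact_qe, D.form.star_self]

theorem qe_tm {M : Bim ℋ.right.RMod} {P : D.Q ⟶ M} (p : El P) (a : H) :
    tm (D.qe a) p = tm (D.qe D.i) (lact (D.qe a) p) := by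
  rw [← tm_balance, ract_qe, D.form.self_star]

theorem lact_ue (r r' : R) : lact (D.ue r) (D.ue r') = D.ue (r * r') :=
  ℋ.right.t_smul_toUnit r r'

theorem ract_ue (r r' : R) : ract (D.ue r) (D.ue r') = D.ue (r * r') :=
  ℋ.right.t_smul_toUnit r r'

theorem tm_ue {M : Bim ℋ.right.RMod} {P : M ⟶ D.U} (p : El P) (r : R) :
    tm p (D.ue r) = tm (ract p (D.ue r)) (D.ue 1) := by
  rw [tm_balance, lact_ue, mul_one]

theorem ue_tm {M : Bim ℋ.right.RMod} {P : D.U ⟶ M} (p : El P) (r : R) :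
    tm (D.ue r) p = tm (D.ue 1) (lact (D.ue r) p) := by
  rw [← tm_balance, ract_ue, one_mul]

/-- The linear map underlying `ev_L`. -/
def evLLin : El (D.XBar ≫ D.X) →ₗ[Hᵐᵒᵖ] El (𝟙 D.Q) :=
  descTm (P := D.XBar) (Q := D.X) (Z := El (𝟙 D.Q)) D.mulHom fun a r b => by
    obtain ⟨r, rfl⟩ := D.ue_surjective r
    exact D.form.star_mul_sR a b r

theorem evLLin_tm (a b : H) : D.evLLin (tm (D.xb a) (D.xe b)) = D.qe (ℋ.star D.p a b) :=
  (descTm_tm (P := D.XBar) (Q := D.X) (Z := El (𝟙 D.Q)) D.mulHom (fun a r b => by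
    obtain ⟨r, rfl⟩ := D.ue_surjective r
    exact D.form.star_mul_sR a b r) (D.xb a) (D.xe b) :)

/-- The 2-morphism `ev_L`. -/
def evL : D.XBar ≫ D.X ⟶ 𝟙 D.Q :=
  mkHomTm D.evLLin
    (fun c a b => by
      obtain ⟨a, rfl⟩ := D.xb_surjective a
      obtain ⟨b, rfl⟩ := D.xe_surjective b
      obtain ⟨c, rfl⟩ := D.qe_surjective c
      rw [lact_xb, evLLin_tm, evLLin_tm, lact_qe, D.form.star_assoc])
    (fun a b c => by
      obtain ⟨a, rfl⟩ := D.xb_surjective a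
      obtain ⟨b, rfl⟩ := D.xe_surjective b
      obtain ⟨c, rfl⟩ := D.qe_surjective c
      rw [ract_xe, evLLin_tm, evLLin_tm, ract_qe, D.form.star_assoc])

theorem ap_evL (a b : H) : ap D.evL (tm (D.xb a) (D.xe b)) = D.qe (ℋ.star D.p a b) :=
  D.evLLin_tm a b

/-- The 2-morphism `coev_L`. -/
def coevL : 𝟙 D.U ⟶ D.X ≫ D.XBar :=
  mkHom _ _
    (show ℋ.right.UnitMod →ₗ[Hᵐᵒᵖ] El (D.X ≫ D.XBar) from
    { toFun := fun r => D.xx (D.i * ℋ.right.s (ℋ.right.toUnit.symm r))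
      map_add' := fun r r' => by rw [map_add, map_add, mul_add, xx_add]
      map_smul' := fun g r => by
        change D.xx (D.i * ℋ.right.s (ℋ.right.π (ℋ.right.s (ℋ.right.toUnit.symm r) * g.unop))) =
          op g.unop • D.xx (D.i * ℋ.right.s (ℋ.right.toUnit.symm r))
        rw [← D.right, ← mul_assoc, smul_xx] })
    (fun r r' => by
      obtain ⟨r, rfl⟩ := D.ue_surjective r
      obtain ⟨r', rfl⟩ := D.ue_surjective r'
      rw [lact_ue]
      change D.xx (D.i * ℋ.right.s (r * r')) = lact (D.ue r) (D.xx (D.i * ℋ.right.s r'))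
      -- The action on the left multiplies by t_R(r) on the right. After commuting past s_R(r') it
      -- meets `i`, and the right integral converts it: i t_R(r) = i s_R(r).
      rw [lact_xx, mul_assoc, ℋ.right.s_comm_t, ← mul_assoc, D.right (ℋ.right.t (op r)),
        ℋ.right.π_t, map_mul, mul_assoc])
    (fun r r' => by
      obtain ⟨r, rfl⟩ := D.ue_surjective r
      obtain ⟨r', rfl⟩ := D.ue_surjective r'
      rw [ract_ue]
      change D.xx (D.i * ℋ.right.s (r * r')) = ract (D.xx (D.i * ℋ.right.s r)) (D.ue r')
      rw [ract_xx, map_mul, mul_assoc])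

theorem ap_coevL (r : R) : ap D.coevL (D.ue r) = D.xx (D.i * ℋ.right.s r) := rfl

theorem counit_mLin_xx (k : H) :
    (lin ℋ.right.counitHom ∘ₗ D.mLin) (D.xx k) = D.ue (ℋ.right.π k) := by
  rw [LinearMap.comp_apply, mLin_xx, lin_counitHom]
  rfl

/-- The 2-morphism `ev_R`. -/
def evR : D.X ≫ D.XBar ⟶ 𝟙 D.U :=
  mkHom _ _ (lin ℋ.right.counitHom ∘ₗ D.mLin)
    (fun r x => by
      obtain ⟨r, rfl⟩ := D.ue_surjective r
      obtain ⟨k, rfl⟩ := D.xx_surjective x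
      rw [lact_xx]
      refine (D.counit_mLin_xx _).trans ((congrArg (lact (D.ue r)) (D.counit_mLin_xx k)).trans ?_).symm
      rw [lact_ue, ℋ.right.π_left])
    (fun x r => by
      obtain ⟨r, rfl⟩ := D.ue_surjective r
      obtain ⟨k, rfl⟩ := D.xx_surjective x
      rw [ract_xx]
      refine (D.counit_mLin_xx _).trans ((congrArg (ract · (D.ue r)) (D.counit_mLin_xx k)).trans ?_).symm
      rw [ract_ue, ℋ.right.π_right])

theorem ap_evR (k : H) : ap D.evR (D.xx k) = D.ue (ℋ.right.π k) := D.counit_mLin_xx k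

theorem isBal_xb_xe : ℋ.right.IsBal fun x y => tm (D.xb x) (D.xe y) :=
  isBal_tm D.xb_add (fun _ _ => rfl) D.xe_add (fun _ _ => rfl)

theorem isBal_xb_xx : ℋ.right.IsBal fun x y => tm (D.xb x) (D.xx y) :=
  isBal_tm D.xb_add (fun _ _ => rfl) D.xx_add fun _ _ => (D.smul_xx _ _).symm

theorem isBal_xx_xe : ℋ.right.IsBal fun x y => tm (D.xx x) (D.xe y) :=
  isBal_tm D.xx_add (fun _ _ => (D.smul_xx _ _).symm) D.xe_add (fun _ _ => rfl)

/-- The linear map underlying `coev_R`. -/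
def coevRLin : El (𝟙 D.Q) →ₗ[Hᵐᵒᵖ] El (D.XBar ≫ D.X) :=
  lin (ℋ.right.fromReg (tm (D.xb 1) (D.xe 1)))

theorem coevRLin_qe (k : H) :
    D.coevRLin (D.qe k) = ℋ.right.ev (fun x y => tm (D.xb x) (D.xe y)) k := by
  refine (op_smul_tm (D.xb 1) (D.xe 1) k).trans ?_
  simp only [smul_xb, smul_xe, one_mul]

/-- The 2-morphism `coev_R`. -/
def coevR : 𝟙 D.Q ⟶ D.XBar ≫ D.X :=
  mkHom _ _ D.coevRLin
    (fun a k => by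
      obtain ⟨a, rfl⟩ := D.qe_surjective a
      obtain ⟨k, rfl⟩ := D.qe_surjective k
      rw [lact_qe, coevRLin_qe, coevRLin_qe, lact_ev, D.form.ev_star_right D.isBal_xb_xe]
      simp only [lact_tm, lact_xb])
    (fun k a => by
      obtain ⟨a, rfl⟩ := D.qe_surjective a
      obtain ⟨k, rfl⟩ := D.qe_surjective k
      rw [ract_qe, coevRLin_qe, coevRLin_qe, ev_ract, D.form.ev_star_left D.isBal_xb_xe]
      simp only [ract_tm, ract_xe])

theorem ap_coevR (k : H) :
    ap D.coevR (D.qe k) = ℋ.right.ev (fun x y => tm (D.xb x) (D.xe y)) k := D.coevRLin_qe k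

theorem xe_ev (f : H → H → H) (k : H) :
    D.xe (ℋ.right.ev f k) = ℋ.right.ev (fun x y => D.xe (f x y)) k :=
  map_sum (AddMonoidHom.mk' D.xe D.xe_add) _ _

theorem xb_ev (f : H → H → H) (k : H) :
    D.xb (ℋ.right.ev f k) = ℋ.right.ev (fun x y => D.xb (f x y)) k :=
  map_sum (AddMonoidHom.mk' D.xb D.xb_add) _ _

theorem xx_ev (f : H → H → H) (k : H) :
    D.xx (ℋ.right.ev f k) = ℋ.right.ev (fun x y => D.xx (f x y)) k :=
  map_sum (AddMonoidHom.mk' D.xx D.xx_add) _ _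

theorem isBal_xb_ue : ℋ.right.IsBal fun x y => tm (D.xb x) (D.ue (ℋ.right.π y)) := by
  simpa only [ap_whiskerLeft, ap_evR] using D.isBal_xb_xx.comp (ap (D.XBar ◁ D.evR))

/-- The second leg, an element of the base ring, is absorbed by the first as s_Rπ_R(k⁽²⁾), and the
counit axiom applies. -/
theorem ev_xb_ue (k : H) :
    ℋ.right.ev (fun x y => tm (D.xb x) (D.ue (ℋ.right.π y))) k = tm (D.xb k) (D.ue 1) := by
  have e : ∀ x y, tm (D.xb x) (D.ue (ℋ.right.π y)) =
      tm (D.xb (x * ℋ.right.s (ℋ.right.π y))) (D.ue 1) := fun x y => by rw [tm_ue, ract_xb]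
  simp only [e]
  rw [← tm_ev_left, ← xb_ev, ev_counit_right]

theorem isBal_ue_xe : ℋ.right.IsBal fun x y => tm (D.ue (ℋ.right.π x)) (D.xe y) := by
  simpa only [ap_whiskerRight, ap_evR] using D.isBal_xx_xe.comp (ap (D.evR ▷ D.X))

theorem ev_ue_xe (k : H) :
    ℋ.right.ev (fun x y => tm (D.ue (ℋ.right.π x)) (D.xe y)) k = tm (D.ue 1) (D.xe k) := by
  have e : ∀ x y, tm (D.ue (ℋ.right.π x)) (D.xe y) =
      tm (D.ue 1) (D.xe (y * ℋ.right.t (op (ℋ.right.π x)))) := fun x y => by rw [ue_tm, lact_xe]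
  simp only [e]
  rw [← tm_ev_right, ← xe_ev, ev_counit_left]

/-- The coherence isomorphisms hidden in the zigzag are made explicit, so that a triangle identity
can be evaluated on elements. -/
theorem leftZigzag_eq {C : Type u₁} [Bicategory.{w, v} C] {a b : C} {f : a ⟶ b} {g : b ⟶ a}
    (η : 𝟙 a ⟶ f ≫ g) (e : g ≫ f ⟶ 𝟙 b) :
    leftZigzag η e = η ▷ f ≫ (α_ f g f).hom ≫ f ◁ e := by
  simp [bicategoricalComp]

theorem rightZigzag_eq {C : Type u₁} [Bicategory.{w, v} C] {a b : C} {f : a ⟶ b} {g : b ⟶ a}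
    (η : 𝟙 a ⟶ f ≫ g) (e : g ≫ f ⟶ 𝟙 b) :
    rightZigzag η e = g ◁ η ≫ (α_ g f g).inv ≫ e ▷ g := by
  simp [bicategoricalComp]

/-- The two-sided dual of `𝒳`. -/
def frobeniusDual : FrobeniusDual D.X D.XBar where
  adjL :=
    { unit := D.coevL
      counit := D.evL
      left_triangle := ext_tm fun r a => by
        obtain ⟨r, rfl⟩ := D.ue_surjective r
        obtain ⟨a, rfl⟩ := D.xe_surjective a
        simp only [leftZigzag_eq, ap_comp, ap_whiskerRight, ap_coevL, xx, ap_associator,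
          ap_whiskerLeft, ap_evL, ap_leftUnitor, ap_rightUnitor_inv, lact_xe, oneElt_Q]
        -- On elements the first two triangle identities say that `i` is a left and a right unit for
        -- ∗.
        rw [tm_qe, ract_xe, D.form.star_mul_sR, D.form.self_star, D.form.self_star]
      right_triangle := ext_tm fun a r => by
        obtain ⟨r, rfl⟩ := D.ue_surjective r
        obtain ⟨a, rfl⟩ := D.xb_surjective a
        simp only [rightZigzag_eq, ap_comp, ap_whiskerRight, ap_coevL, xx, ap_associator_inv,
          ap_whiskerLeft, ap_evL, ap_leftUnitor_inv, ap_rightUnitor, ract_xb, oneElt_Q]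
        rw [qe_tm, lact_xb, D.form.star_mul_right_sR, D.form.star_self, D.form.star_self] }
  adjR :=
    { unit := D.coevR
      counit := D.evR
      left_triangle := ext_tm fun k a => by
        obtain ⟨k, rfl⟩ := D.qe_surjective k
        obtain ⟨a, rfl⟩ := D.xb_surjective a
        simp only [leftZigzag_eq, ap_comp, ap_whiskerRight, ap_coevR, tm_ev_left, map_ev,
          ap_associator, ap_whiskerLeft, tm_xe_xb, ap_evR, ap_leftUnitor, ap_rightUnitor_inv,
          lact_xb, oneElt_U]
        -- The other two triangle identities combine the two bimodule properties of γ_R with the two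
        -- counit axioms.
        rw [← D.form.ev_star_left D.isBal_xb_ue, ev_xb_ue]
      right_triangle := ext_tm fun a k => by
        obtain ⟨k, rfl⟩ := D.qe_surjective k
        obtain ⟨a, rfl⟩ := D.xe_surjective a
        simp only [rightZigzag_eq, ap_comp, ap_whiskerRight, ap_coevR, tm_ev_right, map_ev,
          ap_associator_inv, ap_whiskerLeft, tm_xe_xb, ap_evR, ap_rightUnitor, ap_leftUnitor_inv,
          ract_xe, oneElt_U]
        rw [← D.form.ev_star_right D.isBal_ue_xe, ev_ue_xe] }

theorem isCanonicalDual : IsCanonicalDual (C := ℋ.right.RMod) (ℋ.convMon D.mon)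
    ℋ.right.comulHom ℋ.right.counitHom D.frobeniusDual where
  evL := hom_ext₂ fun a b => D.ap_evL a b
  coevL := hom_ext <| LinearMap.ext fun r => by
    obtain ⟨r, rfl⟩ := unitElt_surjective r
    exact D.mLin_xx (D.i * ℋ.right.s r)
  evR := rfl
  coevR := hom_ext <| LinearMap.ext fun k => by
    exact ((lin (prj D.XBar D.X)).map_smul (op (show H from k))
      (pure (D.xb 1) (D.xe 1))).symm

end FrobeniusIntegral

end FrobeniusIntegralDual

/-! ### Transport of Hopf algebroids along isomorphisms of rings -/

section Transport

section Functoriality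

variable {R R' M N P T : Type*} [AddCommGroup M] [AddCommGroup N] [AddCommGroup P]
variable {R₂ R₂' M₂ N₂ P₂ : Type*} [AddCommGroup M₂] [AddCommGroup N₂] [AddCommGroup P₂]
variable {ρ : M → R → M} {l : R → N → N} {ρ' : N → R' → N} {l' : R' → P → P}
variable {ρ₂ : M₂ → R₂ → M₂} {l₂ : R₂ → N₂ → N₂} {ρ₂' : N₂ → R₂' → N₂} {l₂' : R₂' → P₂ → P₂}

/-- The map of tensor products over a ring induced by two additive maps. -/
def Bal.map (f : M →+ M₂) (g : N →+ N₂) (q : R → R₂) (hf : ∀ m r, f (ρ m r) = ρ₂ (f m) (q r))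
    (hg : ∀ r n, g (l r n) = l₂ (q r) (g n)) : Bal ρ l →+ Bal ρ₂ l₂ :=
  Bal.lift ((Bal.mk ρ₂ l₂).comp (tmap f g)) fun m r n => by
    simp only [AddMonoidHom.comp_apply, tmap_tmul, hf, hg, Bal.mk_balance]

theorem Bal.map_mk (f : M →+ M₂) (g : N →+ N₂) (q : R → R₂)
    (hf : ∀ m r, f (ρ m r) = ρ₂ (f m) (q r)) (hg : ∀ r n, g (l r n) = l₂ (q r) (g n))
    (w : M ⊗[ℤ] N) : Bal.map f g q hf hg (Bal.mk ρ l w) = Bal.mk ρ₂ l₂ (tmap f g w) := rfl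

/-- The map of triple tensor products induced by three additive maps. -/
def Bal3.map (f : M →+ M₂) (g : N →+ N₂) (k : P →+ P₂) (q : R → R₂) (q' : R' → R₂')
    (hf : ∀ m r, f (ρ m r) = ρ₂ (f m) (q r)) (hg : ∀ r n, g (l r n) = l₂ (q r) (g n))
    (hg' : ∀ n r, g (ρ' n r) = ρ₂' (g n) (q' r)) (hk : ∀ r n, k (l' r n) = l₂' (q' r) (k n)) :
    Bal3 ρ l ρ' l' →+ Bal3 ρ₂ l₂ ρ₂' l₂' :=
  Bal3.lift ((Bal3.mkL ρ₂ l₂ ρ₂' l₂').comp (tmap (Bal.map f g q hf hg) k)) fun m n r p => by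
    simp only [AddMonoidHom.comp_apply, tmap_tmul, Bal.map_mk, hg', hk, Bal3.mkL_balance]

theorem tmap_tmap {M' N' M'' N'' : Type*} [AddCommGroup M'] [AddCommGroup N'] [AddCommGroup M'']
    [AddCommGroup N''] (f' : M' →+ M'') (g' : N' →+ N'') (f : M →+ M') (g : N →+ N')
    (w : M ⊗[ℤ] N) : tmap f' g' (tmap f g w) = tmap (f'.comp f) (g'.comp g) w := by
  change ((tmap f' g').comp (tmap f g)) w = _
  congr 1
  exact tensor_hom_ext fun _ _ => rfl

theorem Bal3.map_mkL (f : M →+ M₂) (g : N →+ N₂) (k : P →+ P₂) (q : R → R₂) (q' : R' → R₂')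
    (hf : ∀ m r, f (ρ m r) = ρ₂ (f m) (q r)) (hg : ∀ r n, g (l r n) = l₂ (q r) (g n))
    (hg' : ∀ n r, g (ρ' n r) = ρ₂' (g n) (q' r)) (hk : ∀ r n, k (l' r n) = l₂' (q' r) (k n))
    (w : Bal ρ l ⊗[ℤ] P) : Bal3.map f g k q q' hf hg hg' hk (Bal3.mkL ρ l ρ' l' w) =
      Bal3.mkL ρ₂ l₂ ρ₂' l₂' (tmap (Bal.map f g q hf hg) k w) := rfl

theorem Bal3.map_mkR (f : M →+ M₂) (g : N →+ N₂) (k : P →+ P₂) (q : R → R₂) (q' : R' → R₂')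
    (hf : ∀ m r, f (ρ m r) = ρ₂ (f m) (q r)) (hg : ∀ r n, g (l r n) = l₂ (q r) (g n))
    (hg' : ∀ n r, g (ρ' n r) = ρ₂' (g n) (q' r)) (hk : ∀ r n, k (l' r n) = l₂' (q' r) (k n))
    (w : M ⊗[ℤ] Bal ρ' l') : Bal3.map f g k q q' hf hg hg' hk (Bal3.mkR ρ l ρ' l' w) =
      Bal3.mkR ρ₂ l₂ ρ₂' l₂' (tmap f (Bal.map g k q' hg' hk) w) := by
  change ((Bal3.map f g k q q' hf hg hg' hk).comp (Bal3.mkR ρ l ρ' l')) w =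
    ((Bal3.mkR ρ₂ l₂ ρ₂' l₂').comp (tmap f (Bal.map g k q' hg' hk))) w
  congr 1
  refine tensor_hom_ext fun m x => ?_
  obtain ⟨x, rfl⟩ := Bal.mk_surjective x
  induction x with
  | zero => simp
  | tmul n p => rfl
  | add x y hx hy => simp only [map_add, TensorProduct.tmul_add, hx, hy]

end Functoriality

variable {A L R A' L' R' : Type*} [Ring A] [Ring L] [Ring R] [Ring A'] [Ring L'] [Ring R']

theorem tmap_mul (Φ : A →+* A') (w w' : A ⊗[ℤ] A) :
    tmap Φ.toAddMonoidHom Φ.toAddMonoidHom (w * w') =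
      tmap Φ.toAddMonoidHom Φ.toAddMonoidHom w * tmap Φ.toAddMonoidHom Φ.toAddMonoidHom w' := by
  induction w with
  | zero => simp
  | add x y hx hy => simp only [add_mul, map_add, hx, hy]
  | tmul a b =>
    induction w' with
    | zero => simp
    | add x y hx hy => simp only [mul_add, map_add, hx, hy]
    | tmul c d => simp [Algebra.TensorProduct.tmul_mul_tmul]

theorem tmap_congr {M N M' N' : Type*} [AddCommGroup M] [AddCommGroup N] [AddCommGroup M']
    [AddCommGroup N'] {f f' : M →+ M'} {g g' : N →+ N'} (hf : ∀ x, f x = f' x)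
    (hg : ∀ x, g x = g' x) (w : M ⊗[ℤ] N) : tmap f g w = tmap f' g' w := by
  rw [AddMonoidHom.ext hf, AddMonoidHom.ext hg]

theorem mulMap_congr {M N : Type*} [AddCommGroup M] [AddCommGroup N] {f f' : M →+ A}
    {g g' : N →+ A} (hf : ∀ x, f x = f' x) (hg : ∀ x, g x = g' x) (w : M ⊗[ℤ] N) :
    mulMap f g w = mulMap f' g' w := by
  rw [AddMonoidHom.ext hf, AddMonoidHom.ext hg]

theorem mulMapSwap_congr {M N : Type*} [AddCommGroup M] [AddCommGroup N] {f f' : M →+ A}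
    {g g' : N →+ A} (hf : ∀ x, f x = f' x) (hg : ∀ x, g x = g' x) (w : M ⊗[ℤ] N) :
    mulMapSwap f g w = mulMapSwap f' g' w := by
  rw [AddMonoidHom.ext hf, AddMonoidHom.ext hg]

/-- The additive map underlying a ring isomorphism. -/
abbrev toAdd (Φ : A ≃+* A') : A →+ A' := (Φ : A →+* A').toAddMonoidHom

theorem tmap_symm (Φ : A ≃+* A') (w : A' ⊗[ℤ] A') :
    tmap (toAdd Φ) (toAdd Φ) (tmap (toAdd Φ.symm) (toAdd Φ.symm) w) = w := by
  rw [tmap_tmap]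
  have : (toAdd Φ).comp (toAdd Φ.symm) = .id A' := AddMonoidHom.ext fun a => Φ.apply_symm_apply a
  rw [this]
  exact DFunLike.congr_fun (tensor_hom_ext (f := tmap (.id A') (.id A')) (g := .id _)
    fun _ _ => rfl) w

theorem mulMap_tmap {M N M' N' : Type*} [AddCommGroup M] [AddCommGroup N] [AddCommGroup M']
    [AddCommGroup N'] (f : M' →+ A) (g : N' →+ A) (a : M →+ M') (b : N →+ N') (w : M ⊗[ℤ] N) :
    mulMap f g (tmap a b w) = mulMap (f.comp a) (g.comp b) w :=
  DFunLike.congr_fun (tensor_hom_ext (f := (mulMap f g).comp (tmap a b))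
    (g := mulMap (f.comp a) (g.comp b)) fun _ _ => rfl) w

theorem mulMapSwap_tmap {M N M' N' : Type*} [AddCommGroup M] [AddCommGroup N] [AddCommGroup M']
    [AddCommGroup N'] (f : M' →+ A) (g : N' →+ A) (a : M →+ M') (b : N →+ N') (w : M ⊗[ℤ] N) :
    mulMapSwap f g (tmap a b w) = mulMapSwap (f.comp a) (g.comp b) w :=
  DFunLike.congr_fun (tensor_hom_ext (f := (mulMapSwap f g).comp (tmap a b))
    (g := mulMapSwap (f.comp a) (g.comp b)) fun _ _ => rfl) w

theorem map_mulMap {M N : Type*} [AddCommGroup M] [AddCommGroup N] (Φ : A ≃+* A') (f : M →+ A)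
    (g : N →+ A) (w : M ⊗[ℤ] N) :
    Φ (mulMap f g w) = mulMap ((toAdd Φ).comp f) ((toAdd Φ).comp g) w :=
  DFunLike.congr_fun (tensor_hom_ext (f := (toAdd Φ).comp (mulMap f g))
    (g := mulMap ((toAdd Φ).comp f) ((toAdd Φ).comp g)) fun m n => map_mul Φ (f m) (g n)) w

theorem map_mulMapSwap {M N : Type*} [AddCommGroup M] [AddCommGroup N] (Φ : A ≃+* A')
    (f : M →+ A) (g : N →+ A) (w : M ⊗[ℤ] N) :
    Φ (mulMapSwap f g w) = mulMapSwap ((toAdd Φ).comp f) ((toAdd Φ).comp g) w :=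
  DFunLike.congr_fun (tensor_hom_ext (f := (toAdd Φ).comp (mulMapSwap f g))
    (g := mulMapSwap ((toAdd Φ).comp f) ((toAdd Φ).comp g)) fun m n => map_mul Φ (g n) (f m)) w

namespace LeftBialgebroid

variable (B : LeftBialgebroid A L) (Φ : A ≃+* A') (φ : L ≃+* L')

/-- The source map of the transported bialgebroid. -/
def transportS : L' →+* A' := (Φ : A →+* A').comp (B.s.comp φ.symm)

/-- The target map of the transported bialgebroid. -/
def transportT : L'ᵐᵒᵖ →+* A' := (Φ : A →+* A').comp (B.t.comp (RingEquiv.op φ.symm : L'ᵐᵒᵖ →+* Lᵐᵒᵖ))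

theorem transportS_apply (l : L) : B.transportS Φ φ (φ l) = Φ (B.s l) := by simp [transportS]

theorem transportT_apply (l : L) : B.transportT Φ φ (op (φ l)) = Φ (B.t (op l)) := by
  simp [transportT]

/-- The transport of the tensor product. -/
def transportTensor : LTensor B.s B.t →+ LTensor (B.transportS Φ φ) (B.transportT Φ φ) :=
  Bal.map (toAdd Φ) (toAdd Φ) φ
    (fun a l => by simp [transportT]) (fun l a => by simp [transportS])

theorem transportTensor_mk (w : A ⊗[ℤ] A) : B.transportTensor Φ φ (Bal.mk _ _ w) =
    Bal.mk _ _ (tmap (toAdd Φ) (toAdd Φ) w) := rfl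

/-- The inverse transport of the tensor product. -/
def transportTensorSymm : LTensor (B.transportS Φ φ) (B.transportT Φ φ) →+ LTensor B.s B.t :=
  Bal.map (toAdd Φ.symm) (toAdd Φ.symm) φ.symm
    (fun a l => by simp [transportT]) (fun l a => by simp [transportS])

theorem transportTensorSymm_transportTensor (x : LTensor B.s B.t) :
    B.transportTensorSymm Φ φ (B.transportTensor Φ φ x) = x := by
  obtain ⟨w, rfl⟩ := Bal.mk_surjective x
  exact congrArg (Bal.mk _ _) (tmap_symm Φ.symm w)

/-- The axioms quantify over all representatives of a coproduct. Each representative for the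
transported structure is the image of one for the original structure, which reduces every axiom to
the original one. -/
theorem exists_rep_of_transport {a : A} {w : A' ⊗[ℤ] A'}
    (hw : (Bal.mk _ _ w : LTensor (B.transportS Φ φ) (B.transportT Φ φ)) =
      B.transportTensor Φ φ (B.γ a)) :
    ∃ w₀ : A ⊗[ℤ] A, Bal.mk _ _ w₀ = B.γ a ∧ w = tmap (toAdd Φ) (toAdd Φ) w₀ :=
  ⟨tmap (toAdd Φ.symm) (toAdd Φ.symm) w, by
    rw [← B.transportTensorSymm_transportTensor Φ φ (B.γ a), ← hw]; rfl, (tmap_symm Φ w).symm⟩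

/-- The coproduct of the transported bialgebroid. -/
def transportγ : A' →+ LTensor (B.transportS Φ φ) (B.transportT Φ φ) :=
  (B.transportTensor Φ φ).comp (B.γ.comp (toAdd Φ.symm))

theorem transportγ_apply (a : A) :
    B.transportγ Φ φ (Φ a) = B.transportTensor Φ φ (B.γ a) := by simp [transportγ]

theorem transportγ_comp :
    (B.transportγ Φ φ).comp (toAdd Φ) = (B.transportTensor Φ φ).comp B.γ :=
  AddMonoidHom.ext (B.transportγ_apply Φ φ)

/-- The transport of a left bialgebroid along isomorphisms of the rings. -/
def transport : LeftBialgebroid A' L' where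
  s := B.transportS Φ φ
  t := B.transportT Φ φ
  s_comm_t l l' := by
    obtain ⟨l, rfl⟩ := φ.surjective l
    obtain ⟨l', rfl⟩ := φ.surjective l'
    rw [transportS_apply, transportT_apply, ← map_mul, B.s_comm_t, map_mul]
  γ := B.transportγ Φ φ
  π := (toAdd φ).comp (B.π.comp (toAdd Φ.symm))
  γ_left l a w hw := by
    obtain ⟨l, rfl⟩ := φ.surjective l
    obtain ⟨a, rfl⟩ := Φ.surjective a
    rw [transportγ_apply] at hw
    obtain ⟨w, hw₀, rfl⟩ := B.exists_rep_of_transport Φ φ hw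
    rw [transportS_apply, ← map_mul, transportγ_apply, B.γ_left l a w hw₀, transportTensor_mk,
      tmap_tmap, tmap_tmap]
    exact congrArg _ (tmap_congr (by simp) (by simp) w)
  γ_right l a w hw := by
    obtain ⟨l, rfl⟩ := φ.surjective l
    obtain ⟨a, rfl⟩ := Φ.surjective a
    rw [transportγ_apply] at hw
    obtain ⟨w, hw₀, rfl⟩ := B.exists_rep_of_transport Φ φ hw
    rw [transportT_apply, ← map_mul, transportγ_apply, B.γ_right l a w hw₀, transportTensor_mk,
      tmap_tmap, tmap_tmap]
    exact congrArg _ (tmap_congr (by simp) (by simp) w)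
  π_left l a := by
    obtain ⟨l, rfl⟩ := φ.surjective l
    obtain ⟨a, rfl⟩ := Φ.surjective a
    simp [transportS_apply, ← map_mul, B.π_left]
  π_right l a := by
    obtain ⟨l, rfl⟩ := φ.surjective l
    obtain ⟨a, rfl⟩ := Φ.surjective a
    simp [transportT_apply, ← map_mul, B.π_right]
  coassoc a w hw := by
    obtain ⟨a, rfl⟩ := Φ.surjective a
    rw [transportγ_apply] at hw
    obtain ⟨w, hw₀, rfl⟩ := B.exists_rep_of_transport Φ φ hw
    have e := congrArg (Bal3.map (toAdd Φ) (toAdd Φ) (toAdd Φ) φ φ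
      (fun a l => by simp [transportT]) (fun l a => by simp [transportS])
      (fun a l => by simp [transportT]) (fun l a => by simp [transportS]) :
        LTensor3 B.s B.t →+ LTensor3 (B.transportS Φ φ) (B.transportT Φ φ)) (B.coassoc a w hw₀)
    rw [Bal3.map_mkL, Bal3.map_mkR, tmap_tmap, tmap_tmap] at e
    rw [tmap_tmap, tmap_tmap, transportγ_comp]
    exact e
  counit_left a w hw := by
    obtain ⟨a, rfl⟩ := Φ.surjective a
    rw [transportγ_apply] at hw
    obtain ⟨w, hw₀, rfl⟩ := B.exists_rep_of_transport Φ φ hw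
    rw [← B.counit_left a w hw₀, map_mulMap, mulMap_tmap]
    exact mulMap_congr (by simp [transportS]) (by simp) w
  counit_right a w hw := by
    obtain ⟨a, rfl⟩ := Φ.surjective a
    rw [transportγ_apply] at hw
    obtain ⟨w, hw₀, rfl⟩ := B.exists_rep_of_transport Φ φ hw
    rw [← B.counit_right a w hw₀, map_mulMapSwap, mulMapSwap_tmap]
    exact mulMapSwap_congr (by simp) (by simp [transportT]) w
  takeuchi l a w hw := by
    obtain ⟨l, rfl⟩ := φ.surjective l
    obtain ⟨a, rfl⟩ := Φ.surjective a
    rw [transportγ_apply] at hw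
    obtain ⟨w, hw₀, rfl⟩ := B.exists_rep_of_transport Φ φ hw
    have e := congrArg (B.transportTensor Φ φ) (B.takeuchi l a w hw₀)
    rw [transportTensor_mk, transportTensor_mk, tmap_tmap, tmap_tmap] at e
    rw [transportS_apply, transportT_apply, tmap_tmap, tmap_tmap]
    refine (congrArg _ (tmap_congr ?_ ?_ w)).trans (e.trans (congrArg _ (tmap_congr ?_ ?_ w))) <;>
      simp
  γ_one := by
    rw [← map_one Φ, transportγ_apply, B.γ_one]
    rfl
  γ_mul a b w w' hw hw' := by
    obtain ⟨a, rfl⟩ := Φ.surjective a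
    obtain ⟨b, rfl⟩ := Φ.surjective b
    rw [transportγ_apply] at hw hw'
    obtain ⟨w, hw₀, rfl⟩ := B.exists_rep_of_transport Φ φ hw
    obtain ⟨w', hw₀', rfl⟩ := B.exists_rep_of_transport Φ φ hw'
    rw [← map_mul, transportγ_apply, B.γ_mul a b w w' hw₀ hw₀', transportTensor_mk, tmap_mul]
  π_one := by simp [B.π_one]
  π_mul_s a b := by
    obtain ⟨a, rfl⟩ := Φ.surjective a
    obtain ⟨b, rfl⟩ := Φ.surjective b
    simp [transportS_apply, ← map_mul, B.π_mul_s]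
  π_mul_t a b := by
    obtain ⟨a, rfl⟩ := Φ.surjective a
    obtain ⟨b, rfl⟩ := Φ.surjective b
    simp [transportT_apply, ← map_mul, B.π_mul_t]

theorem transport_π (a : A) : (B.transport Φ φ).π (Φ a) = φ (B.π a) :=
  congrArg (fun a => φ (B.π a)) (Φ.symm_apply_apply a)

theorem transport_s_π (a : A) :
    (B.transport Φ φ).s ((B.transport Φ φ).π (Φ a)) = Φ (B.s (B.π a)) :=
  (congrArg (B.transport Φ φ).s (B.transport_π Φ φ a)).trans (B.transportS_apply Φ φ (B.π a))

end LeftBialgebroid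

namespace RightBialgebroid

variable (B : RightBialgebroid A R) (Φ : A ≃+* A') (ψ : R ≃+* R')

/-- The source map of the transported bialgebroid. -/
def transportS : R' →+* A' := (Φ : A →+* A').comp (B.s.comp ψ.symm)

/-- The target map of the transported bialgebroid. -/
def transportT : R'ᵐᵒᵖ →+* A' := (Φ : A →+* A').comp (B.t.comp (RingEquiv.op ψ.symm : R'ᵐᵒᵖ →+* Rᵐᵒᵖ))

theorem transportS_apply (r : R) : B.transportS Φ ψ (ψ r) = Φ (B.s r) := by simp [transportS]

theorem transportT_apply (r : R) : B.transportT Φ ψ (op (ψ r)) = Φ (B.t (op r)) := by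
  simp [transportT]

/-- The transport of the tensor product. -/
def transportTensor : RTensor B.s B.t →+ RTensor (B.transportS Φ ψ) (B.transportT Φ ψ) :=
  Bal.map (toAdd Φ) (toAdd Φ) ψ
    (fun a r => by simp [transportS]) (fun r a => by simp [transportT])

theorem transportTensor_mk (w : A ⊗[ℤ] A) : B.transportTensor Φ ψ (Bal.mk _ _ w) =
    Bal.mk _ _ (tmap (toAdd Φ) (toAdd Φ) w) := rfl

/-- The inverse transport of the tensor product. -/
def transportTensorSymm : RTensor (B.transportS Φ ψ) (B.transportT Φ ψ) →+ RTensor B.s B.t :=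
  Bal.map (toAdd Φ.symm) (toAdd Φ.symm) ψ.symm
    (fun a r => by simp [transportS]) (fun r a => by simp [transportT])

theorem transportTensorSymm_transportTensor (x : RTensor B.s B.t) :
    B.transportTensorSymm Φ ψ (B.transportTensor Φ ψ x) = x := by
  obtain ⟨w, rfl⟩ := Bal.mk_surjective x
  exact congrArg (Bal.mk _ _) (tmap_symm Φ.symm w)

theorem exists_rep_of_transport {a : A} {w : A' ⊗[ℤ] A'}
    (hw : (Bal.mk _ _ w : RTensor (B.transportS Φ ψ) (B.transportT Φ ψ)) =
      B.transportTensor Φ ψ (B.γ a)) :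
    ∃ w₀ : A ⊗[ℤ] A, Bal.mk _ _ w₀ = B.γ a ∧ w = tmap (toAdd Φ) (toAdd Φ) w₀ :=
  ⟨tmap (toAdd Φ.symm) (toAdd Φ.symm) w, by
    rw [← B.transportTensorSymm_transportTensor Φ ψ (B.γ a), ← hw]; rfl, (tmap_symm Φ w).symm⟩

/-- The coproduct of the transported bialgebroid. -/
def transportγ : A' →+ RTensor (B.transportS Φ ψ) (B.transportT Φ ψ) :=
  (B.transportTensor Φ ψ).comp (B.γ.comp (toAdd Φ.symm))

theorem transportγ_apply (a : A) :
    B.transportγ Φ ψ (Φ a) = B.transportTensor Φ ψ (B.γ a) := by simp [transportγ]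

theorem transportγ_comp :
    (B.transportγ Φ ψ).comp (toAdd Φ) = (B.transportTensor Φ ψ).comp B.γ :=
  AddMonoidHom.ext (B.transportγ_apply Φ ψ)

/-- The transport of a right bialgebroid along isomorphisms of the rings. -/
def transport : RightBialgebroid A' R' where
  s := B.transportS Φ ψ
  t := B.transportT Φ ψ
  s_comm_t r r' := by
    obtain ⟨r, rfl⟩ := ψ.surjective r
    obtain ⟨r', rfl⟩ := ψ.surjective r'
    rw [transportS_apply, transportT_apply, ← map_mul, B.s_comm_t, map_mul]
  γ := B.transportγ Φ ψ
  π := (toAdd ψ).comp (B.π.comp (toAdd Φ.symm))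
  γ_left r a w hw := by
    obtain ⟨r, rfl⟩ := ψ.surjective r
    obtain ⟨a, rfl⟩ := Φ.surjective a
    rw [transportγ_apply] at hw
    obtain ⟨w, hw₀, rfl⟩ := B.exists_rep_of_transport Φ ψ hw
    rw [transportT_apply, ← map_mul, transportγ_apply, B.γ_left r a w hw₀, transportTensor_mk,
      tmap_tmap, tmap_tmap]
    exact congrArg _ (tmap_congr (by simp) (by simp) w)
  γ_right r a w hw := by
    obtain ⟨r, rfl⟩ := ψ.surjective r
    obtain ⟨a, rfl⟩ := Φ.surjective a
    rw [transportγ_apply] at hw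
    obtain ⟨w, hw₀, rfl⟩ := B.exists_rep_of_transport Φ ψ hw
    rw [transportS_apply, ← map_mul, transportγ_apply, B.γ_right r a w hw₀, transportTensor_mk,
      tmap_tmap, tmap_tmap]
    exact congrArg _ (tmap_congr (by simp) (by simp) w)
  π_left r a := by
    obtain ⟨r, rfl⟩ := ψ.surjective r
    obtain ⟨a, rfl⟩ := Φ.surjective a
    simp [transportT_apply, ← map_mul, B.π_left]
  π_right r a := by
    obtain ⟨r, rfl⟩ := ψ.surjective r
    obtain ⟨a, rfl⟩ := Φ.surjective a
    simp [transportS_apply, ← map_mul, B.π_right]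
  coassoc a w hw := by
    obtain ⟨a, rfl⟩ := Φ.surjective a
    rw [transportγ_apply] at hw
    obtain ⟨w, hw₀, rfl⟩ := B.exists_rep_of_transport Φ ψ hw
    have e := congrArg (Bal3.map (toAdd Φ) (toAdd Φ) (toAdd Φ) ψ ψ
      (fun a r => by simp [transportS]) (fun r a => by simp [transportT])
      (fun a r => by simp [transportS]) (fun r a => by simp [transportT]) :
        RTensor3 B.s B.t →+ RTensor3 (B.transportS Φ ψ) (B.transportT Φ ψ)) (B.coassoc a w hw₀)
    rw [Bal3.map_mkL, Bal3.map_mkR, tmap_tmap, tmap_tmap] at e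
    rw [tmap_tmap, tmap_tmap, transportγ_comp]
    exact e
  counit_left a w hw := by
    obtain ⟨a, rfl⟩ := Φ.surjective a
    rw [transportγ_apply] at hw
    obtain ⟨w, hw₀, rfl⟩ := B.exists_rep_of_transport Φ ψ hw
    rw [← B.counit_left a w hw₀, map_mulMapSwap, mulMapSwap_tmap]
    exact mulMapSwap_congr (by simp [transportT]) (by simp) w
  counit_right a w hw := by
    obtain ⟨a, rfl⟩ := Φ.surjective a
    rw [transportγ_apply] at hw
    obtain ⟨w, hw₀, rfl⟩ := B.exists_rep_of_transport Φ ψ hw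
    rw [← B.counit_right a w hw₀, map_mulMap, mulMap_tmap]
    exact mulMap_congr (by simp) (by simp [transportS]) w
  takeuchi r a w hw := by
    obtain ⟨r, rfl⟩ := ψ.surjective r
    obtain ⟨a, rfl⟩ := Φ.surjective a
    rw [transportγ_apply] at hw
    obtain ⟨w, hw₀, rfl⟩ := B.exists_rep_of_transport Φ ψ hw
    have e := congrArg (B.transportTensor Φ ψ) (B.takeuchi r a w hw₀)
    rw [transportTensor_mk, transportTensor_mk, tmap_tmap, tmap_tmap] at e
    rw [transportS_apply, transportT_apply, tmap_tmap, tmap_tmap]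
    refine (congrArg _ (tmap_congr ?_ ?_ w)).trans (e.trans (congrArg _ (tmap_congr ?_ ?_ w))) <;>
      simp
  γ_one := by
    rw [← map_one Φ, transportγ_apply, B.γ_one]
    rfl
  γ_mul a b w w' hw hw' := by
    obtain ⟨a, rfl⟩ := Φ.surjective a
    obtain ⟨b, rfl⟩ := Φ.surjective b
    rw [transportγ_apply] at hw hw'
    obtain ⟨w, hw₀, rfl⟩ := B.exists_rep_of_transport Φ ψ hw
    obtain ⟨w', hw₀', rfl⟩ := B.exists_rep_of_transport Φ ψ hw'
    rw [← map_mul, transportγ_apply, B.γ_mul a b w w' hw₀ hw₀', transportTensor_mk, tmap_mul]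
  π_one := by simp [B.π_one]
  π_s_mul a b := by
    obtain ⟨a, rfl⟩ := Φ.surjective a
    obtain ⟨b, rfl⟩ := Φ.surjective b
    simp [transportS_apply, ← map_mul, B.π_s_mul]
  π_t_mul a b := by
    obtain ⟨a, rfl⟩ := Φ.surjective a
    obtain ⟨b, rfl⟩ := Φ.surjective b
    simp [transportT_apply, ← map_mul, B.π_t_mul]

theorem transport_π (a : A) : (B.transport Φ ψ).π (Φ a) = ψ (B.π a) :=
  congrArg (fun a => ψ (B.π a)) (Φ.symm_apply_apply a)

theorem transport_s_π (a : A) :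
    (B.transport Φ ψ).s ((B.transport Φ ψ).π (Φ a)) = Φ (B.s (B.π a)) :=
  (congrArg (B.transport Φ ψ).s (B.transport_π Φ ψ a)).trans (B.transportS_apply Φ ψ (B.π a))

end RightBialgebroid

namespace HopfAlgebroid

variable (ℋ : HopfAlgebroid A L R) (Φ : A ≃+* A') (φ : L ≃+* L') (ψ : R ≃+* R')

theorem mem_range_transport {K K' : Type*} [Ring K] [Ring K'] (s : K →+* A) (χ : K' ≃+* K)
    (a : A) : Φ a ∈ ((Φ : A →+* A').comp (s.comp (χ : K' →+* K))).range ↔ a ∈ s.range := by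
  constructor
  · rintro ⟨k, hk⟩
    exact ⟨χ k, Φ.injective hk⟩
  · rintro ⟨k, rfl⟩
    exact ⟨χ.symm k, by simp⟩

/-- The antipode of the transported Hopf algebroid. -/
def transportAntipode : A' ≃+ A' := Φ.symm.toAddEquiv.trans (ℋ.S.trans Φ.toAddEquiv)

theorem transportAntipode_apply (a : A) : ℋ.transportAntipode Φ (Φ a) = Φ (ℋ.S a) := by
  simp [transportAntipode]

theorem transport_antipode_left (a : A') (w : A' ⊗[ℤ] A')
    (hw : Bal.mk _ _ w = (ℋ.left.transport Φ φ).γ a) :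
    mulMap (ℋ.transportAntipode Φ).toAddMonoidHom (.id A') w =
      (ℋ.right.transport Φ ψ).s ((ℋ.right.transport Φ ψ).π a) := by
  obtain ⟨a, rfl⟩ := Φ.surjective a
  obtain ⟨w, hw₀, rfl⟩ := ℋ.left.exists_rep_of_transport Φ φ
    (hw.trans (ℋ.left.transportγ_apply Φ φ a))
  rw [mulMap_tmap, RightBialgebroid.transport_s_π, ← ℋ.antipode_left a w hw₀, map_mulMap]
  exact mulMap_congr (ℋ.transportAntipode_apply Φ) (fun _ => rfl) w

theorem transport_antipode_right (a : A') (w : A' ⊗[ℤ] A')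
    (hw : Bal.mk _ _ w = (ℋ.right.transport Φ ψ).γ a) :
    mulMap (.id A') (ℋ.transportAntipode Φ).toAddMonoidHom w =
      (ℋ.left.transport Φ φ).s ((ℋ.left.transport Φ φ).π a) := by
  obtain ⟨a, rfl⟩ := Φ.surjective a
  obtain ⟨w, hw₀, rfl⟩ := ℋ.right.exists_rep_of_transport Φ ψ
    (hw.trans (ℋ.right.transportγ_apply Φ ψ a))
  rw [mulMap_tmap, LeftBialgebroid.transport_s_π, ← ℋ.antipode_right a w hw₀, map_mulMap]
  exact mulMap_congr (fun _ => rfl) (ℋ.transportAntipode_apply Φ) w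

/-- The transport of a Hopf algebroid along isomorphisms of the rings. -/
def transport : HopfAlgebroid A' L' R' where
  left := ℋ.left.transport Φ φ
  right := ℋ.right.transport Φ ψ
  base := ⟨ψ.symm.trans (ℋ.base.some.trans (RingEquiv.op φ))⟩
  range_sL := by
    ext a
    obtain ⟨a, rfl⟩ := Φ.surjective a
    refine (mem_range_transport Φ ℋ.left.s φ.symm a).trans ?_
    rw [ℋ.range_sL]
    exact (mem_range_transport Φ ℋ.right.t (RingEquiv.op ψ.symm) a).symm
  range_tL := by
    ext a
    obtain ⟨a, rfl⟩ := Φ.surjective a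
    refine (mem_range_transport Φ ℋ.left.t (RingEquiv.op φ.symm) a).trans ?_
    rw [ℋ.range_tL]
    exact (mem_range_transport Φ ℋ.right.s ψ.symm a).symm
  coassoc_left_right a w w' hw hw' := by
    obtain ⟨a, rfl⟩ := Φ.surjective a
    obtain ⟨w, hw₀, rfl⟩ := ℋ.right.exists_rep_of_transport Φ ψ
      (hw.trans (ℋ.right.transportγ_apply Φ ψ a))
    obtain ⟨w', hw₀', rfl⟩ := ℋ.left.exists_rep_of_transport Φ φ
      (hw'.trans (ℋ.left.transportγ_apply Φ φ a))
    have e := congrArg (Bal3.map (toAdd Φ) (toAdd Φ) (toAdd Φ) φ ψ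
      (fun a l => by simp [LeftBialgebroid.transportT])
      (fun l a => by simp [LeftBialgebroid.transportS])
      (fun a l => by simp [RightBialgebroid.transportS])
      (fun l a => by simp [RightBialgebroid.transportT]) :
        LRTensor3 ℋ.left.s ℋ.left.t ℋ.right.s ℋ.right.t →+
          LRTensor3 (ℋ.left.transportS Φ φ) (ℋ.left.transportT Φ φ) (ℋ.right.transportS Φ ψ)
            (ℋ.right.transportT Φ ψ)) (ℋ.coassoc_left_right a w w' hw₀ hw₀')
    rw [Bal3.map_mkL, Bal3.map_mkR, tmap_tmap, tmap_tmap] at e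
    rw [tmap_tmap, tmap_tmap]
    refine (congrArg _ (tmap_congr (ℋ.left.transportγ_apply Φ φ) (fun _ => rfl) w)).trans
      (e.trans (congrArg _ (tmap_congr (fun _ => rfl) (fun x => ?_) w')))
    exact (ℋ.right.transportγ_apply Φ ψ x).symm
  coassoc_right_left a w w' hw hw' := by
    obtain ⟨a, rfl⟩ := Φ.surjective a
    obtain ⟨w, hw₀, rfl⟩ := ℋ.left.exists_rep_of_transport Φ φ
      (hw.trans (ℋ.left.transportγ_apply Φ φ a))
    obtain ⟨w', hw₀', rfl⟩ := ℋ.right.exists_rep_of_transport Φ ψ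
      (hw'.trans (ℋ.right.transportγ_apply Φ ψ a))
    have e := congrArg (Bal3.map (toAdd Φ) (toAdd Φ) (toAdd Φ) ψ φ
      (fun a l => by simp [RightBialgebroid.transportS])
      (fun l a => by simp [RightBialgebroid.transportT])
      (fun a l => by simp [LeftBialgebroid.transportT])
      (fun l a => by simp [LeftBialgebroid.transportS]) :
        RLTensor3 ℋ.left.s ℋ.left.t ℋ.right.s ℋ.right.t →+
          RLTensor3 (ℋ.left.transportS Φ φ) (ℋ.left.transportT Φ φ) (ℋ.right.transportS Φ ψ)
            (ℋ.right.transportT Φ ψ)) (ℋ.coassoc_right_left a w w' hw₀ hw₀')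
    rw [Bal3.map_mkL, Bal3.map_mkR, tmap_tmap, tmap_tmap] at e
    rw [tmap_tmap, tmap_tmap]
    refine (congrArg _ (tmap_congr (ℋ.right.transportγ_apply Φ ψ) (fun _ => rfl) w)).trans
      (e.trans (congrArg _ (tmap_congr (fun _ => rfl) (fun x => ?_) w')))
    exact (ℋ.left.transportγ_apply Φ φ x).symm
  S := ℋ.transportAntipode Φ
  S_left l l' a := by
    obtain ⟨l, rfl⟩ := φ.surjective l
    obtain ⟨l', rfl⟩ := φ.surjective l'
    obtain ⟨a, rfl⟩ := Φ.surjective a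
    change ℋ.transportAntipode Φ (ℋ.left.transportT Φ φ (op (φ l)) * Φ a *
      ℋ.left.transportT Φ φ (op (φ l'))) = ℋ.left.transportS Φ φ (φ l') *
        ℋ.transportAntipode Φ (Φ a) * ℋ.left.transportS Φ φ (φ l)
    simp only [LeftBialgebroid.transportT_apply, LeftBialgebroid.transportS_apply, ← map_mul,
      transportAntipode_apply, ℋ.S_left]
  S_right r r' a := by
    obtain ⟨r, rfl⟩ := ψ.surjective r
    obtain ⟨r', rfl⟩ := ψ.surjective r'
    obtain ⟨a, rfl⟩ := Φ.surjective a
    change ℋ.transportAntipode Φ (ℋ.right.transportT Φ ψ (op (ψ r')) * Φ a *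
      ℋ.right.transportT Φ ψ (op (ψ r))) = ℋ.right.transportS Φ ψ (ψ r) *
        ℋ.transportAntipode Φ (Φ a) * ℋ.right.transportS Φ ψ (ψ r')
    simp only [RightBialgebroid.transportT_apply, RightBialgebroid.transportS_apply, ← map_mul,
      transportAntipode_apply, ℋ.S_right]
  antipode_left a w hw := ℋ.transport_antipode_left Φ φ ψ a w hw
  antipode_right a w hw := ℋ.transport_antipode_right Φ φ ψ a w hw

theorem isStrictIso_transport : ℋ.IsStrictIso (ℋ.transport Φ φ ψ) Φ φ where
  isHom :=
    { s := ℋ.left.transportS_apply Φ φ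
      t := ℋ.left.transportT_apply Φ φ
      π := ℋ.left.transport_π Φ φ
      γ := fun a w hw => (ℋ.left.transportγ_apply Φ φ a).trans (by rw [← hw]; rfl) }
  antipode a := (ℋ.transportAntipode_apply Φ a).symm

end HopfAlgebroid

end Transport

/-! ### Identification of the symmetry with the given Hopf algebroid -/

section FrobeniusIntegralSymmetry

open RightBialgebroid RightBialgebroid.RMod Bicategory Bim

variable {H L R : Type u} [Ring H] [Ring L] [Ring R] {ℋ : HopfAlgebroid H L R}

namespace FrobeniusIntegral

variable (D : FrobeniusIntegral ℋ)

/-- Left multiplication by an element of `H` on `𝒳 × 𝒳bar`. -/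
def xxHom (h : H) : D.X ≫ D.XBar ⟶ D.X ≫ D.XBar :=
  mkHom _ _ (lin (ℋ.right.fromReg (D.xx h)) ∘ₗ D.mLin)
    (fun r x => by
      obtain ⟨r, rfl⟩ := D.ue_surjective r
      obtain ⟨k, rfl⟩ := D.xx_surjective x
      rw [lact_xx, LinearMap.comp_apply, LinearMap.comp_apply, mLin_xx, mLin_xx]
      change op (k * _) • D.xx h = lact _ (op k • D.xx h)
      rw [smul_xx, smul_xx, lact_xx, mul_assoc])
    (fun x r => by
      obtain ⟨r, rfl⟩ := D.ue_surjective r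
      obtain ⟨k, rfl⟩ := D.xx_surjective x
      rw [ract_xx, LinearMap.comp_apply, LinearMap.comp_apply, mLin_xx, mLin_xx]
      change op (k * _) • D.xx h = ract (op k • D.xx h) _
      rw [smul_xx, smul_xx, ract_xx, mul_assoc])

theorem ap_xxHom (h k : H) : ap (D.xxHom h) (D.xx k) = D.xx (h * k) := by
  refine (congrArg (lin (ℋ.right.fromReg (D.xx h))) (D.mLin_xx k)).trans ?_
  exact D.smul_xx h k

/-- Left multiplication by an element of the left base ring on `𝒳`. -/
def xeHom (l : L) : D.X ⟶ D.X :=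
  mkHom _ _ (lin (ℋ.right.fromReg (D.xe (ℋ.left.s l))))
    (fun r x => by
      obtain ⟨r, rfl⟩ := D.ue_surjective r
      obtain ⟨k, rfl⟩ := D.xe_surjective x
      exact congrArg D.xe (mul_assoc _ _ _).symm)
    (fun x b => by
      obtain ⟨b, rfl⟩ := D.qe_surjective b
      obtain ⟨k, rfl⟩ := D.xe_surjective x
      exact congrArg D.xe (D.form.sL_mul_star l k b).symm)

theorem ap_xeHom (l : L) (k : H) : ap (D.xeHom l) (D.xe k) = D.xe (ℋ.left.s l * k) := rfl

/-- Left multiplication by an element of the right base ring on the dual of `𝒳`. -/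
def xbHom (r : R) : D.XBar ⟶ D.XBar :=
  mkHom _ _ (lin (ℋ.right.fromReg (D.xb (ℋ.right.s r))))
    (fun b x => by
      obtain ⟨b, rfl⟩ := D.qe_surjective b
      obtain ⟨k, rfl⟩ := D.xb_surjective x
      obtain ⟨l, hl⟩ := ℋ.exists_sR_eq_tL r
      rw [hl]
      exact congrArg D.xb (D.form.star_tL_mul l b k).symm)
    (fun x r' => by
      obtain ⟨r', rfl⟩ := D.ue_surjective r'
      obtain ⟨k, rfl⟩ := D.xb_surjective x
      exact congrArg D.xb (mul_assoc _ _ _).symm)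

theorem ap_xbHom (r : R) (k : H) : ap (D.xbHom r) (D.xb k) = D.xb (ℋ.right.s r * k) := rfl

/-- `H` is the ring of endomorphisms of `𝒳 × 𝒳bar`. -/
def totalEquiv : H ≃+* End (D.X ≫ D.XBar) where
  toFun := D.xxHom
  invFun f := D.mLin (ap f (D.xx 1))
  left_inv h := by
    refine (congrArg D.mLin (D.ap_xxHom h 1)).trans ((D.mLin_xx (h * 1)).trans ?_)
    exact mul_one h
  right_inv f := D.ext_xx fun k => by
    obtain ⟨h, e⟩ := D.xx_surjective (ap f (D.xx 1))
    -- As an H-module the composite is free on `xx 1`, so an endomorphism is left multiplication by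
    -- its value there.
    have e' : ap f (D.xx k) = D.xx (h * k) := by
      rw [← smul_xx, e, ← map_smul, smul_xx, one_mul]
    refine (D.ap_xxHom _ k).trans (Eq.trans ?_ e'.symm)
    exact congrArg (fun z : H => D.xx (z * k)) ((congrArg D.mLin e.symm).trans (D.mLin_xx h))
  map_mul' h h' := D.ext_xx fun k => by
    rw [ap_xxHom, End.mul_def, ap_comp, ap_xxHom, ap_xxHom, mul_assoc]
  map_add' h h' := D.ext_xx fun k => by
    rw [ap_xxHom, add_mul, xx_add, ← ap_xxHom, ← ap_xxHom]
    rfl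

theorem ap_totalEquiv (h k : H) : ap (D.totalEquiv h) (D.xx k) = D.xx (h * k) := D.ap_xxHom h k

/-- The left base ring is the ring of endomorphisms of `𝒳`. -/
def leftBaseEquiv : L ≃+* End D.X where
  toFun := D.xeHom
  invFun f := ℋ.left.π (show H from ap f (D.xe 1))
  left_inv l := (congrArg ℋ.left.π (mul_one _)).trans (ℋ.left.π_s l)
  right_inv f := D.ext_xe fun k => by
    obtain ⟨h, e⟩ := D.xe_surjective (ap f (D.xe 1))
    have e' : ∀ k, ap f (D.xe k) = D.xe (h * k) := fun k => by
      rw [← smul_xe, e, ← map_smul, smul_xe, one_mul]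
    -- Linearity over the monoid forces h into s_L(L): f(1) = f(i ∗ 1) = (hi) ∗ 1 = s_L(p(hi)), and
    -- p(hi) = π_L(h) for the left integral `i`.
    have e1 : D.xe h = D.xe (ℋ.left.s (ℋ.left.π h)) := by
      rw [e]
      conv_lhs => rw [← D.form.self_star 1, ← ract_xe, ap_ract, e', ract_xe, D.form.star_one,
        D.left, D.form.s_mul, D.form.apply_self, mul_one]
    refine Eq.trans ?_ (e' k).symm
    exact congrArg (fun z : H => D.xe (z * k))
      ((congrArg (fun z : H => ℋ.left.s (ℋ.left.π z)) e.symm).trans (D.xe_injective e1).symm)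
  map_mul' h h' := D.ext_xe fun k => by
    rw [ap_xeHom, End.mul_def, ap_comp, ap_xeHom, ap_xeHom, map_mul, mul_assoc]
  map_add' h h' := D.ext_xe fun k => by
    rw [ap_xeHom, map_add, add_mul, xe_add, ← ap_xeHom, ← ap_xeHom]
    rfl

theorem ap_leftBaseEquiv (l : L) (k : H) :
    ap (D.leftBaseEquiv l) (D.xe k) = D.xe (ℋ.left.s l * k) := rfl

/-- The right base ring is the ring of endomorphisms of the dual of `𝒳`. -/
def rightBaseEquiv : R ≃+* End D.XBar where
  toFun := D.xbHom
  invFun f := ℋ.right.π (show H from ap f (D.xb 1))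
  left_inv r := (congrArg ℋ.right.π (mul_one _)).trans (ℋ.right.π_s r)
  right_inv f := D.ext_xb fun k => by
    obtain ⟨h, e⟩ := D.xb_surjective (ap f (D.xb 1))
    have e' : ∀ k, ap f (D.xb k) = D.xb (h * k) := fun k => by
      rw [← smul_xb, e, ← map_smul, smul_xb, one_mul]
    -- Here f(1) = f(1 ∗ i) = 1 ∗ (hi) = 1 ∗ (s_Lπ_L(h)i), which is t_Lπ_L(h) by `star_sL_mul_self`;
    -- and t_L(L) = s_R(R).
    have e1 : D.xb h = D.xb (ℋ.left.t (op (ℋ.left.π h))) := by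
      rw [e]
      conv_lhs => rw [← D.form.star_self 1, ← lact_xb, ap_lact, e', lact_xb, D.left,
        D.form.star_sL_mul_self D.left, mul_one]
    have e2 : ℋ.right.s (ℋ.right.π h) = h := by
      obtain ⟨r, hr⟩ := ℋ.exists_tL_eq_sR (ℋ.left.π h)
      rw [D.xb_injective e1, hr, ℋ.right.π_s]
    refine Eq.trans ?_ (e' k).symm
    exact congrArg (fun z : H => D.xb (z * k))
      ((congrArg (fun z : H => ℋ.right.s (ℋ.right.π z)) e.symm).trans e2)
  map_mul' h h' := D.ext_xb fun k => by
    rw [ap_xbHom, End.mul_def, ap_comp, ap_xbHom, ap_xbHom, map_mul, mul_assoc]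
  map_add' h h' := D.ext_xb fun k => by
    rw [ap_xbHom, map_add, add_mul, xb_add, ← ap_xbHom, ← ap_xbHom]
    rfl

theorem ap_rightBaseEquiv (r : R) (k : H) :
    ap (D.rightBaseEquiv r) (D.xb k) = D.xb (ℋ.right.s r * k) := rfl

theorem frobeniusDual_evL : D.frobeniusDual.adjL.counit = D.evL := rfl
theorem frobeniusDual_coevL : D.frobeniusDual.adjL.unit = D.coevL := rfl
theorem frobeniusDual_evR : D.frobeniusDual.adjR.counit = D.evR := rfl
theorem frobeniusDual_coevR : D.frobeniusDual.adjR.unit = D.coevR := rfl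

/-- The composite of ev_R and coev_L sends `k` to i s_Rπ_R(k), which is `ik` for a right integral.
-/
theorem integral_eq : D.frobeniusDual.integral = D.totalEquiv D.i := D.ext_xx fun k => by
  simp only [FrobeniusDual.integral, frobeniusDual_evR, frobeniusDual_coevL, ap_comp, ap_evR,
    ap_coevL, ap_totalEquiv]
  rw [D.right k]

theorem ap_whiskerRight_xx {P : D.U ⟶ D.Q} (f : D.X ⟶ P) (k : H) :
    ap (f ▷ D.XBar) (D.xx k) = tm (ap f (D.xe D.i)) (D.xb k) := ap_whiskerRight _ _ _ _

theorem ap_whiskerLeft_xx {P : D.Q ⟶ D.U} (f : D.XBar ⟶ P) (k : H) :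
    ap (D.X ◁ f) (D.xx k) = tm (D.xe D.i) (ap f (D.xb k)) := ap_whiskerLeft _ _ _ _

theorem ap_associator_xx {M : Bim ℋ.right.RMod} {W : D.U ⟶ M} (k : H) (w : El W) :
    ap (α_ D.X D.XBar W).hom (tm (D.xx k) w) = tm (D.xe D.i) (tm (D.xb k) w) :=
  ap_associator _ _ _ _ _ _

theorem ap_associator_inv_xx {M : Bim ℋ.right.RMod} {W : M ⟶ D.U} (w : El W) (k : H) :
    ap (α_ W D.X D.XBar).inv (tm w (D.xx k)) = tm (tm w (D.xe D.i)) (D.xb k) :=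
  ap_associator_inv _ _ _ _ _ _

theorem self_star_apply (k : H) : ℋ.star D.p D.i k = k := D.form.self_star k

theorem star_self_apply (k : H) : ℋ.star D.p k D.i = k := D.form.star_self k

/-- The coevaluation yields k ∗ i⁽¹⁾ ⊗ i⁽²⁾, that is, the coproduct of `k`. This and the next three
lemmas evaluate the pieces from which the structure maps of the symmetry are composed. -/
theorem ap_coev_xe (k : H) :
    ap (α_ D.X D.XBar D.X).inv (ap (D.X ◁ D.coevR) (ap (ρ_ D.X).inv (D.xe k))) =
      ℋ.right.ev (fun x y => tm (D.xx x) (D.xe y)) k := by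
  simp only [ap_rightUnitor_inv, oneElt_Q, ap_whiskerLeft, ap_coevR, tm_ev_right, map_ev,
    ap_associator_inv, tm_xe_xb]
  exact D.form.ev_self_right D.isBal_xx_xe k

theorem ap_ev_xx_xe (a b : H) :
    ap (ρ_ D.X).hom (ap (D.X ◁ D.evL) (ap (α_ D.X D.XBar D.X).hom (tm (D.xx a) (D.xe b)))) =
      D.xe (ℋ.star D.p a b) := by
  simp only [ap_associator_xx, ap_whiskerLeft, ap_evL, ap_rightUnitor, ract_xe, self_star_apply]

theorem ap_coev_xb (k : H) :
    ap (α_ D.XBar D.X D.XBar).hom (ap (D.coevR ▷ D.XBar) (ap (λ_ D.XBar).inv (D.xb k))) =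
      ℋ.right.ev (fun x y => tm (D.xb x) (D.xx y)) k := by
  simp only [ap_leftUnitor_inv, oneElt_Q, ap_whiskerRight, ap_coevR, tm_ev_left, map_ev,
    ap_associator, tm_xe_xb]
  exact D.form.ev_self_left D.isBal_xb_xx k

theorem ap_ev_xb_xx (a b : H) :
    ap (λ_ D.XBar).hom (ap (D.evL ▷ D.XBar) (ap (α_ D.XBar D.X D.XBar).inv
      (tm (D.xb a) (D.xx b)))) = D.xb (ℋ.star D.p a b) := by
  simp only [ap_associator_inv_xx, ap_whiskerRight, ap_evL, ap_leftUnitor, lact_xb,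
    star_self_apply]

/-- On elements φ_L sends `k` to ck⁽¹⁾ ∗ k⁽²⁾ = (c ∗ 1)k = s_L(p(c))k: the Frobenius map is the
Frobenius form. -/
theorem phiL_totalEquiv (c : H) :
    D.frobeniusDual.phiL (D.totalEquiv c) = D.leftBaseEquiv (D.p c) := D.ext_xe fun k => by
  simp only [FrobeniusDual.phiL, frobeniusDual_evL, frobeniusDual_coevR, ap_comp, ap_coev_xe,
    map_ev, ap_whiskerRight, ap_totalEquiv, ap_ev_xx_xe, ap_leftBaseEquiv, ← xe_ev]
  rw [← D.form.star_one, ← D.form.ev_star]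
  simp only [one_mul]

/-- On `k` the left side becomes ai⁽¹⁾ ∗ b(i⁽²⁾ ∗ k) = ak⁽¹⁾ ∗ bk⁽²⁾, which is (a ∗ b)k by
H-linearity of ∗. -/
theorem conv_totalEquiv (a b : H) : D.frobeniusDual.conv (D.totalEquiv a) (D.totalEquiv b) =
    D.totalEquiv (ℋ.star D.p a b) := D.ext_xx fun k => by
  simp only [FrobeniusDual.conv, frobeniusDual_evL, frobeniusDual_coevR, ap_comp,
    ap_whiskerRight_xx, ap_whiskerRight, ap_coev_xe, tm_ev_left, map_ev, ap_associator, tm_xe_xb,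
    ap_totalEquiv, ap_whiskerLeft, ap_associator_inv_xx, ap_ev_xx_xe, star_self_apply, ← xx_ev]
  rw [D.form.ev_self_left (RightBialgebroid.isBal_mul_mul D.form.isBal_star a b), D.form.ev_star]

theorem mu_leftBaseEquiv (l : L) (k : H) :
    ap (D.frobeniusDual.mu (D.leftBaseEquiv l)) (D.xb k) = D.xb (ℋ.left.t (op l) * k) := by
  simp only [FrobeniusDual.mu, frobeniusDual_evL, frobeniusDual_coevL, ap_comp,
    ap_rightUnitor_inv, oneElt_U, ap_whiskerLeft, ap_whiskerRight, ap_coevL, map_one, mul_one,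
    ap_associator_inv_xx, ap_leftBaseEquiv, ap_evL, ap_leftUnitor, lact_xb, star_self_apply]
  rw [D.form.star_sL_mul_self D.left]

/-- The left side sends `k` to k⁽¹⁾s_Rπ_R(s_L(l)k⁽²⁾). As s_L(l) lies in t_R(R), the Takeuchi
condition moves it in front of the first leg, where it becomes a value of s_R. -/
theorem nu_leftBaseEquiv (l : L) :
    D.frobeniusDual.nu (D.leftBaseEquiv l) = D.rightBaseEquiv (ℋ.baseEquiv.symm l) :=
  D.ext_xb fun k => by
  simp only [FrobeniusDual.nu, frobeniusDual_evR, frobeniusDual_coevR, ap_comp, ap_coev_xb, map_ev,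
    ap_whiskerLeft, ap_whiskerRight_xx, ap_leftBaseEquiv, tm_xe_xb, D.form.sL_mul_star,
    self_star_apply, ap_evR, ap_rightUnitor, ract_xb, ap_rightBaseEquiv, ← xb_ev]
  rw [← HopfAlgebroid.tR_baseEquiv_symm,
    ← ev_takeuchi HopfAlgebroid.IsFrobeniusForm.isBal_mul_sR_π]
  simp only [mul_assoc]
  rw [← mul_ev, ev_counit_right]

theorem fourier_totalEquiv (c a b : H) :
    ap (D.frobeniusDual.fourier (D.totalEquiv c)) (tm (D.xb a) (D.xe b)) =
      ℋ.right.ev (fun x y => tm (D.xb x) (D.xe (ℋ.star D.p (c * y) b))) a := by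
  have hb : ℋ.right.IsBal fun x y => tm (D.xb x) (D.xe (ℋ.star D.p (c * y) b)) :=
    isBal_tm D.xb_add (fun _ _ => rfl)
      (fun x y => by rw [mul_add, D.form.star_add_left, xe_add])
      (fun x r => by rw [← mul_assoc, D.form.star_mul_tR, smul_xe])
  simp only [FrobeniusDual.fourier, frobeniusDual_evL, frobeniusDual_coevR, ap_comp,
    ap_leftUnitor_inv, oneElt_Q, ap_whiskerRight, ap_coevR, tm_ev_left, map_ev, ap_associator_inv,
    ap_associator, tm_xe_xb, ap_whiskerLeft, ap_totalEquiv, ap_associator_inv_xx, ap_evL,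
    ap_rightUnitor, ract_tm, ract_xe, self_star_apply]
  exact D.form.ev_self_left hb a

/-- Tracing `k` through the two transforms yields i⁽¹⁾s_Rπ_R(ci⁽²⁾ ∗ k), which `ev_mul_sR_π_star`
identifies with S(c)k. -/
theorem fourierDotInv_fourier_totalEquiv (c : H) :
    D.frobeniusDual.fourierDotInv (D.frobeniusDual.fourier (D.totalEquiv c)) =
      D.totalEquiv (ℋ.S c) := D.ext_xx fun k => by
  simp only [FrobeniusDual.fourierDotInv, frobeniusDual_evR, frobeniusDual_coevL, ap_comp,
    ap_leftUnitor_inv, oneElt_U, ap_whiskerRight, ap_coevL, map_one, mul_one,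
    ap_associator_inv_xx, ap_associator_xx, ap_whiskerLeft, fourier_totalEquiv, tm_ev_left,
    tm_ev_right, map_ev, ap_associator_inv, ap_associator, tm_xe_xb, star_self_apply,
    self_star_apply, ap_evR, ap_rightUnitor, ract_xx, ap_totalEquiv, ← xx_ev]
  rw [D.form.ev_mul_sR_π_star D.left]

theorem leftBaseEquiv_whiskerRight (l : L) :
    (D.leftBaseEquiv l : D.X ⟶ D.X) ▷ D.XBar = D.totalEquiv (ℋ.left.s l) := D.ext_xx fun k => by
  rw [ap_whiskerRight_xx, ap_leftBaseEquiv, tm_xe_xb, D.form.sL_mul_star, self_star_apply,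
    ap_totalEquiv]

theorem whiskerLeft_rightBaseEquiv (r : R) :
    D.X ◁ (D.rightBaseEquiv r : D.XBar ⟶ D.XBar) = D.totalEquiv (ℋ.right.s r) :=
  D.ext_xx fun k => by
  rw [ap_whiskerLeft_xx, ap_rightBaseEquiv, tm_xe_xb, self_star_apply, ap_totalEquiv]

theorem whiskerLeft_mu (l : L) :
    D.X ◁ (D.frobeniusDual.mu (D.leftBaseEquiv l) : D.XBar ⟶ D.XBar) =
      D.totalEquiv (ℋ.left.t (op l)) := D.ext_xx fun k => by
  rw [ap_whiskerLeft_xx, mu_leftBaseEquiv, tm_xe_xb, self_star_apply, ap_totalEquiv]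

theorem ap_quasiBasis (x y a b : H) :
    ap ((D.totalEquiv y : D.X ≫ D.XBar ⟶ D.X ≫ D.XBar) ▷ D.X) (ap (α_ D.X D.XBar D.X).inv
      (ap (D.X ◁ D.coevR) (ap (D.X ◁ D.evL) (ap (α_ D.X D.XBar D.X).hom
        (ap ((D.totalEquiv x : D.X ≫ D.XBar ⟶ D.X ≫ D.XBar) ▷ D.X)
          (tm (D.xx a) (D.xe b))))))) =
      ℋ.right.ev (fun u v => tm (D.xx (y * u)) (D.xe v)) (ℋ.star D.p (x * a) b) := by
  simp only [ap_whiskerRight, ap_totalEquiv, ap_associator_xx, ap_whiskerLeft, ap_evL, ap_coevR,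
    tm_ev_right, map_ev, ap_associator_inv, tm_xe_xb, self_star_apply]

/-- Evaluate the quasi-basis identity at 1 ⊗ i: ∑ y_k x_k⁽¹⁾ ⊗ x_k⁽²⁾ = 1 ⊗ i. Multiplying the first
leg by `a` and then applying ∗ gives ∑ (ay_k ∗ 1)x_k = a ∗ i. Only this consequence is needed for
the formulas of both coproducts. -/
theorem sum_of_isQuasiBasis {n : ℕ} {y x : Fin n → H}
    (h : D.frobeniusDual.IsQuasiBasis (fun k => D.totalEquiv (y k)) fun k => D.totalEquiv (x k))
    (a : H) : ∑ k, ℋ.left.s (D.p (a * y k)) * x k = a := by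
  have e := congrArg (fun f => ap f (tm (D.xx 1) (D.xe D.i))) h
  simp only [ap_sum_apply, ap_comp, frobeniusDual_evL, frobeniusDual_coevR, ap_quasiBasis,
    mul_one, star_self_apply, ap_id] at e
  have e' := congrArg (fun z => ap (ρ_ D.X).hom (ap (D.X ◁ D.evL) (ap (α_ D.X D.XBar D.X).hom
    (ap ((D.totalEquiv a : D.X ≫ D.XBar ⟶ D.X ≫ D.XBar) ▷ D.X) z)))) e
  simp only [map_sum, map_ev, ap_whiskerRight, ap_totalEquiv, ap_ev_xx_xe, mul_one,
    star_self_apply, ← xe_ev] at e'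
  have e1 : ∀ k, ℋ.right.ev (fun u v => ℋ.star D.p (a * (y k * u)) v) (x k) =
      ℋ.left.s (D.p (a * y k)) * x k := fun k => by
    rw [← D.form.star_one, ← D.form.ev_star]
    simp only [mul_assoc, one_mul]
  simp only [e1] at e'
  exact D.xe_injective ((map_sum (AddMonoidHom.mk' D.xe D.xe_add) _ _).trans e')

/-- The symmetry of `𝒳`. -/
def symmetry : HopfAlgebroid (End (D.X ≫ D.XBar)) (End D.X) (End D.XBar) :=
  ℋ.transport D.totalEquiv D.leftBaseEquiv D.rightBaseEquiv

theorem symmetry_S (h : H) : D.symmetry.S (D.totalEquiv h) = D.totalEquiv (ℋ.S h) :=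
  ℋ.transportAntipode_apply D.totalEquiv h

theorem symmetry_S_symm (h : H) :
    D.symmetry.S.symm (D.totalEquiv h) = D.totalEquiv (ℋ.S.symm h) := by
  rw [AddEquiv.symm_apply_eq, symmetry_S, AddEquiv.apply_symm_apply]

theorem isSymmetry : D.frobeniusDual.IsSymmetry D.symmetry where
  sL l := by
    obtain ⟨l, rfl⟩ := D.leftBaseEquiv.surjective l
    exact (ℋ.left.transportS_apply _ _ l).trans (D.leftBaseEquiv_whiskerRight l).symm
  tL l := by
    obtain ⟨l, rfl⟩ := D.leftBaseEquiv.surjective l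
    exact (ℋ.left.transportT_apply _ _ l).trans (D.whiskerLeft_mu l).symm
  γL n y x h c := by
    obtain ⟨c, rfl⟩ := D.totalEquiv.surjective c
    obtain ⟨y, rfl⟩ : ∃ y' : Fin n → H, y = fun k => D.totalEquiv (y' k) :=
      ⟨fun k => D.totalEquiv.symm (y k), by simp⟩
    obtain ⟨x, rfl⟩ : ∃ x' : Fin n → H, x = fun k => D.totalEquiv (x' k) :=
      ⟨fun k => D.totalEquiv.symm (x k), by simp⟩
    refine (ℋ.left.transportγ_apply _ _ c).trans ?_
    rw [D.form.γL_eq_sum (D.sum_of_isQuasiBasis h), map_sum]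
    simp only [symmetry_S_symm, conv_totalEquiv]
    rfl
  πL c := by
    obtain ⟨c, rfl⟩ := D.totalEquiv.surjective c
    refine (ℋ.left.transport_π _ _ c).trans ?_
    rw [integral_eq, ← map_mul, phiL_totalEquiv, D.left, D.form.s_mul, D.form.apply_self, mul_one]
  sR r := by
    obtain ⟨r, rfl⟩ := D.rightBaseEquiv.surjective r
    exact (ℋ.right.transportS_apply _ _ r).trans (D.whiskerLeft_rightBaseEquiv r).symm
  tR l := by
    obtain ⟨l, rfl⟩ := D.leftBaseEquiv.surjective l
    rw [nu_leftBaseEquiv, leftBaseEquiv_whiskerRight]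
    exact (ℋ.right.transportT_apply _ _ _).trans
      (congrArg D.totalEquiv (HopfAlgebroid.tR_baseEquiv_symm l))
  γR n y x h c := by
    obtain ⟨c, rfl⟩ := D.totalEquiv.surjective c
    obtain ⟨y, rfl⟩ : ∃ y' : Fin n → H, y = fun k => D.totalEquiv (y' k) :=
      ⟨fun k => D.totalEquiv.symm (y k), by simp⟩
    obtain ⟨x, rfl⟩ : ∃ x' : Fin n → H, x = fun k => D.totalEquiv (x' k) :=
      ⟨fun k => D.totalEquiv.symm (x k), by simp⟩
    refine (ℋ.right.transportγ_apply _ _ c).trans ?_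
    rw [D.form.γR_eq_sum (D.form.S_self D.left) (D.sum_of_isQuasiBasis h), map_sum]
    simp only [symmetry_S, conv_totalEquiv]
    rfl
  πR c := by
    obtain ⟨c, rfl⟩ := D.totalEquiv.surjective c
    -- With S(c) in place of `c` the inverse antipode disappears, and the claim becomes the formula
    -- `πR_S` for π_R ∘ S.
    obtain ⟨c, rfl⟩ := ℋ.S.surjective c
    refine (ℋ.right.transport_π _ _ _).trans ?_
    rw [symmetry_S_symm, AddEquiv.symm_apply_apply, integral_eq, ← map_mul, phiL_totalEquiv,
      D.left, D.form.s_mul, D.form.apply_self, mul_one, nu_leftBaseEquiv, ℋ.πR_S]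
    rfl
  S c := by
    obtain ⟨c, rfl⟩ := D.totalEquiv.surjective c
    rw [symmetry_S, fourierDotInv_fourier_totalEquiv]

theorem isStrictIso_symmetry : ℋ.IsStrictIso D.symmetry D.totalEquiv D.leftBaseEquiv :=
  ℋ.isStrictIso_transport _ _ _

theorem hom_totalEquiv (h : H) :
    Bim.hom (D.totalEquiv h : D.X ≫ D.XBar ⟶ D.X ≫ D.XBar) ≫
        Bim.m (C := ℋ.right.RMod) (ℋ.convMon D.mon) =
      Bim.m (C := ℋ.right.RMod) (ℋ.convMon D.mon) ≫ ℋ.right.Λ h :=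
  hom_ext <| LinearMap.ext fun x => by
    obtain ⟨k, rfl⟩ := D.xx_surjective x
    change D.mLin (ap (D.totalEquiv h) (D.xx k)) = lin (ℋ.right.Λ h) (D.mLin (D.xx k))
    rw [ap_totalEquiv, mLin_xx, mLin_xx]
    rfl

theorem hom_leftBaseEquiv (l : L) :
    Bim.hom (D.leftBaseEquiv l : D.X ⟶ D.X) = ℋ.right.Λ (ℋ.left.s l) :=
  hom_ext <| LinearMap.ext fun _ => rfl

end FrobeniusIntegral

end FrobeniusIntegralSymmetry

/-! ### Depth two -/

section FrobeniusIntegralDepthTwo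

theorem HopfAlgebroid.S_symm_sL_mul {A L R : Type*} [Ring A] [Ring L] [Ring R]
    {H : HopfAlgebroid A L R} (l : L) (a : A) :
    H.S.symm (H.left.s l * a) = H.S.symm a * H.left.t (op l) := by
  rw [AddEquiv.symm_apply_eq, H.S_mul_tL, AddEquiv.apply_symm_apply]

/-- `g₍₁₎⁽¹⁾ ⊗ S⁻¹(g₍₂₎) g₍₁₎⁽²⁾ = g ⊗ 1`. -/
theorem HopfAlgebroid.ev_ev_S_symm_mul {A L R T : Type*} [Ring A] [Ring L] [Ring R]
    [AddCommGroup T] {H : HopfAlgebroid A L R} {f : A → A → T} (hf : H.right.IsBal f) (g : A) :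
    H.left.ev (fun x y => H.right.ev (fun a b => f a (H.S.symm y * b)) x) g = f g 1 := by
  have hF : H.IsBalRL fun a b y => f a (H.S.symm y * b) :=
    ⟨fun _ _ _ _ => hf.add_left _ _ _, fun _ _ _ _ => by rw [mul_add, hf.add_right],
      fun _ _ _ _ => by rw [map_add, add_mul, hf.add_right], fun _ _ _ _ => by
        rw [hf.bal, mul_assoc], fun _ _ _ _ => by rw [S_symm_sL_mul, mul_assoc]⟩
  have h1 : ∀ a z, H.left.ev (fun b y => f a (H.S.symm y * b)) z =
      f (a * H.right.s (H.right.π z)) 1 := fun a z => by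
    have e : H.left.ev (fun b y => H.S.symm y * b) z = H.right.t (op (H.right.π z)) := by
      apply H.S.injective
      rw [LeftBialgebroid.map_ev, S_tR, ← ev_antipode_left]
      simp only [S_mul, AddEquiv.apply_symm_apply]
    rw [← LeftBialgebroid.ev_isBal_right hf, e, hf.bal, one_mul]
  rw [ev_coassocRL hF]
  simp only [h1]
  rw [← RightBialgebroid.ev_isBal_left hf, RightBialgebroid.ev_counit_right]

open RightBialgebroid RightBialgebroid.RMod Bicategory Bim

variable {H L R : Type u} [Ring H] [Ring L] [Ring R] {ℋ : HopfAlgebroid H L R}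

/-- The chosen representatives of γ_L(g) form a finite set; an enumeration of it supplies the copies
of `Q`. -/
theorem Bim.isSummandOfPower_of_ev {M N : Bim ℋ.right.RMod} {P Q : M ⟶ N} (β : H → H → (P ⟶ Q))
    (β' : H → H → (Q ⟶ P)) (g : H)
    (h : ∀ p : El P, ℋ.left.ev (fun x y => ap (β' x y) (ap (β x y) p)) g = p) :
    IsSummandOfPower P Q := by
  let s := Bal.rep (ℋ.left.γ g)
  refine ⟨s.card, fun k => β (s.equivFin.symm k).1.1 (s.equivFin.symm k).1.2,
    fun k => β' (s.equivFin.symm k).1.1 (s.equivFin.symm k).1.2, ap_ext fun p => ?_⟩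
  rw [ap_sum_apply, ap_id]
  refine Eq.trans ?_ (h p)
  refine (Equiv.sum_comp s.equivFin.symm
    fun q : s => ap (β q.1.1 q.1.2 ≫ β' q.1.1 q.1.2) p).trans ?_
  exact Finset.sum_coe_sort s fun q => ap (β q.1 q.2 ≫ β' q.1 q.2) p

namespace FrobeniusIntegral

variable (D : FrobeniusIntegral ℋ)

/-- Replace iv by i s_Rπ_R(v), move the scalar into the first leg, and apply the counit axiom. -/
theorem ev_integral_mul_right (a b : H) :
    ℋ.right.ev (fun u v => tm (D.xx u) (D.xe (ℋ.star D.p (D.i * v) b))) a =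
      tm (D.xx a) (D.xe b) := by
  have e : ∀ u v, tm (D.xx u) (D.xe (ℋ.star D.p (D.i * v) b)) =
      tm (D.xx (u * ℋ.right.s (ℋ.right.π v))) (D.xe b) := fun u v => by
    rw [D.right v, D.form.star_mul_sR, self_star_apply, ← smul_xe, ← tm_smul_balance, smul_xx]
  simp only [e]
  rw [← tm_ev_left, ← xx_ev, ev_counit_right]

theorem ev_integral_mul_left (a k : H) :
    ℋ.right.ev (fun u v => tm (D.xb (ℋ.star D.p a (D.i * u))) (D.xx v)) k =
      tm (D.xb a) (D.xx k) := by
  have e : ∀ u v, tm (D.xb (ℋ.star D.p a (D.i * u))) (D.xx v) =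
      tm (D.xb a) (D.xx (v * ℋ.right.t (op (ℋ.right.π u)))) := fun u v => by
    rw [D.right u, D.form.star_mul_right_sR, star_self_apply, ← smul_xb, tm_smul_balance, smul_xx]
  simp only [e]
  rw [← tm_ev_right, ← xx_ev, ev_counit_left]

/-- This says that the pairs (S(i₍₁₎), i₍₂₎) form a D2 quasi-basis. The coproduct of (i₍₂₎a) ∗ b is
that of i₍₂₎a with its second leg multiplied by `b`, and S(i₍₁₎)i₍₂₎⁽¹⁾ ⊗ i₍₂₎⁽²⁾ collapses to 1 ⊗
i. -/
theorem left_ev_xx_xe (a b : H) :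
    ℋ.left.ev (fun p q => ℋ.right.ev (fun u v => tm (D.xx (ℋ.S p * u)) (D.xe v))
      (ℋ.star D.p (q * a) b)) D.i = tm (D.xx a) (D.xe b) := by
  have hb : ℋ.right.IsBal fun u v => tm (D.xx u) (D.xe (ℋ.star D.p v b)) :=
    isBal_tm D.xx_add (fun _ _ => (D.smul_xx _ _).symm)
      (fun _ _ => by rw [D.form.star_add_left, xe_add])
      (fun _ _ => by rw [D.form.star_mul_tR, smul_xe])
  have e : ∀ p q, ℋ.right.ev (fun u v => tm (D.xx (ℋ.S p * u)) (D.xe v)) (ℋ.star D.p (q * a) b) =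
      ℋ.right.ev (fun x z => ℋ.right.ev (fun u v => tm (D.xx (ℋ.S p * x * u))
        (D.xe (ℋ.star D.p (z * v) b))) a) q := fun p q => by
    rw [D.form.ev_star_left (isBal_mul_left D.isBal_xx_xe _), ev_mul (isBal_mul_left hb _)]
    simp only [mul_assoc]
  simp only [e]
  refine (HopfAlgebroid.ev_ev_S_mul (HopfAlgebroid.isBal_ev_mul_mul_right hb a) D.i).trans ?_
  simp only [one_mul]
  exact D.ev_integral_mul_right a b

/-- The mirror image, with S⁻¹(i₍₂₎) and i₍₁₎: here i₍₁₎⁽¹⁾ ⊗ S⁻¹(i₍₂₎)i₍₁₎⁽²⁾ collapses to i ⊗ 1.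
-/
theorem left_ev_xb_xx (a k : H) :
    ℋ.left.ev (fun p q => ℋ.right.ev (fun u v => tm (D.xb u) (D.xx (ℋ.S.symm q * v)))
      (ℋ.star D.p a (p * k))) D.i = tm (D.xb a) (D.xx k) := by
  have hb : ℋ.right.IsBal fun u v => tm (D.xb (ℋ.star D.p a u)) (D.xx v) :=
    isBal_tm (fun _ _ => by rw [D.form.star_add_right, xb_add])
      (fun _ _ => by rw [D.form.star_mul_right_sR, smul_xb])
      D.xx_add (fun _ _ => (D.smul_xx _ _).symm)
  have e : ∀ p q, ℋ.right.ev (fun u v => tm (D.xb u) (D.xx (ℋ.S.symm q * v)))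
      (ℋ.star D.p a (p * k)) = ℋ.right.ev (fun x z => ℋ.right.ev
        (fun u v => tm (D.xb (ℋ.star D.p a (x * u))) (D.xx (ℋ.S.symm q * z * v))) k) p :=
    fun p q => by
    rw [D.form.ev_star_right (isBal_mul_right D.isBal_xb_xx _), ev_mul (isBal_mul_right hb _)]
    simp only [mul_assoc]
  simp only [e]
  refine (HopfAlgebroid.ev_ev_S_symm_mul (HopfAlgebroid.isBal_ev_mul_mul_right hb k) D.i).trans ?_
  simp only [one_mul]
  exact D.ev_integral_mul_left a k

theorem isDepthTwo : IsDepthTwo D.X D.XBar := by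
  constructor
  · refine isSummandOfPower_of_ev
      (fun _ x => (D.totalEquiv x : D.X ≫ D.XBar ⟶ D.X ≫ D.XBar) ▷ D.X ≫
        (α_ D.X D.XBar D.X).hom ≫ D.X ◁ D.evL ≫ (ρ_ D.X).hom)
      (fun y _ => (ρ_ D.X).inv ≫ D.X ◁ D.coevR ≫ (α_ D.X D.XBar D.X).inv ≫
        (D.totalEquiv (ℋ.S y) : D.X ≫ D.XBar ⟶ D.X ≫ D.XBar) ▷ D.X) D.i fun p => ?_
    induction p using tm_induction with
    | h0 =>
      simp only [map_zero]
      exact Finset.sum_const_zero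
    | ht a b =>
      obtain ⟨a, rfl⟩ := D.xx_surjective a
      obtain ⟨b, rfl⟩ := D.xe_surjective b
      simp only [ap_comp, ap_whiskerRight, ap_totalEquiv, ap_ev_xx_xe, ap_coev_xe, map_ev]
      exact D.left_ev_xx_xe a b
    | ha p q hp hq =>
      simp only [map_add]
      rw [LeftBialgebroid.ev_add_fun, hp, hq]
  · refine isSummandOfPower_of_ev
      (fun x _ => (α_ D.XBar D.X D.XBar).hom ≫
        D.XBar ◁ (D.totalEquiv x : D.X ≫ D.XBar ⟶ D.X ≫ D.XBar) ≫ (α_ D.XBar D.X D.XBar).inv ≫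
        D.evL ▷ D.XBar ≫ (λ_ D.XBar).hom)
      (fun _ y => (λ_ D.XBar).inv ≫ D.coevR ▷ D.XBar ≫ (α_ D.XBar D.X D.XBar).hom ≫
        D.XBar ◁ (D.totalEquiv (ℋ.S.symm y) : D.X ≫ D.XBar ⟶ D.X ≫ D.XBar) ≫
          (α_ D.XBar D.X D.XBar).inv) D.i fun p => ?_
    -- Elements are rebracketed so that the last two factors form a single `xx k`.
    obtain ⟨q, rfl⟩ : ∃ q, ap (α_ D.XBar D.X D.XBar).inv q = p := ⟨_, ap_hom_inv _ p⟩
    induction q using tm_induction with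
    | h0 =>
      simp only [map_zero]
      exact Finset.sum_const_zero
    | ht a k =>
      obtain ⟨a, rfl⟩ := D.xb_surjective a
      obtain ⟨k, rfl⟩ := D.xx_surjective k
      simp only [ap_comp, ap_inv_hom, ap_whiskerLeft, ap_totalEquiv, ap_ev_xb_xx, ap_coev_xb,
        map_ev]
      rw [← D.left_ev_xb_xx a k]
      simp only [LeftBialgebroid.map_ev, map_ev]
    | ha p q hp hq =>
      simp only [map_add] at hp hq ⊢
      rw [LeftBialgebroid.ev_add_fun, hp, hq]

end FrobeniusIntegral

end FrobeniusIntegralDepthTwo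

/-! ### The integral in the symmetry of an abstract D2 Frobenius 1-morphism -/

section AbstractSymmetry

open Bicategory

namespace FrobeniusDual

variable {C : Type u₁} [Bicategory.{w, v} C] {a b : C} {ι : a ⟶ b} {ι' : b ⟶ a}
  (F : FrobeniusDual ι ι')

/-- The mate of a 2-morphism `P → ι × ι'` with respect to the first adjunction. -/
def hat {P : a ⟶ a} (x : P ⟶ ι ≫ ι') : P ≫ ι ⟶ ι :=
  x ▷ ι ≫ (α_ ι ι' ι).hom ≫ ι ◁ F.evL ≫ (ρ_ ι).hom

/-- The inverse of `hat`. -/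
def unhat {P : a ⟶ a} (x : P ≫ ι ⟶ ι) : P ⟶ ι ≫ ι' :=
  (ρ_ P).inv ≫ P ◁ F.coevL ≫ (α_ P ι ι').inv ≫ x ▷ ι'

/-- The mate of a 2-morphism `ι × ι' → P` with respect to the second adjunction. -/
def check {P : a ⟶ a} (y : ι ≫ ι' ⟶ P) : ι ⟶ P ≫ ι :=
  (ρ_ ι).inv ≫ ι ◁ F.coevR ≫ (α_ ι ι' ι).inv ≫ y ▷ ι

/-- The inverse of `check`. -/
def uncheck {P : a ⟶ a} (y : ι ⟶ P ≫ ι) : ι ≫ ι' ⟶ P :=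
  y ▷ ι' ≫ (α_ P ι ι').hom ≫ P ◁ F.evR ≫ (ρ_ P).hom

/-- As for the next three lemmas, the exchange law brings a unit and a counit next to each other,
and a triangle identity removes them. -/
theorem unhat_hat {P : a ⟶ a} (x : P ⟶ ι ≫ ι') : F.unhat (F.hat x) = x := by
  calc F.unhat (F.hat x) = 𝟙 _ ⊗≫ (P ◁ F.coevL ≫ x ▷ (ι ≫ ι')) ⊗≫ ι ◁ F.evL ▷ ι' ⊗≫ 𝟙 _ := by
        simp only [unhat, hat]; bicategory
    _ = x ⊗≫ ι ◁ (rightZigzag F.coevL F.evL) ⊗≫ 𝟙 _ := by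
        rw [whisker_exchange]; bicategory
    _ = x := by rw [F.adjL.right_triangle]; bicategory

theorem hat_unhat {P : a ⟶ a} (x : P ≫ ι ⟶ ι) : F.hat (F.unhat x) = x := by
  calc F.hat (F.unhat x) = 𝟙 _ ⊗≫ P ◁ F.coevL ▷ ι ⊗≫ (x ▷ (ι' ≫ ι) ≫ ι ◁ F.evL) ⊗≫ 𝟙 _ := by
        simp only [unhat, hat]; bicategory
    _ = 𝟙 _ ⊗≫ P ◁ (leftZigzag F.coevL F.evL) ⊗≫ x ⊗≫ 𝟙 _ := by
        rw [← whisker_exchange]; bicategory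
    _ = x := by rw [F.adjL.left_triangle]; bicategory

theorem uncheck_check {P : a ⟶ a} (y : ι ≫ ι' ⟶ P) : F.uncheck (F.check y) = y := by
  calc F.uncheck (F.check y) =
        𝟙 _ ⊗≫ ι ◁ F.coevR ▷ ι' ⊗≫ (y ▷ (ι ≫ ι') ≫ P ◁ F.evR) ⊗≫ 𝟙 _ := by
        simp only [uncheck, check]; bicategory
    _ = 𝟙 _ ⊗≫ ι ◁ (leftZigzag F.coevR F.evR) ⊗≫ y ⊗≫ 𝟙 _ := by
        rw [← whisker_exchange]; bicategory
    _ = y := by rw [F.adjR.left_triangle]; bicategory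

theorem check_uncheck {P : a ⟶ a} (y : ι ⟶ P ≫ ι) : F.check (F.uncheck y) = y := by
  calc F.check (F.uncheck y) =
        𝟙 _ ⊗≫ (ι ◁ F.coevR ≫ y ▷ (ι' ≫ ι)) ⊗≫ P ◁ F.evR ▷ ι ⊗≫ 𝟙 _ := by
        simp only [uncheck, check]; bicategory
    _ = y ⊗≫ P ◁ (rightZigzag F.coevR F.evR) ⊗≫ 𝟙 _ := by
        rw [whisker_exchange]; bicategory
    _ = y := by rw [F.adjR.right_triangle]; bicategory

theorem hat_injective {P : a ⟶ a} : Function.Injective (F.hat (P := P)) :=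
  Function.LeftInverse.injective F.unhat_hat

theorem check_injective {P : a ⟶ a} : Function.Injective (F.check (P := P)) :=
  Function.LeftInverse.injective F.uncheck_check

theorem hat_comp {P Q : a ⟶ a} (f : P ⟶ Q) (x : Q ⟶ ι ≫ ι') : F.hat (f ≫ x) = f ▷ ι ≫ F.hat x := by
  simp [hat]

theorem hat_whiskerRight {P : a ⟶ a} (x : P ⟶ ι ≫ ι') (l : ι ⟶ ι) :
    F.hat (x ≫ l ▷ ι') = F.hat x ≫ l := by
  simp only [hat, comp_whiskerRight, Category.assoc, associator_naturality_left_assoc]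
  rw [← whisker_exchange_assoc, rightUnitor_naturality]

theorem check_comp {P Q : a ⟶ a} (y : ι ≫ ι' ⟶ P) (f : P ⟶ Q) :
    F.check (y ≫ f) = F.check y ≫ f ▷ ι := by
  simp [check]

theorem check_whiskerRight {P : a ⟶ a} (l : ι ⟶ ι) (y : ι ≫ ι' ⟶ P) :
    F.check (l ▷ ι' ≫ y) = l ≫ F.check y := by
  simp only [check, comp_whiskerRight]
  rw [← associator_inv_naturality_left_assoc, whisker_exchange_assoc,
    rightUnitor_inv_naturality_assoc]

/-- Cut in the middle, φ_L is the pairing of the two kinds of mates. Through this, relations between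
mates become statements about φ_L. -/
theorem phiL_comp (y x : ι ≫ ι' ⟶ ι ≫ ι') : F.phiL (y ≫ x) = F.check y ≫ F.hat x := by
  simp [phiL, check, hat]

theorem hat_coevL : F.hat F.coevL = (λ_ ι).hom := by
  have h := F.adjL.left_triangle
  rw [FrobeniusIntegral.leftZigzag_eq] at h
  simp [hat, reassoc_of% h]

theorem check_evR : F.check F.evR = (λ_ ι).inv := by
  have h := F.adjR.right_triangle
  rw [FrobeniusIntegral.rightZigzag_eq] at h
  simp [check, h]

/-- This is the left integral property. The mate of coev_L is a unitor, so every 2-morphism 1 → ι ×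
ι̅ is coev_L followed by l × ι̅ for some l; for coev_L followed by `c`, this l is read off by
`phiL_comp`. -/
theorem integral_comp (c : ι ≫ ι' ⟶ ι ≫ ι') :
    F.integral ≫ c = F.integral ≫ (F.phiL (F.integral ≫ c) : ι ⟶ ι) ▷ ι' := by
  have e : F.coevL ≫ c = F.coevL ≫ (F.phiL (F.integral ≫ c) : ι ⟶ ι) ▷ ι' := by
    apply F.hat_injective
    have := F.phiL_comp (F.evR ≫ F.coevL) c
    rw [hat_whiskerRight, hat_coevL, integral, this, check_comp, check_evR, Category.assoc,
      Iso.hom_inv_id_assoc, hat_comp]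
  simp only [integral, Category.assoc] at e ⊢
  rw [← e]

/-- The integral factors as ev_R followed by coev_L; the convolution product closes these with
coev_R and ev_L by two triangle identities, and `y` remains. -/
theorem conv_integral (y : ι ≫ ι' ⟶ ι ≫ ι') : F.conv F.integral y = y := by
  have h1 := F.check_evR
  have h2 := F.hat_coevL
  simp only [check, hat] at h1 h2
  calc F.conv F.integral y = 𝟙 _ ⊗≫ ((ρ_ ι).inv ≫ ι ◁ F.coevR ≫ (α_ ι ι' ι).inv ≫ F.evR ▷ ι) ▷ ι' ⊗≫
        (F.coevL ▷ (ι ≫ ι') ≫ (ι ≫ ι') ◁ y) ⊗≫ (ι ◁ F.evL) ▷ ι' ⊗≫ 𝟙 _ := by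
        simp only [conv, integral]; bicategory
    _ = 𝟙 _ ⊗≫ y ⊗≫ (F.coevL ▷ ι ≫ (α_ ι ι' ι).hom ≫ ι ◁ F.evL ≫ (ρ_ ι).hom) ▷ ι' ⊗≫ 𝟙 _ := by
        rw [h1, ← whisker_exchange]; bicategory
    _ = y := by rw [h2]; bicategory

/-- Again two triangle identities. Together with `fourierDotInv_one` this shows that the antipode of
the symmetry fixes i_A. -/
theorem fourier_integral : F.fourier F.integral = 𝟙 _ := by
  calc F.fourier F.integral = 𝟙 _ ⊗≫ (leftZigzag F.coevR F.evR) ▷ ι ⊗≫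
        ι' ◁ (leftZigzag F.coevL F.evL) ⊗≫ 𝟙 _ := by
        simp only [fourier, integral]; bicategory
    _ = 𝟙 _ := by rw [F.adjL.left_triangle, F.adjR.left_triangle]; bicategory

theorem fourierDotInv_one : F.fourierDotInv (𝟙 _) = F.integral := by
  calc F.fourierDotInv (𝟙 _) = 𝟙 _ ⊗≫ (F.coevL ▷ (ι ≫ ι') ≫ (ι ≫ ι') ◁ F.evR) ⊗≫ 𝟙 _ := by
        simp only [fourierDotInv]; bicategory
    _ = F.integral := by rw [← whisker_exchange, integral]; bicategory

theorem phiL_mul_whiskerRight (x : ι ≫ ι' ⟶ ι ≫ ι') (l : ι ⟶ ι) :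
    F.phiL (x ≫ l ▷ ι') = F.phiL x ≫ l := by
  have h := F.phiL_comp (𝟙 _) (x ≫ l ▷ ι')
  have h' := F.phiL_comp (𝟙 _) x
  rw [Category.id_comp] at h h'
  rw [h, h', hat_whiskerRight, Category.assoc]

theorem phiL_whiskerRight_mul (x : ι ≫ ι' ⟶ ι ≫ ι') (l : ι ⟶ ι) :
    F.phiL (l ▷ ι' ≫ x) = l ≫ F.phiL x := by
  have h := F.phiL_comp (l ▷ ι' ≫ x) (𝟙 _)
  have h' := F.phiL_comp x (𝟙 _)
  rw [Category.comp_id] at h h'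
  rw [h, h', check_whiskerRight, Category.assoc]

variable [PreadditiveBicategory C]

theorem phiL_add (x y : ι ≫ ι' ⟶ ι ≫ ι') : F.phiL (x + y) = F.phiL x + F.phiL y := by
  simp only [phiL, PreadditiveBicategory.add_whiskerRight, Preadditive.add_comp,
    Preadditive.comp_add]

/-- The map `φ_L` as an additive map. -/
def phiLHom : End (ι ≫ ι') →+ End ι := AddMonoidHom.mk' F.phiL F.phiL_add

/-- In terms of mates a quasi-basis is a factorization of the identity of ι × ι̅ × ι through copies
of ι. Hence the first half of the D2 condition provides one. -/
theorem isQuasiBasis_iff {n : ℕ} (y x : Fin n → End (ι ≫ ι')) :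
    F.IsQuasiBasis y x ↔ ∑ k, F.hat (x k) ≫ F.check (y k) = 𝟙 _ := by
  have : ∀ k, F.hat (x k) ≫ F.check (y k) = (x k : ι ≫ ι' ⟶ ι ≫ ι') ▷ ι ≫ (α_ ι ι' ι).hom ≫
      ι ◁ F.evL ≫ ι ◁ F.coevR ≫ (α_ ι ι' ι).inv ≫ (y k : ι ≫ ι' ⟶ ι ≫ ι') ▷ ι := fun k => by
    simp [hat, check]
  simp only [IsQuasiBasis, this]

theorem exists_isQuasiBasis (h : IsDepthTwo ι ι') :
    ∃ (n : ℕ) (y x : Fin n → End (ι ≫ ι')), F.IsQuasiBasis y x := by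
  obtain ⟨n, β, β', hβ⟩ := h.1
  refine ⟨n, fun k => F.uncheck (β' k), fun k => F.unhat (β k), (F.isQuasiBasis_iff _ _).2 ?_⟩
  simpa only [hat_unhat, check_uncheck] using hβ

variable {F} in
-- Pass to mates: the terms become `hat (x k) ≫ check (y k) ≫ hat c`, and the quasi-basis identity
-- collapses their sum. So `x` and `y` are dual bases for φ_L.
theorem IsQuasiBasis.sum_left {n : ℕ} {y x : Fin n → End (ι ≫ ι')} (h : F.IsQuasiBasis y x)
    (c : End (ι ≫ ι')) : ∑ k, (x k : ι ≫ ι' ⟶ ι ≫ ι') ≫ (F.phiL (c * y k) : ι ⟶ ι) ▷ ι' = c := by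
  rw [isQuasiBasis_iff] at h
  apply F.hat_injective
  have hs : ∀ f : Fin n → End (ι ≫ ι'), F.hat (∑ k, f k) = ∑ k, F.hat (f k) := fun f =>
    map_sum (AddMonoidHom.mk' (fun x : ι ≫ ι' ⟶ ι ≫ ι' => F.hat x) fun x y => by
      simp only [hat, PreadditiveBicategory.add_whiskerRight, Preadditive.add_comp]) f _
  rw [hs]
  simp only [hat_whiskerRight, End.mul_def, phiL_comp, ← Category.assoc]
  rw [← Preadditive.sum_comp, h, Category.id_comp]

variable {F} in
theorem IsQuasiBasis.sum_right {n : ℕ} {y x : Fin n → End (ι ≫ ι')} (h : F.IsQuasiBasis y x)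
    (c : End (ι ≫ ι')) : ∑ k, (F.phiL (x k * c) : ι ⟶ ι) ▷ ι' ≫ (y k : ι ≫ ι' ⟶ ι ≫ ι') = c := by
  rw [isQuasiBasis_iff] at h
  apply F.check_injective
  have hs : ∀ f : Fin n → End (ι ≫ ι'), F.check (∑ k, f k) = ∑ k, F.check (f k) := fun f =>
    map_sum (AddMonoidHom.mk' (fun x : ι ≫ ι' ⟶ ι ≫ ι' => F.check x) fun x y => by
      simp only [check, PreadditiveBicategory.add_whiskerRight, Preadditive.comp_add]) f _
  rw [hs]
  simp only [check_whiskerRight, End.mul_def, phiL_comp, Category.assoc]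
  rw [← Preadditive.comp_sum, h, Category.comp_id]

variable {F} in
/-- A Hopf algebroid which is strictly isomorphic to a symmetry has a Frobenius integral. -/
theorem IsSymmetry.exists_frobeniusIntegral (h2 : IsDepthTwo ι ι')
    {𝒜 : HopfAlgebroid (End (ι ≫ ι')) (End ι) (End ι')} (h𝒜 : F.IsSymmetry 𝒜)
    {A L R : Type*} [Ring A] [Ring L] [Ring R] {ℋ : HopfAlgebroid A L R}
    {Φ : A ≃+* End (ι ≫ ι')} {φ : L ≃+* End ι} (h : ℋ.IsStrictIso 𝒜 Φ φ) :
    ∃ i p, ℋ.IsFrobeniusForm i p ∧ ℋ.IsLeftIntegral i ∧ ℋ.IsRightIntegral i := by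
  obtain ⟨n, y, x, hyx⟩ := F.exists_isQuasiBasis h2
  -- The integral is i_A and its form is φ_L, both carried back along the strict isomorphism.
  let i : A := Φ.symm F.integral
  let p : A →+ L := (toAdd φ.symm).comp (F.phiLHom.comp (toAdd Φ))
  have hi : Φ i = F.integral := Φ.apply_symm_apply _
  have hp : ∀ c, φ (p c) = F.phiL (Φ c) := fun c => φ.apply_symm_apply _
  have hs : ∀ l, Φ (ℋ.left.s l) = (φ l : ι ⟶ ι) ▷ ι' := fun l =>
    (h.isHom.s l).symm.trans (h𝒜.sL (φ l))
  have hS : ℋ.S i = i := Φ.injective <| by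
    rw [h.antipode, hi, h𝒜.S, fourier_integral, fourierDotInv_one]
  have hleft : ℋ.IsLeftIntegral i := fun c => Φ.injective <| by
    have e : φ (ℋ.left.π c) = F.phiL (Φ c * F.integral) := (h.isHom.π c).symm.trans (h𝒜.πL _)
    rw [map_mul, map_mul, hs, hi, e]
    exact F.integral_comp (Φ c)
  have hγ : ℋ.left.γ i = ∑ k, Bal.mk _ _ (ℋ.S.symm (Φ.symm (y k)) ⊗ₜ Φ.symm (x k)) := by
    -- `IsHom` expresses the coproduct of `𝒜` by that of `ℋ`; `G` carries the formula back. The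
    -- first legs simplify because i_A is the unit of the convolution product.
    let G : LTensor 𝒜.left.s 𝒜.left.t →+ LTensor ℋ.left.s ℋ.left.t :=
      Bal.map (toAdd Φ.symm) (toAdd Φ.symm) φ.symm
        (fun c l => by
          obtain ⟨l, rfl⟩ := φ.surjective l
          have e := h.isHom.t l
          simp only [RingEquiv.coe_toRingHom] at e
          simp [e, -End.mul_def])
        (fun l c => by
          obtain ⟨l, rfl⟩ := φ.surjective l
          have e := h.isHom.s l
          simp only [RingEquiv.coe_toRingHom] at e
          simp [e, -End.mul_def])
    have e := (h.isHom.γ i _ (Bal.mk_repT _)).symm.trans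
      ((congrArg 𝒜.left.γ hi).trans (h𝒜.γL n y x hyx F.integral))
    have e' := congrArg G e
    rw [map_sum] at e'
    refine ((Bal.mk_repT _).symm.trans (congrArg _ (tmap_symm Φ.symm _).symm)).trans (e'.trans ?_)
    refine Finset.sum_congr rfl fun k _ => congrArg (fun z => Bal.mk _ _ (z ⊗ₜ Φ.symm (x k))) ?_
    refine (congrArg Φ.symm (F.conv_integral (𝒜.S.symm (y k)))).trans ?_
    rw [RingEquiv.symm_apply_eq, AddEquiv.symm_apply_eq, ← h.antipode, AddEquiv.apply_symm_apply,
      RingEquiv.apply_symm_apply]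
  have hev : ∀ f : A → A → A, ℋ.left.IsBal f →
      ℋ.left.ev f i = ∑ k, f (ℋ.S.symm (Φ.symm (y k))) (Φ.symm (x k)) := fun f hf => by
    rw [LeftBialgebroid.ev, hγ, Bal.sw_eq_lift hf, map_sum]
    rfl
  have hsm : ∀ l c, p (ℋ.left.s l * c) = l * p c := fun l c => φ.injective <| by
    rw [hp, map_mul, map_mul, hp, hs]
    exact F.phiL_mul_whiskerRight (Φ c) (φ l)
  have hms : ∀ l c, p (c * ℋ.left.s l) = p c * l := fun l c => φ.injective <| by
    rw [hp, map_mul, map_mul, hp, hs]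
    exact F.phiL_whiskerRight_mul (Φ c) (φ l)
  -- Since S fixes `i` and turns left integrals into right ones, `i` is two-sided.
  refine ⟨i, p, ⟨hsm, hms, fun k => ?_, fun k => ?_⟩, hleft, hS ▸ hleft.S⟩
  · refine (hev _ (LeftBialgebroid.isBal_t_mul_of_LDual (HopfAlgebroid.dualOf hsm k))).trans ?_
    -- Under S the terms t_L(p(x_jS(k)))S⁻¹(y_j) become y_j s_L(p(x_jS(k))), whose sum is S(k) by
    -- `sum_right`.
    apply ℋ.S.injective
    apply Φ.injective
    rw [map_sum, map_sum]
    refine Eq.trans (Finset.sum_congr rfl fun j _ => ?_) (hyx.sum_right (Φ (ℋ.S k)))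
    rw [HopfAlgebroid.S_tL_mul, AddEquiv.apply_symm_apply, map_mul, hs, HopfAlgebroid.dualOf_apply,
      hp, map_mul, RingEquiv.apply_symm_apply, RingEquiv.apply_symm_apply]
    rfl
  · have hb : ℋ.left.IsBal fun c d => ℋ.left.s (p (k * ℋ.S c)) * d :=
      ⟨fun _ _ _ => by rw [map_add, mul_add, map_add, map_add, add_mul],
        fun _ _ _ => mul_add _ _ _,
        fun _ _ _ => by rw [HopfAlgebroid.S_tL_mul, ← mul_assoc, hms, map_mul, mul_assoc]⟩
    rw [hev _ hb]
    apply Φ.injective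
    rw [map_sum]
    refine Eq.trans (Finset.sum_congr rfl fun j _ => ?_) (hyx.sum_left (Φ k))
    rw [AddEquiv.apply_symm_apply, map_mul, hs, hp, map_mul, RingEquiv.apply_symm_apply,
      RingEquiv.apply_symm_apply]
    rfl

end FrobeniusDual

theorem exists_of_arisesAsSymmetry {A L R : Type*} [Ring A] [Ring L] [Ring R]
    {ℋ : HopfAlgebroid A L R} (h : ArisesAsSymmetry.{v, w, u₁} ℋ) :
    ∃ i : A, ℋ.IsLeftIntegral i ∧ ℋ.IsRightIntegral i ∧
      ℋ.IsLeftNondegenerate i ∧ ℋ.IsRightNondegenerate i := by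
  obtain ⟨C, _, _, _, a, b, ι, ι', F, h2, 𝒜, Φ, φ, h𝒜, hΦ⟩ := h
  obtain ⟨i, p, hp, hl, hr⟩ := h𝒜.exists_frobeniusIntegral h2 hΦ
  exact ⟨i, hl, hr, (HopfAlgebroid.nondegenerate_of_twoSided hl hr
    (Or.inr hp.isRightNondegenerate)).2⟩

end AbstractSymmetry

end

end Algebroid

/-! ### The main theorem -/

theorem mainTheorem4 {H L R : Type u} [Ring H] [Ring L] [Ring R] (ℋ : HopfAlgebroid H L R) :
    (∀ i : H, ℋ.IsRightIntegral i → ℋ.IsRightNondegenerate i →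
      (ℋ.S i = i ↔ ℋ.IsLeftIntegral i) ∧
      (ℋ.S i = i →
        IsAdditiveBicategory (Bim ℋ.right.RMod) ∧
        ∃ m : MonObj ℋ.right.regObj, ℋ.IsConvolution i m ∧
        ∃ F : FrobeniusDual (Bim.X (ℋ.convMon m)) (Bim.XBar (ℋ.convMon m)),
          Bim.IsCanonicalDual (ℋ.convMon m) ℋ.right.comulHom ℋ.right.counitHom F ∧
          IsDepthTwo (Bim.X (ℋ.convMon m)) (Bim.XBar (ℋ.convMon m)) ∧
          ∃ 𝒜 : HopfAlgebroid (End (Bim.X (ℋ.convMon m) ≫ Bim.XBar (ℋ.convMon m)))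
              (End (Bim.X (ℋ.convMon m))) (End (Bim.XBar (ℋ.convMon m))),
            F.IsSymmetry 𝒜 ∧
            ∃ (Φ : H ≃+* End (Bim.X (ℋ.convMon m) ≫ Bim.XBar (ℋ.convMon m)))
              (φ : L ≃+* End (Bim.X (ℋ.convMon m))),
              (∀ h, Bim.hom (Φ h) ≫ Bim.m (ℋ.convMon m) =
                Bim.m (ℋ.convMon m) ≫ ℋ.right.Λ h) ∧
              (∀ l, Bim.hom (φ l) = ℋ.right.Λ (ℋ.left.s l)) ∧
              ℋ.IsStrictIso 𝒜 Φ φ)) ∧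
    (ArisesAsSymmetry.{u + 1, u, u + 1} ℋ ↔
      ∃ i : H, ℋ.IsLeftIntegral i ∧ ℋ.IsRightIntegral i ∧
        (ℋ.IsLeftNondegenerate i ∨ ℋ.IsRightNondegenerate i)) ∧
    (ArisesAsSymmetry.{v, w, u₁} ℋ →
      ∃ i : H, ℋ.IsLeftIntegral i ∧ ℋ.IsRightIntegral i ∧
        ℋ.IsLeftNondegenerate i ∧ ℋ.IsRightNondegenerate i) := by
  have part : ∀ i : H, ℋ.IsRightIntegral i → ℋ.IsRightNondegenerate i → ℋ.IsLeftIntegral i →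
      ∃ D : FrobeniusIntegral ℋ, D.i = i := fun i hr hn hl => by
    obtain ⟨p, hp⟩ := hr.exists_isFrobeniusForm hn
    exact ⟨⟨i, p, hp, hl, hr⟩, rfl⟩
  have arises : ∀ i : H, ℋ.IsLeftIntegral i → ℋ.IsRightIntegral i →
      (ℋ.IsLeftNondegenerate i ∨ ℋ.IsRightNondegenerate i) →
        ArisesAsSymmetry.{u + 1, u, u + 1} ℋ := fun i hl hr hn => by
    -- A two-sided integral that is non-degenerate on either side is right non-degenerate, so it
    -- carries a Frobenius form.
    obtain ⟨D, -⟩ := part i hr (HopfAlgebroid.nondegenerate_of_twoSided hl hr hn).2.2 hl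
    exact ⟨Bim ℋ.right.RMod, inferInstance, inferInstance, inferInstance, D.U, D.Q, D.X, D.XBar,
      D.frobeniusDual, D.isDepthTwo, D.symmetry, D.totalEquiv, D.leftBaseEquiv, D.isSymmetry,
      D.isStrictIso_symmetry⟩
  refine ⟨fun i hr hn => ⟨hr.S_eq_iff hn, fun hS => ?_⟩,
    ⟨fun h => ?_, fun ⟨i, hl, hr, hn⟩ => arises i hl hr hn⟩, exists_of_arisesAsSymmetry⟩
  · obtain ⟨D, rfl⟩ := part i hr hn ((hr.S_eq_iff hn).1 hS)
    exact ⟨inferInstance, D.mon, D.isConvolution, D.frobeniusDual, D.isCanonicalDual,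
      D.isDepthTwo, D.symmetry, D.isSymmetry, D.totalEquiv, D.leftBaseEquiv, D.hom_totalEquiv,
      D.hom_leftBaseEquiv, D.isStrictIso_symmetry⟩
  · obtain ⟨i, hl, hr, hn, -⟩ := exists_of_arisesAsSymmetry h
    exact ⟨i, hl, hr, Or.inl hn⟩
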